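/- **Setting.** Let $\mathcal G=(V,E,p)$ be a finite simple undirected graph with at least one edge, in which each edge $e$ is present independently with probability $p_e\in[0,1]$. For a subgraph $\mathcal H$, a vertex $u$ and an integer $k\ge 1$, let $k\text{-}prob(u,\mathcal H)=\Pr(\deg(u,\mathcal H)\ge k)$. The $k$-core is the largest subgraph in which every vertex has degree at least $k$ (edge probabilities ignored), and $k_{\max}$ is the largest $k$ for which the $k$-core is non-empty. Let $\deg(u,\mathcal G)$ be the number of neighbours of $u$. A $(k,\eta)$-core is a maximal connected induced subgraph $\mathcal H$ with $k\text{-}prob(u,\mathcal H)\ge\eta$ for all its vertices $u$. The $\eta$-threshold $\eta\text{-}thres_k(u)$ is the largest $\eta$ for which $u$ lies in a $(k,\eta)$-core. The UCF-Index consists, for every $1\le k\le k_{\max}$, of the $\eta$-tree (forest) of $k$. Its nodes are sets of vertices with equal $\eta$-threshold, and the subtrees list the vertex sets of the connected components of the subgraphs induced by $\{u:\eta\text{-}thres_k(u)\ge\eta\}$. **The algorithm OptiUCF.** Sort the adjacency lists by probability, in non-increasing order, and determine $k_{\max}$. For $k=k_{\max},\dots,1$ do the following. 1. Let $\mathcal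 G'$ be the $k$-core of $\mathcal G$. Let $\eta_1<\dots<\eta_l$ be the distinct $\eta$-thresholds found in the iteration for $k+1$ (none if $k=k_{\max}$), and let the layer $P(k,i)$ be the set of vertices with threshold $\eta_i$. The working set $V_w$ initially consists of the vertices of $\mathcal G'$ in no layer; compute their $k$-probabilities. Set $D=\varnothing$, $i=0$, $curThres=0$, and let $S$ be an empty stack. The sets $V_w\setminus D$ (key: $k$-probability) and $D$ (key: the lower bound $LB$ below) are kept in Fibonacci heaps. 2. While $\mathcal G'$ is not empty: - Let $p_{crt}$ be the vertex of minimum $k$-probability in $V_w\setminus D$ (a virtual vertex of larger $k$-probability than all others if this set is empty). - While the vertex $u\in D$ of minimum $LB(u)$ has $LB(u)<k\text{-}prob(p_{crt},\mathcal G')$, recompute $k\text{-}prob(u,\mathcal G')$, remove $u$ from $D$, and set $p_{crt}=u$ if its $k$-probability is smaller. - While $i<l$ and $\eta_{i+1}<k\text{-}prob(p_{crt},\mathcal G')$, increase $i$ by one and add layer $P(k,i)$: put its vertices into $V_w$, compute their $k$-probabilities in $\mathcal G'$, and update $p_{crt}$ whenever a smaller value is found. - Set $curThres=\max(k\text{-}prob(p_{crt},\mathcal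 G'),curThres)$ and $\eta\text{-}thres_k(p_{crt})=curThres$; push $p_{crt}$ onto $S$ and remove it from $V_w$ and from $\mathcal G'$. - For every neighbour $u\in V_w$ of the removed vertex: if its degree in $\mathcal G'$ is less than $k$ or $UB(u)\le curThres$, set its $k$-probability to $0$ (and take it out of $D$); otherwise put $u$ into $D$ with its current $LB(u)$. - If $V_w=\varnothing$ and $i<l$, increase $i$ by one and add layer $P(k,i)$. 3. Construct the $\eta$-tree for $k$ from $S$. Every $k$-probability of a vertex with edges $e_1,\dots,e_d$ is computed as $1-\sum_{i<k}X(d,i)$ by the dynamic program $X(h,i)=p_{e_h}X(h-1,i-1)+(1-p_{e_h})X(h-1,i)$, where $X(0,0)=1$, $X(0,i)=0$ for $i>0$ and $X(h,-1)=0$. The bounds are $UB(u)=I_{p_{\max}(u)}(k,d-k+1)$ and $LB(u)=\max\{I_{p_{\min}(u)}(k,d-k+1),\ \text{the product of the } k \text{ largest probabilities at } u\}$. Here $d$, $p_{\min}(u)$ and $p_{\max}(u)$ are the degree of $u$ and the smallest and largest edge probability at $u$ in the current $\mathcal G'$, and $I_z(k,d-k+1)=\sum_{i=k}^{d}\binom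 di z^i(1-z)^{d-i}$. **Theorem 2.** There is an absolute constant $C$ such that, for every such $\mathcal G$, given by a list of its vertices and adjacency lists in any order, OptiUCF halts on a unit-cost real RAM after at most $$C\Bigl(k_{\max}|V|^2\log|V|+\sum_{u\in V}k_{\max}^2\deg(u,\mathcal G)^2+k_{\max}^2|E|\Bigr)$$ elementary steps. The count includes the sorting of the adjacency lists, the computation of $k_{\max}$ and of the $k$-cores, all $k$-probability computations by the dynamic program, the evaluation of the bounds, all operations on the Fibonacci heaps, and the construction of all $\eta$-trees. -/

import Mathlib

/-! ## Step counting

The machine is a unit-cost real RAM.  A `Timed α` is the result of a computation together with the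
number of elementary instructions it executes: arithmetic operations and comparisons on reals and
on natural numbers, array reads and writes, pointer operations, and loop tests.  The cost is `⊤` for
a run that never halts.  An array indexed by the vertices is a function on `V`, and one array write
is one `Function.update`; a list is a singly linked list. -/

structure Timed (α : Type) where
  val : α
  cost : ℕ∞

namespace Timed

variable {α β σ : Type}

/-- Sequential composition adds the costs. -/
instance : Monad Timed where
  pure x := ⟨x, 0⟩
  bind x f := ⟨(f x.val).val, x.cost + (f x.val).cost⟩

/-- The result of one elementary instruction. -/
def op (x : α) : Timed α := ⟨x, 1⟩

/-- The result of `c` elementary instructions. -/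
def ops (c : ℕ) (x : α) : Timed α := ⟨x, c⟩

/-- `while cond s do s := body s`.  Every test of the condition is charged one step.  If the
condition never becomes false, the loop has infinite cost. -/
noncomputable def whileT (cond : σ → Bool) (body : σ → Timed σ) (s : σ) : Timed σ :=
  open Classical in
  let it : ℕ → σ := fun j => (fun t => (body t).val)^[j] s
  if h : ∃ j, cond (it j) = false then
    ⟨it (Nat.find h), (∑ j ∈ Finset.range (Nat.find h), (1 + (body (it j)).cost)) + 1⟩
  else ⟨s, ⊤⟩

/-- `for a in l do s := body s a`.  Every advance along the list is charged one step. -/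
def forT (body : σ → α → Timed σ) : σ → List α → Timed σ
  | s, [] => op s
  | s, a :: l => do
    let t ← op s
    let t' ← body t a
    forT body t' l

end Timed

open Timed

namespace OptiUCF

section Program

/-! The program is written over an ordered field `K` of numbers; it is run with `K = ℝ`.
The list `verts` always enumerates the vertices, and `nbrs u` is the adjacency list of `u`, whose
entries are pairs (neighbour, probability of the edge). -/

variable {V K : Type} [DecidableEq V] [Field K] [LinearOrder K]

/-! ### Arrays and lists -/

/-- Allocate an array indexed by the vertices, with all entries `x`. -/
def newArray {α : Type} (verts : List V) (x : α) : Timed (V → α) :=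
  ops (verts.length + 1) (fun _ => x)

def lengthT {α : Type} (l : List α) : Timed ℕ := forT (fun c _ => op (c + 1)) 0 l

def reverseT {α : Type} (l : List α) : Timed (List α) := forT (fun acc a => op (a :: acc)) [] l

/-- The sublist of the entries with `keep a = true`, in the same order. -/
def filterT {α : Type} (keep : α → Bool) : List α → Timed (List α)
  | [] => op []
  | a :: l => do
    let b ← op (keep a)
    let l' ← filterT keep l
    if b then op (a :: l') else pure l'

/-- Scan a list of vertices for `v` and remove its first occurrence. -/
def eraseT (v : V) : List V → Timed (List V)
  | [] => op []
  | a :: l => do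
    let b ← op (decide (a = v))
    if b then op l
    else do
      let l' ← eraseT v l
      op (a :: l')

/-- Scan an adjacency list for the entry of `v` and remove it. -/
def eraseEdge (v : V) : List (V × K) → Timed (List (V × K))
  | [] => op []
  | e :: l => do
    let b ← op (decide (e.1 = v))
    if b then op l
    else do
      let l' ← eraseEdge v l
      op (e :: l')

/-! ### Preprocessing: adjacency lists in non-increasing order of probability -/

def insertEdge (e : V × K) : List (V × K) → Timed (List (V × K))
  | [] => op [e]
  | f :: l => do
    let b ← op (decide (f.2 ≤ e.2))
    if b then op (e :: f :: l)
    else do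
      let l' ← insertEdge e l
      op (f :: l')

def sortEdges (l : List (V × K)) : Timed (List (V × K)) :=
  forT (fun acc e => insertEdge e acc) [] l

def sortAdj (verts : List V) (nbrs : V → List (V × K)) : Timed (V → List (V × K)) := do
  let a ← newArray verts []
  forT (fun a v => do
    let l ← sortEdges (nbrs v)
    op (Function.update a v l)) a verts

/-! ### The `k`-core of the underlying deterministic graph -/

/-- `alive` marks the vertices not yet discarded, `deg` are the degrees still to be maintained, and
`todo` holds the discarded vertices whose neighbours have not yet been informed. -/
structure CoreState (V : Type) where
  deg : V → ℕ
  alive : V → Bool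
  todo : List V

def coreDiscard (s : CoreState V) (v : V) : Timed (CoreState V) :=
  ops 2 { s with alive := Function.update s.alive v false, todo := v :: s.todo }

def coreStep (nbrs : V → List (V × K)) (k : ℕ) (s : CoreState V) : Timed (CoreState V) :=
  match s.todo with
  | [] => op s
  | v :: rest => do
    let s ← op { s with todo := rest }
    forT (fun s e => do
      let b ← op (s.alive e.1)
      if b then do
        let d ← ops 2 (s.deg e.1 - 1)
        let s ← op { s with deg := Function.update s.deg e.1 d }
        let c ← op (decide (d < k))
        if c then coreDiscard s e.1 else pure s
      else pure s) s (nbrs v)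

/-- The membership array of the `k`-core: vertices of degree less than `k` are discarded
repeatedly. -/
noncomputable def kCoreT (verts : List V) (nbrs : V → List (V × K)) (k : ℕ) :
    Timed (V → Bool) := do
  let deg ← newArray verts 0
  let deg ← forT (fun d v => do
    let c ← lengthT (nbrs v)
    op (Function.update d v c)) deg verts
  let alive ← newArray verts true
  let s ← forT (fun s v => do
    let b ← ops 2 (decide (s.deg v < k))
    if b then coreDiscard s v else pure s) (CoreState.mk deg alive []) verts
  let s ← whileT (fun s => !s.todo.isEmpty) (coreStep nbrs k) s
  pure s.alive

/-- `k_max`, found by computing the `k`-core for `k = 1, 2, …` until it is empty. -/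
noncomputable def kMaxT (verts : List V) (nbrs : V → List (V × K)) : Timed ℕ := do
  let s ← whileT (fun s : ℕ × Bool => s.2) (fun s => do
    let alive ← kCoreT verts nbrs (s.1 + 1)
    let core ← filterT alive verts
    let b ← op (!core.isEmpty)
    if b then op (s.1 + 1, true) else op (s.1, false)) (0, true)
  pure s.1

/-! ### Refreshing: the `k`-probability by dynamic programming

For the edges `e_1, …, e_d` at a vertex, the row of `h` lists `X(h, 0), …, X(h, k - 1)`, where
`X(h, i) = p_{e_h} X(h - 1, i - 1) + (1 - p_{e_h}) X(h - 1, i)`. -/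

/-- From `X(h - 1, ·)` to `X(h, ·)`; `prev` is the entry before the head of the list. -/
def dpRow (p : K) : K → List K → Timed (List K)
  | _, [] => op []
  | prev, x :: xs => do
    let y ← ops 4 (p * prev + (1 - p) * x)
    let ys ← dpRow p x xs
    op (y :: ys)

def zerosT : ℕ → Timed (List K)
  | 0 => op []
  | j + 1 => do
    let l ← zerosT j
    op (0 :: l)

/-- `k-prob = 1 - ∑_{i < k} X(d, i)` for `k ≥ 1`, from the list of the edges at the vertex. -/
def kProb (k : ℕ) (es : List (V × K)) : Timed K := do
  let z ← zerosT (k - 1)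
  let row ← op (1 :: z)
  let row ← forT (fun r e => dpRow e.2 0 r) row es
  let s ← forT (fun a x => op (a + x)) 0 row
  op (1 - s)

/-! ### The bounds `LB` and `UB` -/

/-- The list `[q ^ (j + d), …, q ^ j] ++ acc` when `w = q ^ j`. -/
def powersT (q : K) : ℕ → K → List K → Timed (List K)
  | 0, w, acc => op (w :: acc)
  | d + 1, w, acc => do
    let w' ← op (q * w)
    let acc' ← op (w :: acc)
    powersT q d w' acc'

/-- Adds up the terms `binom d i * z ^ i * (1 - z) ^ (d - i)` with `i ≥ k`.  The list holds the
remaining powers of `1 - z`, `c = binom d i` and `y = z ^ i`. -/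
def betaLoop (k d : ℕ) (z : K) : List K → ℕ → K → K → K → Timed K
  | [], _, _, _, acc => op acc
  | w :: ws, i, c, y, acc => do
    let b ← op (decide (k ≤ i))
    let acc' ← ops 3 (if b then acc + c * y * w else acc)
    let c' ← ops 4 (c * ((d - i : ℕ) : K) / ((i + 1 : ℕ) : K))
    let y' ← op (y * z)
    betaLoop k d z ws (i + 1) c' y' acc'

/-- The regularized beta function `I_z(k, d - k + 1)`, by its defining sum
`∑_{i = k}^{d} binom d i * z ^ i * (1 - z) ^ (d - i)`. -/
def betaT (z : K) (k d : ℕ) : Timed K := do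
  let q ← op (1 - z)
  let ws ← powersT q d 1 []
  betaLoop k d z ws 0 1 1 0

/-- The largest probability in a list in non-increasing order. -/
def pMax (es : List (V × K)) : Timed K :=
  match es with
  | [] => op 0
  | e :: _ => op e.2

/-- The smallest probability in a list in non-increasing order. -/
def pMin (es : List (V × K)) : Timed K := forT (fun _ e => op e.2) 0 es

/-- The product of the first `k` probabilities. -/
def topProd : ℕ → List (V × K) → Timed K
  | 0, _ => op 1
  | _ + 1, [] => op 1
  | k + 1, e :: es => do
    let x ← topProd k es
    ops 2 (e.2 * x)

/-- `UB` of a vertex of degree `d`. -/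
def upperBound (k d : ℕ) (es : List (V × K)) : Timed K := do
  let z ← pMax es
  betaT z k d

/-- `LB` of a vertex of degree `d`: the larger of the beta-function based bound and the top-`k`
based bound. -/
def lowerBound (k d : ℕ) (es : List (V × K)) : Timed K := do
  let z ← pMin es
  let x ← betaT z k d
  let y ← topProd k es
  op (max x y)

/-! ### Fibonacci heaps -/

/-- A Fibonacci heap whose elements are vertices, as arrays of pointers.  `table` is the work array
of the consolidation, indexed by ranks and all `none` between two operations. -/
structure FibHeap (V K : Type) where
  mem : V → Bool
  key : V → K
  parent : V → Option V
  children : V → List V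
  rank : V → ℕ
  mark : V → Bool
  roots : List V
  min : Option V
  table : ℕ → Option V

namespace FibHeap

/-- Allocate an empty heap: seven arrays of size `|V|`. -/
def empty (verts : List V) : Timed (FibHeap V K) :=
  ops (7 * verts.length + 2)
    { mem := fun _ => false, key := fun _ => 0, parent := fun _ => none, children := fun _ => [],
      rank := fun _ => 0, mark := fun _ => false, roots := [], min := none, table := fun _ => none }

/-- The element of minimum key together with its key, `none` for an empty heap. -/
def findMin (h : FibHeap V K) : Timed (Option (V × K)) :=
  match h.min with
  | none => op none
  | some m => ops 2 (some (m, h.key m))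

/-- Redirect the pointer to the minimum to the root `v` if its key is smaller. -/
def updateMin (h : FibHeap V K) (v : V) : Timed (FibHeap V K) := do
  let b ← ops 4 (match h.min with
    | none => true
    | some m => decide (h.key v < h.key m))
  if b then op { h with min := some v } else pure h

/-- Insert `v`, which is not in the heap, with key `x`, as a new root. -/
def insert (h : FibHeap V K) (v : V) (x : K) : Timed (FibHeap V K) := do
  let h ← ops 7 { h with
    mem := Function.update h.mem v true
    key := Function.update h.key v x
    parent := Function.update h.parent v none
    children := Function.update h.children v []
    rank := Function.update h.rank v 0
    mark := Function.update h.mark v false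
    roots := v :: h.roots }
  updateMin h v

/-- Make the root `y` a child of the root `x`. -/
def link (h : FibHeap V K) (y x : V) : Timed (FibHeap V K) :=
  ops 6 { h with
    parent := Function.update h.parent y (some x)
    children := Function.update h.children x (y :: h.children x)
    rank := Function.update h.rank x (h.rank x + 1)
    mark := Function.update h.mark y false }

/-- Link the root `r` with the root of the same rank in the table until there is none, then enter
it into the table.  `mx` is the largest rank entered so far. -/
noncomputable def place (s : FibHeap V K × ℕ) (r : V) : Timed (FibHeap V K × ℕ) := do
  let t ← whileT (fun t : FibHeap V K × V => (t.1.table (t.1.rank t.2)).isSome) (fun t => do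
    match t.1.table (t.1.rank t.2) with
    | none => op t
    | some q => do
      let h ← ops 2 { t.1 with table := Function.update t.1.table (t.1.rank t.2) none }
      let b ← ops 3 (decide (h.key q < h.key t.2))
      if b then do
        let h ← link h t.2 q
        op (h, q)
      else do
        let h ← link h q t.2
        op (h, t.2)) (s.1, r)
  let h ← ops 2 { t.1 with table := Function.update t.1.table (t.1.rank t.2) (some t.2) }
  let mx ← ops 2 (max s.2 (h.rank t.2))
  pure (h, mx)

/-- Empty the entries `j - 1, …, 0` of the table into the root list. -/
def collect : ℕ → FibHeap V K → Timed (FibHeap V K)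
  | 0, h => op h
  | j + 1, h => do
    let o ← op (h.table j)
    match o with
    | none => collect j h
    | some r => do
      let h ← ops 2 { h with roots := r :: h.roots, table := Function.update h.table j none }
      let h ← updateMin h r
      collect j h

/-- Consolidation: link roots of equal rank until all the ranks are distinct. -/
noncomputable def consolidate (h : FibHeap V K) : Timed (FibHeap V K) := do
  let s ← forT place (h, 0) h.roots
  let h ← ops 2 { s.1 with roots := [], min := none }
  collect (s.2 + 1) h

/-- Remove the element that the pointer to the minimum shows. -/
noncomputable def extractMin (h : FibHeap V K) : Timed (FibHeap V K) :=
  match h.min with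
  | none => op h
  | some m => do
    let rs ← eraseT m h.roots
    let h ← ops 2 { h with roots := rs, mem := Function.update h.mem m false }
    let h ← forT (fun (h : FibHeap V K) c => ops 3 { h with
      parent := Function.update h.parent c none
      mark := Function.update h.mark c false
      roots := c :: h.roots }) h (h.children m)
    let h ← ops 2 { h with
      children := Function.update h.children m []
      rank := Function.update h.rank m 0 }
    consolidate h

/-- Cut the child `x` of `y` and make it a root. -/
def cut (h : FibHeap V K) (x y : V) : Timed (FibHeap V K) := do
  let cs ← eraseT x (h.children y)
  ops 6 { h with
    children := Function.update h.children y cs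
    rank := Function.update h.rank y (h.rank y - 1)
    roots := x :: h.roots
    parent := Function.update h.parent x none
    mark := Function.update h.mark x false }

/-- Cascading cut from `y` upwards: marked nodes are cut from their parents, up to the first node
that is a root or unmarked; in the latter case it is marked. -/
noncomputable def cascade (h : FibHeap V K) (y : V) : Timed (FibHeap V K) := do
  let t ← whileT (fun t : FibHeap V K × Option V => t.2.isSome) (fun t => do
    match t.2 with
    | none => op t
    | some y =>
      match t.1.parent y with
      | none => op (t.1, none)
      | some z => do
        let b ← ops 2 (t.1.mark y)
        if b then do
          let h ← cut t.1 y z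
          op (h, some z)
        else op ({ t.1 with mark := Function.update t.1.mark y true }, none)) (h, some y)
  pure t.1

/-- Decrease the key of the element `v` to `x`. -/
noncomputable def decreaseKey (h : FibHeap V K) (v : V) (x : K) : Timed (FibHeap V K) := do
  let h ← op { h with key := Function.update h.key v x }
  let o ← op (h.parent v)
  let h ← match o with
    | none => pure h
    | some y => do
      let b ← ops 2 (decide (x < h.key y))
      if b then do
        let h ← cut h v y
        cascade h y
      else pure h
  updateMin h v

/-- Delete the element `v`: treat its key as `-∞`, that is, cut it from its parent and let the
pointer to the minimum show it, and extract it. -/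
noncomputable def delete (h : FibHeap V K) (v : V) : Timed (FibHeap V K) := do
  let o ← op (h.parent v)
  let h ← match o with
    | none => pure h
    | some y => do
      let h ← cut h v y
      cascade h y
  let h ← op { h with min := some v }
  extractMin h

end FibHeap

/-! ### The peeling stage -/

/-- The variables of the peeling stage for one value of `k`.
* `adj` are the adjacency lists of the current graph `𝒢'` and `size` is its number of vertices.
* `inW` and `wSize` are the working set `V_w` and its size.
* `W` is the heap of `V_w ∖ D`, where the key of `u` is `k-prob(u)`; `D` is the heap of the
  indefinite vertices, where the key of `u` is `LB(u)`.
* `layers` are the layers `P(k, i + 1), …, P(k, l)` that have not yet been added to `V_w`, each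
  together with its threshold, in ascending order of the thresholds.
* `stack` is the stack `S` of the peeled vertices, most recent first; each run of vertices with the
  same `η-thres_k` forms one bucket, stored together with that threshold. -/
structure PeelState (V K : Type) where
  adj : V → List (V × K)
  size : ℕ
  inW : V → Bool
  wSize : ℕ
  W : FibHeap V K
  D : FibHeap V K
  layers : List (K × List V)
  curThres : K
  stack : List (K × List V)

/-- `x < k-prob(p_crt)`, for `p_crt` given with its `k`-probability.  Here `none` is the virtual
vertex, whose `k`-probability exceeds every number. -/
def below (x : K) : Option (V × K) → Bool
  | none => true
  | some q => decide (x < q.2)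

/-- Some vertex of `D` has `LB(u) < k-prob(p_crt)`. -/
def hasBelow (t : PeelState V K × Option (V × K)) : Bool :=
  match t.1.D.min with
  | none => false
  | some u => below (t.1.D.key u) t.2

/-- Delayed refreshing: while the smallest `LB(u)` in `D` is less than the `k`-probability of the
candidate, the `k`-probability of `u` is recomputed and `u` leaves `D`. -/
noncomputable def refKPROB (k : ℕ) (t : PeelState V K × Option (V × K)) :
    Timed (PeelState V K × Option (V × K)) :=
  whileT hasBelow (fun t =>
    match t.1.D.min with
    | none => op t
    | some u => do
      let x ← kProb k (t.1.adj u)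
      let D ← t.1.D.extractMin
      let W ← t.1.W.insert u x
      let b ← op (below x t.2)
      ops 3 ({ t.1 with W := W, D := D }, if b then some (u, x) else t.2)) t

/-- Add the vertex `u`, with its recomputed `k`-probability, to the working set. -/
def addVertex (k : ℕ) (t : PeelState V K × Option (V × K)) (u : V) :
    Timed (PeelState V K × Option (V × K)) := do
  let x ← kProb k (t.1.adj u)
  let W ← t.1.W.insert u x
  let b ← op (below x t.2)
  ops 5 ({ t.1 with
    W := W
    inW := Function.update t.1.inW u true
    wSize := t.1.wSize + 1 }, if b then some (u, x) else t.2)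

/-- Add the next layer to the working set. -/
def addLayer (k : ℕ) (t : PeelState V K × Option (V × K)) :
    Timed (PeelState V K × Option (V × K)) :=
  match t.1.layers with
  | [] => op t
  | L :: rest => do
    let t ← ops 2 ({ t.1 with layers := rest }, t.2)
    forT (addVertex k) t L.2

/-- Push `v` with threshold `c` onto the stack. -/
def push (c : K) (v : V) (S : List (K × List V)) : Timed (List (K × List V)) :=
  match S with
  | [] => ops 2 [(c, [v])]
  | B :: rest => do
    let b ← op (decide (B.1 = c))
    if b then ops 2 ((c, v :: B.2) :: rest) else ops 2 ((c, [v]) :: B :: rest)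

/-- Treat the neighbour `u ∈ V_w` of the vertex just removed: its `k`-probability becomes `0` if its
degree is less than `k` or `UB(u) ≤ curThres`; otherwise it is put into `D` with key `LB(u)`, after
removing it from `D` if it was there. -/
noncomputable def updateNbr (k : ℕ) (s : PeelState V K) (u : V) : Timed (PeelState V K) := do
  let d ← lengthT (s.adj u)
  let small ← op (decide (d < k))
  let zero ← if small then pure true else do
    let x ← upperBound k d (s.adj u)
    op (decide (x ≤ s.curThres))
  let inD ← op (s.D.mem u)
  if zero then
    if inD then do
      let D ← s.D.delete u
      let W ← s.W.insert u 0
      ops 2 { s with D := D, W := W }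
    else do
      let W ← s.W.decreaseKey u 0
      op { s with W := W }
  else do
    let x ← lowerBound k d (s.adj u)
    if inD then do
      let D ← s.D.delete u
      let D ← D.insert u x
      op { s with D := D }
    else do
      let W ← s.W.delete u
      let D ← s.D.insert u x
      ops 2 { s with D := D, W := W }

/-- Remove `p_crt = v`, which has `k`-probability `x`, and treat its neighbours. -/
noncomputable def removeVertex (k : ℕ) (s : PeelState V K) (v : V) (x : K) :
    Timed (PeelState V K) := do
  let c ← op (max x s.curThres)
  let S ← push c v s.stack
  let W ← s.W.delete v
  let N ← op (s.adj v)
  let s ← ops 8 { s with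
    curThres := c
    stack := S
    W := W
    inW := Function.update s.inW v false
    wSize := s.wSize - 1
    adj := Function.update s.adj v []
    size := s.size - 1 }
  let s ← forT (fun (s : PeelState V K) e => do
    let l ← eraseEdge v (s.adj e.1)
    op { s with adj := Function.update s.adj e.1 l }) s N
  forT (fun (s : PeelState V K) e => do
    let b ← op (s.inW e.1)
    if b then updateNbr k s e.1 else pure s) s N

/-- One round of the peeling stage: find `p_crt`, the vertex of minimum `k`-probability, and remove
it.  A round that ends with the virtual vertex changes nothing. -/
noncomputable def peelRound (k : ℕ) (s : PeelState V K) : Timed (PeelState V K) := do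
  let p ← s.W.findMin
  let b ← ops 3 (hasBelow (s, p))
  let t ← if b then refKPROB k (s, p) else pure (s, p)
  let t ← whileT (fun t : PeelState V K × Option (V × K) =>
    match t.1.layers with
    | [] => false
    | L :: _ => below L.1 t.2) (addLayer k) t
  match t.2 with
  | none => op t.1
  | some q => do
    let s ← removeVertex k t.1 q.1 q.2
    let b ← ops 2 (decide (s.wSize = 0) && !s.layers.isEmpty)
    if b then do
      let t ← addLayer k (s, some q)
      pure t.1
    else pure s

/-- The `η`-thresholds for one `k`: the initialization, and peeling until `𝒢'` is empty.  The
`layers` are the buckets of the iteration for `k + 1`, in ascending order.  The result is the stack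
of the peeled vertices with their thresholds. -/
noncomputable def peel (verts : List V) (nbrs : V → List (V × K)) (k : ℕ)
    (layers : List (K × List V)) : Timed (List (K × List V)) := do
  let alive ← kCoreT verts nbrs k
  let core ← filterT alive verts
  let adj ← newArray verts []
  let adj ← forT (fun (a : V → List (V × K)) v => do
    let l ← filterT (fun e => alive e.1) (nbrs v)
    op (Function.update a v l)) adj core
  let size ← lengthT core
  let inP ← newArray verts false
  let inP ← forT (fun (a : V → Bool) L =>
    forT (fun a v => op (Function.update a v true)) a L.2) inP layers
  let PT ← filterT (fun v => !inP v) core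
  let inW ← newArray verts false
  let W ← FibHeap.empty verts
  let D ← FibHeap.empty verts
  let s ← ops 9 ({ adj := adj, size := size, inW := inW, wSize := 0, W := W, D := D,
                   layers := layers, curThres := 0, stack := [] } : PeelState V K)
  let t ← forT (addVertex k) (s, none) PT
  let s ← whileT (fun s : PeelState V K => decide (s.size ≠ 0)) (peelRound k) t.1
  pure s.stack

/-! ### The `η`-tree -/

/-- An `η`-tree (one tree for each connected component).  A node is named by one of its vertices;
`verts x` are the vertices stored in the node `x`, all of which have `η`-threshold `eta x`. -/
structure EtaTree (V K : Type) where
  nodes : List V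
  eta : V → K
  verts : V → List V
  parent : V → Option V

/-- The state of the construction: the tree built so far, and a union-find structure `uf`, `size` on
the vertices already treated (`done`), whose classes are the connected components of the subgraph
that they induce.  For a root `r` of the union-find structure, `top r` is the root of the part of
the tree built for the component of `r`, if it exists already.  `pending` are the nodes that wait
for a parent. -/
structure TreeState (V K : Type) where
  tree : EtaTree V K
  uf : V → V
  size : V → ℕ
  top : V → Option V
  done : V → Bool
  pending : List V

noncomputable def findRoot (b : TreeState V K) (v : V) : Timed V :=
  whileT (fun x => decide (b.uf x ≠ x)) (fun x => op (b.uf x)) v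

def addPending (b : TreeState V K) (r : V) : Timed (TreeState V K) :=
  match b.top r with
  | none => op b
  | some y => ops 2 { b with pending := y :: b.pending }

def attach (b : TreeState V K) (child r : V) : Timed (TreeState V K) :=
  ops 6 { b with
    uf := Function.update b.uf child r
    size := Function.update b.size r (b.size r + b.size child)
    top := Function.update b.top r none }

/-- Unite the components of `u` and `v`, the smaller one being attached to the larger one. -/
noncomputable def union (b : TreeState V K) (u v : V) : Timed (TreeState V K) := do
  let a ← findRoot b u
  let c ← findRoot b v
  let same ← op (decide (a = c))
  if same then pure b
  else do
    let b ← addPending b a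
    let b ← addPending b c
    let less ← ops 3 (decide (b.size a < b.size c))
    if less then attach b a c else attach b c a

/-- Treat all the vertices of one `η`-threshold.  First they are united with the treated vertices
next to them; then every resulting component gets one new node, which stores those of the vertices
that lie in it, and becomes the parent of the nodes of the components it has absorbed. -/
noncomputable def treeBucket (nbrs : V → List (V × K)) (b : TreeState V K) (B : K × List V) :
    Timed (TreeState V K) := do
  let b ← op { b with pending := [] }
  let b ← forT (fun (b : TreeState V K) v => do
    let b ← ops 4 { b with
      uf := Function.update b.uf v v
      size := Function.update b.size v 1
      top := Function.update b.top v none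
      done := Function.update b.done v true }
    forT (fun (b : TreeState V K) e => do
      let d ← op (b.done e.1)
      if d then union b v e.1 else pure b) b (nbrs v)) b B.2
  let b ← forT (fun (b : TreeState V K) v => do
    let r ← findRoot b v
    match b.top r with
    | none => ops 6 { b with
        tree :=
          { nodes := v :: b.tree.nodes
            eta := Function.update b.tree.eta v B.1
            verts := Function.update b.tree.verts v [v]
            parent := Function.update b.tree.parent v none }
        top := Function.update b.top r (some v) }
    | some x => ops 4 { b with
        tree := { b.tree with
          verts := Function.update b.tree.verts x (v :: b.tree.verts x) } }) b B.2
  forT (fun (b : TreeState V K) y => do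
    let r ← findRoot b y
    ops 3 { b with
      tree := { b.tree with parent := Function.update b.tree.parent y (b.top r) } }) b b.pending

/-- Construct `η-tree_k` from the stack, that is, in descending order of the thresholds. -/
noncomputable def etaTree (verts : List V) (nbrs : V → List (V × K))
    (stack : List (K × List V)) : Timed (EtaTree V K) := do
  let eta ← newArray verts 0
  let vs ← newArray verts []
  let parent ← newArray verts none
  let uf ← forT (fun (a : V → V) v => op (Function.update a v v)) id verts
  let size ← newArray verts 0
  let top ← newArray verts none
  let done ← newArray verts false
  let b ← forT (treeBucket nbrs) (⟨⟨[], eta, vs, parent⟩, uf, size, top, done, []⟩) stack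
  pure b.tree

/-! ### The main program -/

/-- The iterations for `k, k - 1, …, 1`. -/
noncomputable def iterations (verts : List V) (nbrs : V → List (V × K)) :
    ℕ → List (K × List V) → List (ℕ × EtaTree V K) → Timed (List (ℕ × EtaTree V K))
  | 0, _, acc => op acc
  | k + 1, layers, acc => do
    let stack ← peel verts nbrs (k + 1) layers
    let tree ← etaTree verts nbrs stack
    let layers' ← reverseT stack
    let acc' ← op ((k + 1, tree) :: acc)
    iterations verts nbrs k layers' acc'

/-- The whole construction of the UCF-Index, including the sorting of the adjacency lists and the
computation of `k_max`.  The result consists of the trees `η-tree_k` for `1 ≤ k ≤ k_max`. -/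
noncomputable def optiUCF (verts : List V) (nbrs : V → List (V × K)) :
    Timed (List (ℕ × EtaTree V K)) := do
  let nbrs ← sortAdj verts nbrs
  let kmax ← kMaxT verts nbrs
  iterations verts nbrs kmax [] []

end Program

end OptiUCF

/-! ## Uncertain graphs -/

/-- An uncertain graph with vertex set `V`: every edge `e` has a probability `p e` in `[0, 1]`. -/
structure UncertainGraph (V : Type) where
  graph : SimpleGraph V
  p : Sym2 V → ℝ
  p_mem : ∀ e ∈ graph.edgeSet, p e ∈ Set.Icc (0 : ℝ) 1

namespace UncertainGraph

variable {V : Type}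

/-- The degree of `u`. -/
noncomputable def deg (𝒢 : UncertainGraph V) (u : V) : ℕ := (𝒢.graph.neighborSet u).ncard

/-- The number of edges. -/
noncomputable def edgeCount (𝒢 : UncertainGraph V) : ℕ := 𝒢.graph.edgeSet.ncard

/-- The vertex set of the `k`-core, the largest subgraph in which every vertex has degree at least
`k`: the union of all vertex sets that induce such a subgraph. -/
def kCore (𝒢 : UncertainGraph V) (k : ℕ) : Set V :=
  ⋃₀ {C : Set V | ∀ u ∈ C, k ≤ (𝒢.graph.neighborSet u ∩ C).ncard}

/-- The largest `k` for which the `k`-core is non-empty. -/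
noncomputable def kMax (𝒢 : UncertainGraph V) : ℕ := sSup {k : ℕ | (𝒢.kCore k).Nonempty}

/-- The input of the program: a list of the vertices and the adjacency lists with the probabilities
of the edges, each in an arbitrary order. -/
structure AdjacencyLists (𝒢 : UncertainGraph V) where
  verts : List V
  nodup_verts : verts.Nodup
  mem_verts : ∀ v, v ∈ verts
  nbrs : V → List (V × ℝ)
  nodup_nbrs : ∀ u, ((nbrs u).map Prod.fst).Nodup
  mem_nbrs : ∀ u v q, (v, q) ∈ nbrs u ↔ 𝒢.graph.Adj u v ∧ q = 𝒢.p s(u, v)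

end UncertainGraph

/-! The proof is an amortized analysis: a potential is attached to every loop, and each round must
pay for its own steps out of the drop in that potential. A `while` loop analysed in this way also
halts, because each round uses up at least one unit (`wp_whileT`). Almost nothing about the values
computed is needed: the general analysis takes `K` to be a field with an unrelated linear order, and
no heap order is ever tracked. What matters is the shape of the data structures, the disjointness of
the buckets, and one fact about cores: the vertices surviving in `kCoreT` have at least `k`
neighbours among themselves. Hence the computed `k_max` is at most the true one (`wp_kMaxT`,
`AdjacencyLists.le_kMax`), which bounds the number of iterations.

In one iteration the expensive work is the refreshing of `k`-probabilities, which takes `O(k deg u)`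
steps for `u`. A vertex is refreshed on leaving the heap `D`, and it entered `D` when a neighbour
was removed, so that removal prepays the refresh (`workPot`, `updateCost`). Every vertex is removed
at most once, so by double counting (`IsAdjacency.sum_nbrs`) the total is `∑ deg u * updateCost u`.
The dynamic programs contribute `k ∑ deg ^ 2`, and the heap operations contribute `∑ deg u` times
the amortized cost of one operation.

Let `n` be the number of vertices. For the heaps a rank bound of order `√n` is enough
(`Forest.rank_le`), and it has a shorter proof than the logarithmic one. The ranks of all vertices
add up to at most `n`, while a vertex with `d` children forces their ranks to add up to about `d ^ 2
/ 2`. The same bound serves for the heights of the union-find forest. The loss is absorbed by `2 d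
√n ≤ d ^ 2 + n`: summed over the vertices, the right side is `∑ deg ^ 2 + n ^ 2`, which the claimed
bound contains anyway (`iterationCost_le`).

With `m = k_max` iterations the whole run costs `O(m (m ∑ deg ^ 2 + n ^ 2))`. The logarithm in the
theorem is used only through `log n ≥ 1 / 2` for `n ≥ 2`, and the edge term only through being
nonnegative. -/

set_option linter.unusedSectionVars false

/-! ### A program logic for halting and step counts -/

namespace Timed

variable {α β σ : Type}

/-- The run of `t` halts, and its result and its number of steps satisfy `Q`. -/
def Wp (t : Timed α) (Q : α → ℕ → Prop) : Prop := ∃ c : ℕ, t.cost = c ∧ Q t.val c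

theorem wp_pure {x : α} {Q : α → ℕ → Prop} : Wp (pure x : Timed α) Q ↔ Q x 0 := by
  constructor
  · rintro ⟨c, hc, h⟩
    have h0 : ((0 : ℕ) : ℕ∞) = c := hc
    have : 0 = c := by exact_mod_cast h0
    subst this; exact h
  · intro h; exact ⟨0, rfl, h⟩

theorem wp_ops {n : ℕ} {x : α} {Q : α → ℕ → Prop} : Wp (ops n x) Q ↔ Q x n := by
  constructor
  · rintro ⟨c, hc, h⟩
    have h0 : (n : ℕ∞) = c := hc
    have : n = c := by exact_mod_cast h0
    subst this; exact h
  · intro h; exact ⟨n, rfl, h⟩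

theorem wp_op {x : α} {Q : α → ℕ → Prop} : Wp (op x) Q ↔ Q x 1 := wp_ops (n := 1)

theorem wp_bind {t : Timed α} {f : α → Timed β} {Q : β → ℕ → Prop} :
    Wp (t >>= f) Q ↔ Wp t (fun x c => Wp (f x) (fun y d => Q y (c + d))) := by
  constructor
  · rintro ⟨c, hc, h⟩
    have h0 : t.cost + (f t.val).cost = c := hc
    have h1 : t.cost ≠ ⊤ := by intro h1; rw [h1, top_add] at h0; exact absurd h0 (by simp)
    have h2 : (f t.val).cost ≠ ⊤ := by intro h1; rw [h1, add_top] at h0; exact absurd h0 (by simp)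
    obtain ⟨a, ha⟩ := ENat.ne_top_iff_exists.mp h1
    obtain ⟨b, hb⟩ := ENat.ne_top_iff_exists.mp h2
    refine ⟨a, ha.symm, b, hb.symm, ?_⟩
    rw [← ha, ← hb] at h0
    have : a + b = c := by exact_mod_cast h0
    subst this; exact h
  · rintro ⟨a, ha, b, hb, h⟩
    refine ⟨a + b, ?_, h⟩
    change t.cost + (f t.val).cost = _
    rw [ha, hb]; norm_cast

theorem Wp.mono {t : Timed α} {Q Q' : α → ℕ → Prop} (h : Wp t Q)
    (hQ : ∀ x c, Q x c → Q' x c) : Wp t Q' := by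
  obtain ⟨c, hc, h⟩ := h
  exact ⟨c, hc, hQ _ _ h⟩

theorem Wp.bind {t : Timed α} {f : α → Timed β} {P : α → ℕ → Prop} {Q : β → ℕ → Prop}
    (h : Wp t P) (hf : ∀ x c, P x c → Wp (f x) (fun y d => Q y (c + d))) : Wp (t >>= f) Q :=
  wp_bind.mpr (h.mono hf)

/-- Amortized analysis of a loop over a list: `I l s` is the invariant and `Φ l s` the potential
when the list `l` remains to be treated. -/
theorem wp_forT {body : σ → α → Timed σ} (I : List α → σ → Prop) (Φ : List α → σ → ℕ)
    (step : ∀ a l s, I (a :: l) s →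
      Wp (body s a) (fun s' c => I l s' ∧ c + 1 + Φ l s' ≤ Φ (a :: l) s)) :
    ∀ (l : List α) (s : σ), I l s →
      Wp (forT body s l) (fun s' c => I [] s' ∧ c + Φ [] s' ≤ Φ l s + 1)
  | [], s, h => by
    rw [forT, wp_op]; exact ⟨h, by omega⟩
  | a :: l, s, h => by
    rw [forT, wp_bind, wp_op]
    refine (step a l s h).bind ?_
    rintro s' c ⟨h1, h2⟩
    refine (wp_forT I Φ step l s' h1).mono ?_
    rintro s'' d ⟨h3, h4⟩
    exact ⟨h3, by omega⟩

/-- A loop over a list whose body has a cost bound that does not depend on the state. -/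
theorem wp_forT_sum {body : σ → α → Timed σ} (I : List α → σ → Prop) (w : α → ℕ)
    (step : ∀ a l s, I (a :: l) s → Wp (body s a) (fun s' c => I l s' ∧ c + 1 ≤ w a))
    (l : List α) (s : σ) (h : I l s) :
    Wp (forT body s l) (fun s' c => I [] s' ∧ c ≤ (l.map w).sum + 1) := by
  refine (wp_forT I (fun l _ => (l.map w).sum) (fun a l s hs => ?_) l s h).mono ?_
  · refine (step a l s hs).mono ?_
    rintro s' c ⟨h1, h2⟩
    refine ⟨h1, ?_⟩
    simp only [List.map_cons, List.sum_cons]; omega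
  · rintro s' c ⟨h1, h2⟩
    exact ⟨h1, by simpa using h2⟩

/-- Amortized analysis of a `while` loop: the potential `Φ` pays for every round. -/
theorem wp_whileT {cond : σ → Bool} {body : σ → Timed σ} (I : σ → Prop) (Φ : σ → ℕ)
    (step : ∀ s, I s → cond s = true →
      Wp (body s) (fun s' c => I s' ∧ c + 1 + Φ s' ≤ Φ s)) (s : σ) (hs : I s) :
    Wp (whileT cond body s)
      (fun s' c => I s' ∧ cond s' = false ∧ c + Φ s' ≤ Φ s + 1) := by
  classical
  set it : ℕ → σ := fun j => (fun t => (body t).val)^[j] s with hit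
  have hsucc : ∀ j, it (j + 1) = (body (it j)).val := fun j => by
    simp only [hit, Function.iterate_succ_apply']
  -- The conjunct `j ≤ c` makes the loop halt: `j` rounds have cost at least `j`, and their cost is
  -- at most `Φ s`.
  have key : ∀ j, (∀ i < j, cond (it i) = true) → I (it j) ∧
      ∃ c : ℕ, ∑ i ∈ Finset.range j, (1 + (body (it i)).cost) = c ∧
        c + Φ (it j) ≤ Φ s ∧ j ≤ c := by
    intro j
    induction j with
    | zero => intro _; exact ⟨hs, 0, by simp, by simp [hit], le_rfl⟩
    | succ j ih =>
      intro h
      obtain ⟨h1, c, hc, h2, h3⟩ := ih (fun i hi => h i (by omega))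
      obtain ⟨d, hd, h4, h5⟩ := step _ h1 (h j (by omega))
      rw [← hsucc] at h4 h5
      refine ⟨h4, c + (1 + d), ?_, by omega, by omega⟩
      rw [Finset.sum_range_succ, hc, hd]; norm_cast
  have hex : ∃ j, cond (it j) = false := by
    by_contra hne
    push Not at hne
    obtain ⟨-, c, -, h2, h3⟩ := key (Φ s + 1) (fun i _ => by simpa using hne i)
    omega
  obtain ⟨h1, c, hc, h2, -⟩ := key (Nat.find hex) (fun i hi => by
    simpa using Nat.find_min hex hi)
  have hw : whileT cond body s = ⟨it (Nat.find hex),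
      (∑ j ∈ Finset.range (Nat.find hex), (1 + (body (it j)).cost)) + 1⟩ := by
    unfold whileT
    exact dif_pos hex
  rw [hw]
  refine ⟨c + 1, ?_, h1, Nat.find_spec hex, by dsimp only; omega⟩
  dsimp only
  rw [hc]; norm_cast

end Timed

/-! ### Cost of the array and list primitives -/

namespace OptiUCF

variable {V K : Type} [DecidableEq V] [Field K] [LinearOrder K]

theorem wp_newArray {α : Type} (verts : List V) (x : α) {Q : (V → α) → ℕ → Prop}
    (h : Q (fun _ => x) (verts.length + 1)) : Wp (newArray verts x) Q := wp_ops.mpr h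

theorem wp_lengthT {α : Type} (l : List α) :
    Wp (lengthT l) (fun n c => n = l.length ∧ c ≤ 2 * l.length + 1) := by
  unfold lengthT
  refine (wp_forT_sum (fun r n => n + r.length = l.length) (fun _ => 2) ?_ l 0 (by simp)).mono ?_
  · intro a r n h
    rw [wp_op]
    simp only [List.length_cons] at h
    omega
  · rintro n c ⟨h, hc⟩
    simp at h hc
    omega

theorem wp_reverseT {α : Type} (l : List α) :
    Wp (reverseT l) (fun l' c => l' = l.reverse ∧ c ≤ 2 * l.length + 1) := by
  unfold reverseT
  refine (wp_forT_sum (fun r acc => r.reverse ++ acc = l.reverse) (fun _ => 2) ?_ l []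
    (by simp)).mono ?_
  · intro a r acc h
    rw [wp_op]
    exact ⟨by simpa using h, le_rfl⟩
  · rintro n c ⟨h, hc⟩
    simp at h hc
    exact ⟨h, by omega⟩

theorem wp_filterT {α : Type} (keep : α → Bool) : ∀ l : List α,
    Wp (filterT keep l) (fun l' c => l' = l.filter keep ∧ c ≤ 2 * l.length + 1)
  | [] => by rw [filterT, wp_op]; simp
  | a :: l => by
    rw [filterT, wp_bind, wp_op]
    refine (wp_filterT keep l).bind ?_
    rintro l' c ⟨rfl, hc⟩
    cases h : keep a
    · simp [h, wp_pure]; omega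
    · simp [h, wp_op]; omega

theorem wp_eraseT (v : V) : ∀ l : List V,
    Wp (eraseT v l) (fun l' c => l' = l.erase v ∧ c ≤ 2 * l.length + 1)
  | [] => by rw [eraseT, wp_op]; simp
  | a :: l => by
    rw [eraseT, wp_bind, wp_op]
    by_cases h : a = v
    · simp [h, wp_op]; omega
    · rw [if_neg (by simp [h])]
      refine (wp_eraseT v l).bind ?_
      rintro l' c ⟨rfl, hc⟩
      rw [wp_op]
      refine ⟨?_, by simp; omega⟩
      rw [List.erase_cons_tail (by simpa using h)]

/-- `Sublist` is all that is recorded of the result: the analysis uses only that current adjacency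
lists are no longer than the original ones. -/
theorem wp_eraseEdge (v : V) : ∀ l : List (V × K),
    Wp (eraseEdge v l) (fun l' c => l'.Sublist l ∧ c ≤ 2 * l.length + 1)
  | [] => by rw [eraseEdge, wp_op]; simp
  | a :: l => by
    rw [eraseEdge, wp_bind, wp_op]
    by_cases h : a.1 = v
    · simp [h, wp_op]; omega
    · rw [if_neg (by simp [h])]
      refine (wp_eraseEdge v l).bind ?_
      rintro l' c ⟨hl, hc⟩
      rw [wp_op]
      exact ⟨hl.cons_cons a, by simp; omega⟩

/-! ### Sorting -/

theorem wp_insertEdge (e : V × K) : ∀ l : List (V × K),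
    Wp (insertEdge e l) (fun l' c => l'.Perm (e :: l) ∧ c ≤ 2 * l.length + 2)
  | [] => by rw [insertEdge, wp_op]; simp
  | f :: l => by
    rw [insertEdge, wp_bind, wp_op]
    by_cases h : f.2 ≤ e.2
    · simp [h, wp_op]
    · rw [if_neg (by simp [h])]
      refine (wp_insertEdge e l).bind ?_
      rintro l' c ⟨hl, hc⟩
      rw [wp_op]
      exact ⟨(hl.cons f).trans (List.Perm.swap e f l), by simp; omega⟩

/-- Insertion sort is quadratic in the degree, which the term `∑ deg ^ 2` can afford. That the
result is sorted is irrelevant for the cost, so only the permutation is kept. -/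
theorem wp_sortEdges (l : List (V × K)) :
    Wp (sortEdges l) (fun l' c => l'.Perm l ∧ c ≤ l.length * (2 * l.length + 3) + 1) := by
  unfold sortEdges
  refine (wp_forT_sum (fun r acc => (r ++ acc).Perm l) (fun _ => 2 * l.length + 3) ?_ l []
    (by simp)).mono ?_
  · intro e r acc h
    refine (wp_insertEdge e acc).mono ?_
    rintro acc' c ⟨h1, h2⟩
    refine ⟨?_, ?_⟩
    · refine (List.Perm.append_left r h1).trans ((List.perm_middle).trans ?_)
      simpa using h
    · have := h.length_eq
      simp at this
      omega
  · rintro acc c ⟨h1, h2⟩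
    refine ⟨by simpa using h1, ?_⟩
    simpa using h2

theorem wp_sortAdj (verts : List V) (nbrs : V → List (V × K)) (hv : ∀ v, v ∈ verts) :
    Wp (sortAdj verts nbrs) (fun a c => (∀ v, (a v).Perm (nbrs v)) ∧
      c ≤ (verts.map (fun v => (nbrs v).length * (2 * (nbrs v).length + 3) + 3)).sum
        + verts.length + 2) := by
  unfold sortAdj
  rw [wp_bind]
  apply wp_newArray
  refine (wp_forT_sum (fun r (a : V → List (V × K)) => ∀ v, v ∉ r → (a v).Perm (nbrs v))
    (fun v => (nbrs v).length * (2 * (nbrs v).length + 3) + 3) ?_ verts _ ?_).mono ?_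
  · intro v r a h
    refine (wp_sortEdges (nbrs v)).bind ?_
    rintro l c ⟨h1, h2⟩
    rw [wp_op]
    refine ⟨fun w hw => ?_, by omega⟩
    by_cases hwv : w = v
    · subst hwv; simpa using h1
    · rw [Function.update_of_ne hwv]
      exact h w (by simp [hwv, hw])
  · intro v h; exact absurd (hv v) h
  · rintro a c ⟨h1, h2⟩
    exact ⟨fun v => h1 v (by simp), by omega⟩

end OptiUCF

/-! ### Adjacency lists, the `k`-core and `k_max` -/

namespace OptiUCF

variable {V K : Type} [DecidableEq V] [Fintype V] [Field K] [LinearOrder K]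

/-- `verts` and `nbrs` are the vertices and the adjacency lists of a simple graph. -/
structure IsAdjacency (verts : List V) (nbrs : V → List (V × K)) : Prop where
  nodup_verts : verts.Nodup
  mem_verts : ∀ v, v ∈ verts
  nodup_nbrs : ∀ u, ((nbrs u).map Prod.fst).Nodup
  symm : ∀ u v, v ∈ (nbrs u).map Prod.fst → u ∈ (nbrs v).map Prod.fst

theorem sum_map_le_of_nodup {l : List V} (hl : l.Nodup) (f : V → ℕ) :
    (l.map f).sum ≤ ∑ v, f v := by
  rw [← List.sum_toFinset f hl]
  exact Finset.sum_le_sum_of_subset (Finset.subset_univ _)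

theorem length_le_of_nodup {l : List V} (hl : l.Nodup) : l.length ≤ Fintype.card V :=
  hl.length_le_card

theorem IsAdjacency.sum_map {verts : List V} {nbrs : V → List (V × K)}
    (h : IsAdjacency verts nbrs) (f : V → ℕ) : (verts.map f).sum = ∑ v, f v := by
  rw [← List.sum_toFinset f h.nodup_verts]
  congr 1
  ext v; simp [h.mem_verts v]

theorem IsAdjacency.length_verts {verts : List V} {nbrs : V → List (V × K)}
    (h : IsAdjacency verts nbrs) : verts.length = Fintype.card V := by
  have := h.sum_map (fun _ => 1)
  simpa using this

/-- The number of neighbours of `w` that are not discarded or still have to announce this. -/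
def CoreState.count (nbrs : V → List (V × K)) (s : CoreState V) (w : V) : ℕ :=
  (((nbrs w).map Prod.fst).toFinset.filter (fun u => s.alive u = true ∨ u ∈ s.todo)).card

/-- The remaining vertices have the maintained degree at least `k`; this degree is not too large,
up to the announcement of one discarded vertex to the vertices of `l`. -/
def CoreInv (nbrs : V → List (V × K)) (k : ℕ) (l : List V) (s : CoreState V) : Prop :=
  ∀ w, s.alive w = true → k ≤ s.deg w ∧ s.deg w ≤ s.count nbrs w + if w ∈ l then 1 else 0

/-- A vertex holds its credit `f v` while it is alive and while it waits in `todo`; the credit is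
spent when its neighbours are informed. -/
def CoreState.pot (f : V → ℕ) (s : CoreState V) : ℕ :=
  ∑ v ∈ Finset.univ.filter (fun v => s.alive v = true), f v + (s.todo.map f).sum

/-- The vertex passes from the alive ones to `todo`. Both `count` and `pot` treat the two groups
alike, so neither changes. -/
theorem wp_coreDiscard (nbrs : V → List (V × K)) (f : V → ℕ) (s : CoreState V) (v : V)
    (hv : s.alive v = true) :
    Wp (coreDiscard s v) (fun s' c => c = 2 ∧ s'.deg = s.deg ∧
      s'.alive = Function.update s.alive v false ∧ s'.count nbrs = s.count nbrs ∧
      s'.pot f = s.pot f) := by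
  unfold coreDiscard
  rw [wp_ops]
  refine ⟨rfl, rfl, rfl, ?_, ?_⟩
  · funext w
    unfold CoreState.count
    congr 1
    apply Finset.filter_congr
    intro u _
    by_cases h : u = v
    · subst h; simp [hv]
    · simp [h]
  · unfold CoreState.pot
    have h1 : Finset.univ.filter (fun v => s.alive v = true)
        = insert v (Finset.univ.filter (fun u => Function.update s.alive v false u = true)) := by
      ext u
      by_cases h : u = v
      · subst h; simp [hv]
      · simp [h]
    rw [h1, Finset.sum_insert (by simp)]
    simp only [List.map_cons, List.sum_cons]
    omega

/-- While the loss of `v` is being announced, a neighbour not yet visited has a maintained degree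
that may be too large by one. This is the summand for `w ∈ l` in `CoreInv`, and the visit to that
neighbour removes it by decrementing the degree. -/
theorem wp_coreStep {verts : List V} {nbrs : V → List (V × K)} (h : IsAdjacency verts nbrs)
    (k : ℕ) (s : CoreState V) (hs : CoreInv nbrs k [] s) (ht : s.todo.isEmpty = false) :
    Wp (coreStep nbrs k s) (fun s' c => CoreInv nbrs k [] s' ∧
      c + 1 + s'.pot (fun v => 8 * (nbrs v).length + 3)
        ≤ s.pot (fun v => 8 * (nbrs v).length + 3)) := by
  set f : V → ℕ := fun v => 8 * (nbrs v).length + 3 with hf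
  obtain ⟨deg, alive, todo⟩ := s
  cases todo with
  | nil => simp at ht
  | cons v rest =>
    unfold coreStep
    dsimp only
    rw [wp_bind, wp_op]
    refine (wp_forT
      (fun l s => (l.map Prod.fst).Nodup ∧ CoreInv nbrs k (l.map Prod.fst) s)
      (fun l s => 8 * l.length + s.pot f) ?_ (nbrs v) ⟨deg, alive, rest⟩ ?_).mono ?_
    · rintro e l s ⟨hnd, hi⟩
      simp only [List.map_cons, List.nodup_cons] at hnd
      have hskip : ∀ w, w ≠ e.1 → (if w ∈ (e :: l).map Prod.fst then 1 else 0)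
          = (if w ∈ l.map Prod.fst then 1 else 0) := fun w hw =>
        if_congr (by rw [List.map_cons, List.mem_cons]; exact or_iff_right hw) rfl rfl
      rw [wp_bind, wp_op]
      by_cases ha : s.alive e.1 = true
      · rw [if_pos ha, wp_bind, wp_ops, wp_bind, wp_op, wp_bind, wp_op]
        have hi1 := hi e.1 ha
        simp only [List.map_cons, List.mem_cons, true_or, if_true] at hi1
        by_cases hk : s.deg e.1 - 1 < k
        · rw [if_pos (by simpa using hk)]
          refine (wp_coreDiscard nbrs f
            { s with deg := Function.update s.deg e.1 (s.deg e.1 - 1) } e.1 ha).mono ?_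
          rintro s' c ⟨rfl, h1, h2, h3, h4⟩
          refine ⟨⟨hnd.2, ?_⟩, ?_⟩
          · intro w hw
            rw [h2] at hw
            have hwe : w ≠ e.1 := by rintro rfl; simp at hw
            rw [Function.update_of_ne hwe] at hw
            rw [h1, h3]
            dsimp only
            rw [Function.update_of_ne hwe, ← hskip w hwe]
            exact hi w hw
          · rw [h4]
            have : CoreState.pot f { s with deg := Function.update s.deg e.1 (s.deg e.1 - 1) }
              = s.pot f := rfl
            simp only [this, List.length_cons]; omega
        · rw [if_neg (by simpa using hk), wp_pure]
          refine ⟨⟨hnd.2, ?_⟩, ?_⟩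
          · intro w hw
            by_cases hwe : w = e.1
            · subst hwe
              have hc : CoreState.count nbrs
                { s with deg := Function.update s.deg e.1 (s.deg e.1 - 1) } = s.count nbrs := rfl
              rw [hc]
              simp only [Function.update_self]
              omega
            · dsimp only
              rw [Function.update_of_ne hwe, ← hskip w hwe]
              exact hi w hw
          · have : CoreState.pot f { s with deg := Function.update s.deg e.1 (s.deg e.1 - 1) }
              = s.pot f := rfl
            simp only [this, List.length_cons]; omega
      · rw [if_neg ha, wp_pure]
        refine ⟨⟨hnd.2, ?_⟩, by simp only [List.length_cons]; omega⟩
        intro w hw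
        have hwe : w ≠ e.1 := by rintro rfl; exact ha hw
        rw [← hskip w hwe]
        exact hi w hw
    · refine ⟨h.nodup_nbrs v, ?_⟩
      intro w hw
      have h1 := hs w hw
      simp only [List.not_mem_nil, if_false, add_zero] at h1
      refine ⟨h1.1, h1.2.trans ?_⟩
      unfold CoreState.count
      dsimp only
      split_ifs with hwv
      · rw [← Finset.card_singleton v]
        refine le_trans (Finset.card_le_card ?_) (Finset.card_union_le _ _)
        intro u hu
        simp only [Finset.mem_union, Finset.mem_filter, Finset.mem_singleton,
          List.mem_cons] at hu ⊢
        tauto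
      · rw [add_zero]
        refine Finset.card_le_card ?_
        intro u hu
        simp only [Finset.mem_filter, List.mem_cons, List.mem_toFinset] at hu ⊢
        refine ⟨hu.1, ?_⟩
        have : u ≠ v := by
          rintro rfl
          exact hwv (h.symm _ _ hu.1)
        tauto
    · rintro s' c ⟨⟨-, h1⟩, h2⟩
      refine ⟨h1, ?_⟩
      simp only [CoreState.pot, List.map_cons, List.sum_cons, List.length_nil, mul_zero] at h2 ⊢
      simp only [hf] at h2 ⊢
      omega

/-- Once `todo` is empty, `count` is the number of surviving neighbours, so the invariant gives the
degree bound. Maximality of the surviving set is neither shown nor needed. -/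
theorem wp_kCoreT {verts : List V} {nbrs : V → List (V × K)} (h : IsAdjacency verts nbrs)
    (k : ℕ) :
    Wp (kCoreT verts nbrs k) (fun alive c =>
      (∀ w, alive w = true → k ≤ (((nbrs w).map Prod.fst).toFinset.filter
        (fun u => alive u = true)).card) ∧
      c ≤ 10 * (∑ v, (nbrs v).length) + 13 * Fintype.card V + 6) := by
  unfold kCoreT
  have hn := h.length_verts
  rw [wp_bind]
  apply wp_newArray
  refine (wp_forT_sum (fun l (d : V → ℕ) => ∀ v, v ∉ l → d v = (nbrs v).length)
    (fun v => 2 * (nbrs v).length + 3) ?_ verts _ (fun v hv => absurd (h.mem_verts v) hv)).bind ?_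
  · intro v l d hd
    refine (wp_lengthT (nbrs v)).bind ?_
    rintro n c ⟨rfl, hc⟩
    rw [wp_op]
    refine ⟨fun w hw => ?_, by omega⟩
    by_cases hwv : w = v
    · subst hwv; simp
    · rw [Function.update_of_ne hwv]
      exact hd w (by simp [hwv, hw])
  rintro deg c1 ⟨hdeg, hc1⟩
  rw [wp_bind]
  apply wp_newArray
  set f : V → ℕ := fun v => 8 * (nbrs v).length + 3 with hf
  have hinit : ∀ w, ({ deg := deg, alive := fun _ => true, todo := [] } : CoreState V).count nbrs w
      = (nbrs w).length := by
    intro w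
    unfold CoreState.count
    simp only [List.not_mem_nil, or_false, Finset.filter_true]
    rw [List.toFinset_card_of_nodup (h.nodup_nbrs w), List.length_map]
  refine (wp_forT_sum (fun l (s : CoreState V) => s.deg = deg ∧
      (∀ w, s.count nbrs w = (nbrs w).length) ∧ (∀ w, w ∉ l → s.alive w = true → k ≤ deg w) ∧
      s.pot f = ∑ v, f v ∧ l.Nodup ∧ ∀ w ∈ l, s.alive w = true)
    (fun v => 5) ?_ verts _ ?_).bind ?_
  · rintro v l s ⟨h1, h2, h3, h4, h5, h6⟩
    rw [wp_bind, wp_ops]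
    rw [List.nodup_cons] at h5
    by_cases hk : s.deg v < k
    · rw [if_pos (by simpa using hk)]
      refine (wp_coreDiscard nbrs f s v (h6 v (by simp))).mono ?_
      rintro s' c ⟨rfl, g1, g2, g3, g4⟩
      refine ⟨⟨g1.trans h1, by rw [g3]; exact h2, ?_, g4.trans h4, h5.2, ?_⟩, by omega⟩
      · intro w hw ha
        rw [g2] at ha
        have hwv : w ≠ v := by rintro rfl; simp at ha
        rw [Function.update_of_ne hwv] at ha
        exact h3 w (by simp [hwv, hw]) ha
      · intro w hw
        have hwv : w ≠ v := by rintro rfl; exact h5.1 hw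
        rw [g2, Function.update_of_ne hwv]
        exact h6 w (by simp [hw])
    · rw [if_neg (by simpa using hk), wp_pure]
      refine ⟨⟨h1, h2, ?_, h4, h5.2, fun w hw => h6 w (by simp [hw])⟩, by omega⟩
      intro w hw ha
      by_cases hwv : w = v
      · subst hwv; rw [← h1]; omega
      · exact h3 w (by simp [hwv, hw]) ha
  · refine ⟨rfl, hinit, fun w hw => absurd (h.mem_verts w) hw, ?_, h.nodup_verts, fun _ _ => rfl⟩
    simp [CoreState.pot]
  rintro s c2 ⟨⟨h1, h2, h3, h4, -, -⟩, hc2⟩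
  refine (wp_whileT (CoreInv nbrs k []) (fun s => s.pot f) ?_ s ?_).bind ?_
  · intro s hs ht
    exact wp_coreStep h k s hs (by simpa using ht)
  · intro w hw
    rw [h2, h1]
    refine ⟨h3 w (by simp) hw, ?_⟩
    rw [hdeg w (by simp)]
    simp
  rintro s' c3 ⟨g1, g2, g3⟩
  rw [wp_pure]
  have htodo : s'.todo = [] := by simpa using g2
  refine ⟨?_, ?_⟩
  · intro w hw
    have := g1 w hw
    simp only [List.not_mem_nil, if_false, add_zero, CoreState.count, htodo, or_false] at this
    exact this.1.trans this.2
  · rw [h.sum_map] at hc1 hc2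
    rw [h4] at g3
    simp only [hf, Finset.sum_add_distrib, Finset.sum_const, Finset.card_univ, smul_eq_mul,
      ← Finset.mul_sum] at g3 hc1 hc2
    omega

/-- By `hm` a nonempty result for `k` certifies `k ≤ m`. Hence at most `m` tests succeed and one
fails, and each costs at most `B`; the factor `m + 1 - s.1` in the potential counts the tests that
may remain. -/
theorem wp_kMaxT {verts : List V} {nbrs : V → List (V × K)} (h : IsAdjacency verts nbrs) (m : ℕ)
    (hm : ∀ (k : ℕ) (alive : V → Bool), (∃ w, alive w = true) →
      (∀ w, alive w = true → k ≤ (((nbrs w).map Prod.fst).toFinset.filter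
        (fun u => alive u = true)).card) → k ≤ m) :
    Wp (kMaxT verts nbrs) (fun r c => r ≤ m ∧
      c ≤ (m + 1) * (10 * (∑ v, (nbrs v).length) + 15 * Fintype.card V + 10) + 1) := by
  unfold kMaxT
  have hn := h.length_verts
  set B := 10 * (∑ v, (nbrs v).length) + 15 * Fintype.card V + 10 with hB
  refine (wp_whileT (fun s : ℕ × Bool => s.1 ≤ m)
    (fun s => if s.2 then (m + 1 - s.1) * B else 0) ?_ (0, true) (Nat.zero_le _)).bind ?_
  · rintro ⟨i, b⟩ hi hb
    dsimp only at hi hb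
    subst hb
    refine (wp_kCoreT h (i + 1)).bind ?_
    rintro alive c1 ⟨h1, hc1⟩
    refine (wp_filterT alive verts).bind ?_
    rintro core c2 ⟨rfl, hc2⟩
    rw [wp_bind, wp_op]
    by_cases hne : (verts.filter alive).isEmpty = true
    · rw [if_neg (by simp [hne]), wp_op]
      refine ⟨hi, ?_⟩
      have : B ≤ (m + 1 - i) * B := Nat.le_mul_of_pos_left _ (by omega)
      simp only [if_true, Bool.false_eq_true, if_false]
      omega
    · rw [if_pos (by simpa using hne), wp_op]
      have hex : ∃ w, alive w = true := by
        by_contra hno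
        apply hne
        push Not at hno
        simp only [List.isEmpty_iff, List.filter_eq_nil_iff]
        intro a _; exact hno a
      have him := hm (i + 1) alive hex h1
      refine ⟨him, ?_⟩
      have : (m + 1 - i) * B = B + (m + 1 - (i + 1)) * B := by
        have : m + 1 - i = 1 + (m + 1 - (i + 1)) := by omega
        rw [this, add_mul, one_mul]
      simp only [if_true]
      omega
  · rintro s c ⟨h1, -, h3⟩
    rw [wp_pure]
    refine ⟨h1, ?_⟩
    simp only [if_true, Nat.sub_zero] at h3
    omega

/-! ### The shape of Fibonacci heaps -/

/-- Every entry of the list has at least as much weight as there are entries behind it. -/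
def Spaced (w : V → ℕ) : List V → Prop
  | [] => True
  | c :: l => l.length ≤ w c ∧ Spaced w l

theorem Spaced.mono {w w' : V → ℕ} : ∀ {l : List V}, Spaced w l → (∀ c ∈ l, w c ≤ w' c) →
    Spaced w' l
  | [], _, _ => trivial
  | c :: _, h, hw => ⟨h.1.trans (hw c (by simp)),
      h.2.mono (fun d hd => hw d (List.mem_cons_of_mem _ hd))⟩

theorem Spaced.sublist {w : V → ℕ} {l l' : List V} (hl : l'.Sublist l) (h : Spaced w l) :
    Spaced w l' := by
  induction hl with
  | slnil => trivial
  | cons a _ ih => exact ih h.2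
  | cons_cons a hs ih => exact ⟨hs.length_le.trans h.1, ih h.2⟩

/-- The weights are at least `d - 1, …, 1, 0` for a list of length `d`, so they sum to at least `d
(d - 1) / 2`. -/
theorem Spaced.sq_length_le {w : V → ℕ} : ∀ {l : List V}, Spaced w l →
    l.length ^ 2 ≤ 2 * (l.map w).sum + l.length
  | [], _ => by simp
  | c :: l, h => by
    have h1 := h.1
    have h2 := h.2.sq_length_le
    simp only [List.length_cons, List.map_cons, List.sum_cons]
    nlinarith

/-- The rank of a vertex, plus one for its mark, plus one if it is the exception `exc`. -/
def forestWeight (exc : Option V) (rank : V → ℕ) (mark : V → Bool) (c : V) : ℕ :=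
  rank c + (if mark c = true then 1 else 0) + (if exc = some c then 1 else 0)

/-- The members form a forest in which a vertex has lost at most one child since it became a child
itself, and only if it is marked; the vertex `exc` may have lost one more. -/
structure Forest (exc : Option V) (mem : V → Bool) (parent : V → Option V)
    (children : V → List V) (rank : V → ℕ) (mark : V → Bool) : Prop where
  nodup_children : ∀ y, (children y).Nodup
  mem_children : ∀ x y, x ∈ children y ↔ mem x = true ∧ parent x = some y
  rank_eq : ∀ y, rank y = (children y).length
  mem_parent : ∀ x y, mem x = true → parent x = some y → mem y = true
  acyclic : ∃ ht : V → ℕ, ∀ x y, mem x = true → parent x = some y → ht x < ht y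
  spaced : ∀ y, Spaced (forestWeight exc rank mark) (children y)

/-- A bound on the ranks in a heap whose elements are vertices. -/
def rankBound (V : Type) [Fintype V] : ℕ := 2 * Nat.sqrt (Fintype.card V) + 6

/-- With `q = √n ≥ 1` rounded down, `2 q + 7 ≤ 9 q`. The square is what remains of the rank bound
after the inequality between the arithmetic and geometric means in `iterationCost_le`. -/
theorem sq_rankBound_le (V : Type) [Fintype V] [Nonempty V] :
    (rankBound V + 1) ^ 2 ≤ 81 * Fintype.card V := by
  unfold rankBound
  have h1 : Nat.sqrt (Fintype.card V) * Nat.sqrt (Fintype.card V) ≤ Fintype.card V :=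
    Nat.sqrt_le _
  have h2 : 1 ≤ Nat.sqrt (Fintype.card V) := by
    rw [Nat.le_sqrt]; exact Fintype.card_pos
  nlinarith

section Forest

variable {exc : Option V} {mem : V → Bool} {parent : V → Option V} {children : V → List V}
  {rank : V → ℕ} {mark : V → Bool}

theorem Forest.weaken (h : Forest none mem parent children rank mark) (exc : Option V) :
    Forest exc mem parent children rank mark :=
  { h with
    spaced := fun y => (h.spaced y).mono (fun c _ => by unfold forestWeight; simp) }

/-- Child lists are disjoint, so all ranks add up to at most `n`. The weights of the `d` children of
`y` exceed their ranks by at most 2 each, and `Spaced` then gives `d ^ 2 ≤ 2 n + 5 d`. Subtree sizes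
never enter. -/
theorem Forest.rank_le (h : Forest exc mem parent children rank mark) (y : V) :
    rank y ≤ rankBound V := by
  have h1 : ∑ v, rank v ≤ Fintype.card V := by
    have : ∀ v, rank v = (children v).toFinset.card := fun v => by
      rw [h.rank_eq, List.toFinset_card_of_nodup (h.nodup_children v)]
    simp_rw [this]
    rw [← Finset.card_biUnion]
    · exact Finset.card_le_univ _
    · intro a _ b _ hab
      rw [Function.onFun, Finset.disjoint_left]
      intro x hx hx'
      rw [List.mem_toFinset, h.mem_children] at hx hx'
      exact hab (Option.some.inj (hx.2.symm.trans hx'.2))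
  have h2 := (h.spaced y).sq_length_le
  have h3 : ((children y).map (forestWeight exc rank mark)).sum
      ≤ ((children y).map rank).sum + 2 * (children y).length := by
    generalize children y = l
    induction l with
    | nil => simp
    | cons c l ih =>
      have : forestWeight exc rank mark c ≤ rank c + 2 := by
        unfold forestWeight; split_ifs <;> omega
      simp only [List.map_cons, List.sum_cons, List.length_cons]
      omega
  have h4 : ((children y).map rank).sum ≤ ∑ v, rank v :=
    sum_map_le_of_nodup (h.nodup_children y) rank
  have h5 : Fintype.card V < (Nat.sqrt (Fintype.card V) + 1) * (Nat.sqrt (Fintype.card V) + 1) :=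
    Nat.lt_succ_sqrt _
  rw [← h.rank_eq] at h2 h3
  by_contra hlt
  unfold rankBound at hlt
  generalize Nat.sqrt (Fintype.card V) = q at h5 hlt
  nlinarith

/-- A member of maximal height cannot have a parent. Consequently a heap without roots is empty, as
`wp_collect` requires. -/
theorem Forest.exists_root (h : Forest exc mem parent children rank mark) {v : V}
    (hv : mem v = true) : ∃ r, mem r = true ∧ parent r = none := by
  obtain ⟨ht, hht⟩ := h.acyclic
  obtain ⟨r, hr, hmax⟩ := Finset.exists_max_image (Finset.univ.filter (fun u => mem u = true)) ht
    ⟨v, by simpa using hv⟩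
  simp only [Finset.mem_filter, Finset.mem_univ, true_and] at hr hmax
  refine ⟨r, hr, ?_⟩
  cases hp : parent r with
  | none => rfl
  | some z =>
    have h1 := hht r z hr hp
    have h2 := hmax z (h.mem_parent r z hr hp)
    omega

theorem Forest.ne_parent (h : Forest exc mem parent children rank mark) {x y : V}
    (hx : mem x = true) (hxy : parent x = some y) : x ≠ y := by
  obtain ⟨ht, hht⟩ := h.acyclic
  rintro rfl
  exact absurd (hht x x hx hxy) (lt_irrefl _)

theorem Forest.insert (h : Forest none mem parent children rank mark) {v : V}
    (hv : mem v = false) :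
    Forest none (Function.update mem v true) (Function.update parent v none)
      (Function.update children v []) (Function.update rank v 0)
      (Function.update mark v false) := by
  have hne : ∀ x y, x ∈ children y → x ≠ v := by
    rintro x y hx rfl
    have := ((h.mem_children _ _).mp hx).1
    simp [hv] at this
  obtain ⟨ht, hht⟩ := h.acyclic
  constructor
  · intro y
    by_cases hy : y = v
    · subst hy; simp
    · simpa [hy] using h.nodup_children y
  · intro x y
    by_cases hy : y = v
    · subst hy
      by_cases hx : x = y
      · subst hx; simp
      · simp only [Function.update_self, List.not_mem_nil, Function.update_of_ne hx, false_iff]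
        rintro ⟨h1, h2⟩
        have := h.mem_parent x y h1 h2
        simp [hv] at this
    · rw [Function.update_of_ne hy]
      by_cases hx : x = v
      · subst hx
        simp only [Function.update_self, reduceCtorEq, and_false, iff_false]
        exact fun hx => hne _ _ hx rfl
      · simpa [hx] using h.mem_children x y
  · intro y
    by_cases hy : y = v
    · subst hy; simp
    · simpa [hy] using h.rank_eq y
  · intro x y hx hxy
    by_cases hy : y = v
    · subst hy; simp
    · by_cases hxv : x = v
      · subst hxv; simp at hxy
      · simp only [Function.update_of_ne hy]
        simp only [Function.update_of_ne hxv] at hx hxy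
        exact h.mem_parent x y hx hxy
  · refine ⟨ht, fun x y hx hxy => ?_⟩
    by_cases hxv : x = v
    · subst hxv; simp at hxy
    · simp only [Function.update_of_ne hxv] at hx hxy
      exact hht x y hx hxy
  · intro y
    by_cases hy : y = v
    · subst hy; simp [Spaced]
    · rw [Function.update_of_ne hy]
      refine (h.spaced y).mono (fun c hc => ?_)
      simp [forestWeight, Function.update_of_ne (hne c y hc)]

/-- Losing the child `x` lowers the rank of `y` by one, and making `y` the exception gives this
weight back. The vertex `x` may give up its mark and its exceptional status, since as a root it
occurs in no child list. -/
theorem Forest.cut {x y : V} (h : Forest (some x) mem parent children rank mark)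
    (hx : mem x = true) (hxy : parent x = some y) :
    Forest (some y) mem (Function.update parent x none)
      (Function.update children y ((children y).erase x)) (Function.update rank y (rank y - 1))
      (Function.update mark x false) := by
  have hne : x ≠ y := h.ne_parent hx hxy
  have hmem : x ∈ children y := (h.mem_children x y).mpr ⟨hx, hxy⟩
  obtain ⟨ht, hht⟩ := h.acyclic
  have hpar : ∀ u z, Function.update parent x none u = some z ↔ u ≠ x ∧ parent u = some z := by
    intro u z
    by_cases hu : u = x
    · subst hu; simp
    · simp [hu]
  constructor
  · intro z
    by_cases hz : z = y
    · subst hz; simpa using (h.nodup_children z).erase x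
    · simpa [hz] using h.nodup_children z
  · intro u z
    rw [hpar]
    by_cases hz : z = y
    · subst hz
      rw [Function.update_self, (h.nodup_children z).mem_erase_iff, h.mem_children]
      tauto
    · rw [Function.update_of_ne hz, h.mem_children]
      refine ⟨fun hu => ⟨hu.1, ?_, hu.2⟩, fun hu => ⟨hu.1, hu.2.2⟩⟩
      rintro rfl
      exact hz (Option.some.inj (hu.2.symm.trans hxy))
  · intro z
    by_cases hz : z = y
    · subst hz
      simp [List.length_erase_of_mem hmem, h.rank_eq]
    · simpa [hz] using h.rank_eq z
  · intro u z hu huz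
    rw [hpar] at huz
    exact h.mem_parent u z hu huz.2
  · refine ⟨ht, fun u z hu huz => ?_⟩
    rw [hpar] at huz
    exact hht u z hu huz.2
  · have key : ∀ c, c ≠ x → forestWeight (some x) rank mark c
        ≤ forestWeight (some y) (Function.update rank y (rank y - 1))
          (Function.update mark x false) c := by
      intro c hc
      unfold forestWeight
      rw [Function.update_of_ne hc]
      by_cases hcy : c = y
      · subst hcy
        simp only [Function.update_self, Option.some.injEq, if_neg hne]
        simp
        omega
      · simp [hcy, Ne.symm hc]
    intro z
    by_cases hz : z = y
    · subst hz
      rw [Function.update_self]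
      refine ((h.spaced z).sublist (List.erase_sublist)).mono (fun c hc => key c ?_)
      rw [(h.nodup_children z).mem_erase_iff] at hc
      exact hc.1
    · rw [Function.update_of_ne hz]
      refine (h.spaced z).mono (fun c hc => key c ?_)
      rintro rfl
      exact hz (Option.some.inj (((h.mem_children _ _).mp hc).2.symm.trans hxy))

/-- The exception may be dropped if it is a root. -/
theorem Forest.drop_root {y : V} (h : Forest (some y) mem parent children rank mark)
    (hy : parent y = none) : Forest none mem parent children rank mark :=
  { h with
    spaced := fun z => (h.spaced z).mono (fun c hc => by
      have : y ≠ c := by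
        rintro rfl
        have := ((h.mem_children _ _).mp hc).2
        simp [hy] at this
      simp [forestWeight, this]) }

/-- The exception may be dropped if an unmarked vertex is marked instead. -/
theorem Forest.drop_mark {y : V} (h : Forest (some y) mem parent children rank mark)
    (hy : mark y = false) :
    Forest none mem parent children rank (Function.update mark y true) :=
  { h with
    spaced := fun z => (h.spaced z).mono (fun c _ => by
      by_cases hc : c = y
      · subst hc; simp [forestWeight, hy]
      · simp [forestWeight, hc, Ne.symm hc]) }

/-- The vertex `y` is put in front of the `rank x` present children, and equality of the ranks says
that its weight is large enough for this position. The other children keep their positions and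
weights. -/
theorem Forest.link (h : Forest none mem parent children rank mark) {y x : V} (hyx : y ≠ x)
    (hy : mem y = true) (hx : mem x = true) (hpy : parent y = none) (hpx : parent x = none)
    (hr : rank y = rank x) :
    Forest none mem (Function.update parent y (some x))
      (Function.update children x (y :: children x)) (Function.update rank x (rank x + 1))
      (Function.update mark y false) := by
  obtain ⟨ht, hht⟩ := h.acyclic
  have hroot : ∀ u z, u ∈ children z → u ≠ y ∧ u ≠ x := by
    intro u z hu
    have := ((h.mem_children _ _).mp hu).2
    constructor
    · rintro rfl; simp [hpy] at this
    · rintro rfl; simp [hpx] at this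
  have hw : ∀ u, u ≠ y → u ≠ x → forestWeight none (Function.update rank x (rank x + 1))
      (Function.update mark y false) u = forestWeight none rank mark u := by
    intro u h1 h2; simp [forestWeight, h1, h2]
  constructor
  · intro z
    by_cases hz : z = x
    · subst hz
      simp only [Function.update_self, List.nodup_cons]
      exact ⟨fun hm => (hroot _ _ hm).1 rfl, h.nodup_children z⟩
    · simpa [hz] using h.nodup_children z
  · intro u z
    by_cases hu : u = y
    · subst hu
      by_cases hz : z = x
      · subst hz; simp [hy]
      · simp only [Function.update_of_ne hz, Function.update_self, Option.some.injEq, Ne.symm hz,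
          and_false, iff_false]
        exact fun hm => (hroot _ _ hm).1 rfl
    · rw [Function.update_of_ne hu, ← h.mem_children]
      by_cases hz : z = x
      · subst hz; simp [hu]
      · simp [hz]
  · intro z
    by_cases hz : z = x
    · subst hz; simp [h.rank_eq]
    · simpa [hz] using h.rank_eq z
  · intro u z hu huz
    by_cases huy : u = y
    · subst huy
      simp at huz
      exact huz ▸ hx
    · rw [Function.update_of_ne huy] at huz
      exact h.mem_parent u z hu huz
  · refine ⟨Function.update ht x (max (ht x) (ht y + 1)), fun u z hu huz => ?_⟩
    by_cases huy : u = y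
    · subst huy
      simp only [Function.update_self, Option.some.injEq] at huz
      subst huz
      rw [Function.update_self, Function.update_of_ne hyx]
      omega
    · rw [Function.update_of_ne huy] at huz
      have hux : u ≠ x := by rintro rfl; simp [hpx] at huz
      have := hht u z hu huz
      rw [Function.update_of_ne hux]
      by_cases hz : z = x
      · subst hz; rw [Function.update_self]; omega
      · rwa [Function.update_of_ne hz]
  · intro z
    have hold : ∀ z, Spaced (forestWeight none (Function.update rank x (rank x + 1))
        (Function.update mark y false)) (children z) := fun z =>
      (h.spaced z).mono (fun c hc => (hw c (hroot c z hc).1 (hroot c z hc).2).ge)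
    by_cases hz : z = x
    · subst hz
      rw [Function.update_self]
      refine ⟨?_, hold z⟩
      rw [← h.rank_eq, ← hr]
      simp [forestWeight, hyx]
    · rw [Function.update_of_ne hz]; exact hold z

/-- Only `m` and its children are altered. Neither occurs in another child list: `m` has no parent,
and a child has only one. -/
theorem Forest.removeRoot (h : Forest none mem parent children rank mark) {m : V}
    (hp : parent m = none) :
    Forest none (Function.update mem m false)
      (fun x => if x ∈ children m then none else parent x)
      (Function.update children m []) (Function.update rank m 0)
      (fun x => if x ∈ children m then false else mark x) := by
  obtain ⟨ht, hht⟩ := h.acyclic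
  have hm : ∀ y, m ∉ children y := fun y hy => by
    have := ((h.mem_children _ _).mp hy).2
    simp [hp] at this
  have hdisj : ∀ x y, y ≠ m → x ∈ children y → x ∉ children m := fun x y hy hx hx' =>
    hy (Option.some.inj (((h.mem_children _ _).mp hx).2.symm.trans ((h.mem_children _ _).mp hx').2))
  have hmem : ∀ x, Function.update mem m false x = true ↔ x ≠ m ∧ mem x = true := fun x => by
    by_cases hx : x = m
    · subst hx; simp
    · simp [hx]
  have hpar : ∀ x y, (if x ∈ children m then none else parent x) = some y ↔
      x ∉ children m ∧ parent x = some y := fun x y => by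
    by_cases hx : x ∈ children m <;> simp [hx]
  constructor
  · intro y
    by_cases hy : y = m
    · subst hy; simp
    · simpa [hy] using h.nodup_children y
  · intro x y
    rw [hmem, hpar]
    by_cases hy : y = m
    · subst hy
      simp only [Function.update_self, List.not_mem_nil, false_iff]
      rintro ⟨⟨-, h1⟩, h2, h3⟩
      exact h2 ((h.mem_children _ _).mpr ⟨h1, h3⟩)
    · rw [Function.update_of_ne hy]
      constructor
      · intro hx
        have := (h.mem_children _ _).mp hx
        exact ⟨⟨by rintro rfl; exact hm _ hx, this.1⟩, hdisj x y hy hx, this.2⟩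
      · rintro ⟨⟨-, h1⟩, -, h3⟩
        exact (h.mem_children _ _).mpr ⟨h1, h3⟩
  · intro y
    by_cases hy : y = m
    · subst hy; simp
    · simpa [hy] using h.rank_eq y
  · intro x y hx hxy
    rw [hmem] at hx ⊢
    rw [hpar] at hxy
    refine ⟨?_, h.mem_parent x y hx.2 hxy.2⟩
    rintro rfl
    exact hxy.1 ((h.mem_children _ _).mpr ⟨hx.2, hxy.2⟩)
  · refine ⟨ht, fun x y hx hxy => ?_⟩
    rw [hmem] at hx
    rw [hpar] at hxy
    exact hht x y hx.2 hxy.2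
  · intro y
    by_cases hy : y = m
    · subst hy; simp [Spaced]
    · rw [Function.update_of_ne hy]
      refine (h.spaced y).mono (fun c hc => ?_)
      have hcm : c ≠ m := by rintro rfl; exact hm _ hc
      simp [forestWeight, hcm, hdisj c y hy hc]

end Forest

/-! ### Amortized cost of the heap operations -/

namespace FibHeap

abbrev IsForest (exc : Option V) (h : FibHeap V K) : Prop :=
  Forest exc h.mem h.parent h.children h.rank h.mark

/-- The invariant between two heap operations (for `exc = none`) and during a cascading cut that
has arrived at `exc`. -/
structure Inv (exc : Option V) (h : FibHeap V K) : Prop where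
  forest : h.IsForest exc
  nodup_roots : h.roots.Nodup
  mem_roots : ∀ v, v ∈ h.roots ↔ h.mem v = true ∧ h.parent v = none
  table : ∀ j, h.table j = none
  min_mem : ∀ m, h.min = some m → h.mem m = true
  min_none : h.min = none → ∀ v, h.mem v = false

/-- The pointer to the minimum shows a root. -/
def RootMin (h : FibHeap V K) : Prop := ∀ m, h.min = some m → h.parent m = none

/-- The number of marked vertices. -/
def marks (h : FibHeap V K) : ℕ := (Finset.univ.filter (fun v => h.mark v = true)).card

/-- A root carries 19 for the next consolidation and 2 for the scan of the root list before it. A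
mark pays for one round of a cascading cut: a scan of a child list, a constant overhead and the 21
units of the new root. -/
def pot (h : FibHeap V K) : ℕ := 21 * h.roots.length + 32 * (rankBound V + 1) * h.marks

/-- A bound on the amortized cost of each heap operation. -/
def _root_.OptiUCF.heapCost (V : Type) [Fintype V] : ℕ := 120 * (rankBound V + 1)

theorem Inv.weaken {h : FibHeap V K} (hi : Inv none h) (exc : Option V) : Inv exc h :=
  { hi with forest := hi.forest.weaken exc }

theorem marks_le {h h' : FibHeap V K} (hm : ∀ v, h'.mark v = true → h.mark v = true) :
    h'.marks ≤ h.marks := by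
  refine Finset.card_le_card (fun v hv => ?_)
  simp only [Finset.mem_filter, Finset.mem_univ, true_and] at hv ⊢
  exact hm v hv

theorem wp_empty (verts : List V) : Wp (empty verts : Timed (FibHeap V K)) (fun h c =>
    Inv none h ∧ RootMin h ∧ (∀ v, h.mem v = false) ∧ h.pot = 0 ∧
      c ≤ 7 * verts.length + 2) := by
  unfold empty
  rw [wp_ops]
  refine ⟨⟨⟨?_, ?_, ?_, ?_, ?_, ?_⟩, ?_, ?_, ?_, ?_, ?_⟩, ?_, ?_, ?_, ?_⟩ <;>
    simp [RootMin, pot, marks, Spaced]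

theorem wp_updateMin (h : FibHeap V K) (v : V) : Wp (h.updateMin v) (fun h' c =>
    (∃ o, h' = { h with min := o } ∧ (o = some v ∨ o = h.min ∧ h.min ≠ none)) ∧ c ≤ 5) := by
  unfold updateMin
  rw [wp_bind, wp_ops]
  cases hm : h.min with
  | none => simp only [if_true, wp_op]; exact ⟨⟨_, rfl, Or.inl rfl⟩, le_rfl⟩
  | some m =>
    dsimp only
    split_ifs
    · rw [wp_op]; exact ⟨⟨_, rfl, Or.inl rfl⟩, le_rfl⟩
    · rw [wp_pure]; exact ⟨⟨h.min, rfl, Or.inr ⟨hm, by simp⟩⟩, by omega⟩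

theorem Inv.setMin {exc : Option V} {h : FibHeap V K} (hi : Inv exc h) {o : Option V} {v : V}
    (hv : h.mem v = true) (ho : o = some v ∨ o = h.min ∧ h.min ≠ none) :
    Inv exc { h with min := o } := by
  refine { hi with min_mem := ?_, min_none := ?_ }
  · intro m hm
    rcases ho with rfl | ⟨rfl, -⟩
    · cases hm; exact hv
    · exact hi.min_mem m hm
  · intro hm
    rcases ho with rfl | ⟨rfl, h1⟩
    · cases hm
    · exact absurd hm h1

theorem wp_insert {h : FibHeap V K} (hi : Inv none h) {v : V} (hv : h.mem v = false) (x : K) :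
    Wp (h.insert v x) (fun h' c => Inv none h' ∧ (RootMin h → RootMin h') ∧
      h'.mem = Function.update h.mem v true ∧ c + h'.pot ≤ h.pot + heapCost V) := by
  unfold insert
  rw [wp_bind, wp_ops]
  have hmv : ∀ m, h.min = some m → m ≠ v := by
    rintro m hm rfl
    have := hi.min_mem m hm
    simp [hv] at this
  refine (wp_updateMin _ v).mono ?_
  rintro h' c ⟨⟨o, rfl, ho⟩, hc⟩
  dsimp only at ho
  refine ⟨⟨hi.forest.insert hv, ?_, ?_, hi.table, ?_, ?_⟩, ?_, rfl, ?_⟩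
  · refine List.nodup_cons.mpr ⟨fun hm => ?_, hi.nodup_roots⟩
    have := ((hi.mem_roots v).mp hm).1
    simp [hv] at this
  · intro u
    by_cases hu : u = v
    · subst hu; simp
    · simpa [hu] using hi.mem_roots u
  · intro m hm
    dsimp only at hm ⊢
    rcases ho with rfl | ⟨rfl, -⟩
    · cases hm; simp
    · rw [Function.update_of_ne (hmv m hm)]; exact hi.min_mem m hm
  · intro hm
    dsimp only at hm
    rcases ho with rfl | ⟨rfl, h1⟩
    · cases hm
    · exact absurd hm h1
  · intro hr m hm
    dsimp only at hm ⊢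
    rcases ho with rfl | ⟨rfl, -⟩
    · cases hm; simp
    · rw [Function.update_of_ne (hmv m hm)]; exact hr m hm
  · have hmk : marks (K := K) { h with
        mem := Function.update h.mem v true
        key := Function.update h.key v x
        parent := Function.update h.parent v none
        children := Function.update h.children v []
        rank := Function.update h.rank v 0
        mark := Function.update h.mark v false
        roots := v :: h.roots, min := o } ≤ h.marks := by
      apply marks_le
      intro u hu
      by_cases huv : u = v
      · subst huv; simp at hu
      · simpa [huv] using hu
    unfold pot heapCost
    have := Nat.mul_le_mul_left (32 * (rankBound V + 1)) hmk
    simp only [List.length_cons]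
    omega

/-- Child lists are singly linked, so a cut scans one. Its length is a rank, which accounts for the
term `2 * rankBound V`. -/
theorem wp_cut {h : FibHeap V K} {x y : V} (hi : Inv (some x) h) (hx : h.mem x = true)
    (hxy : h.parent x = some y) :
    Wp (h.cut x y) (fun h' c => Inv (some y) h' ∧ h'.mem = h.mem ∧
      (∀ u, h.parent u = none → h'.parent u = none) ∧ h'.parent x = none ∧
      h'.roots.length = h.roots.length + 1 ∧
      h'.marks + (if h.mark x = true then 1 else 0) ≤ h.marks ∧
      c ≤ 2 * rankBound V + 7) := by
  unfold cut
  refine (wp_eraseT x (h.children y)).bind ?_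
  rintro cs c ⟨rfl, hc⟩
  rw [wp_ops]
  have hr := hi.forest.rank_le y
  rw [hi.forest.rank_eq] at hr
  refine ⟨⟨hi.forest.cut hx hxy, ?_, ?_, hi.table, hi.min_mem, hi.min_none⟩, rfl, ?_, ?_, ?_, ?_,
    ?_⟩
  · refine List.nodup_cons.mpr ⟨fun hm => ?_, hi.nodup_roots⟩
    have := ((hi.mem_roots x).mp hm).2
    simp [hxy] at this
  · intro u
    by_cases hu : u = x
    · subst hu; simp [hx]
    · simpa [hu] using hi.mem_roots u
  · intro u hu
    dsimp only
    by_cases hux : u = x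
    · subst hux; simp
    · rw [Function.update_of_ne hux]; exact hu
  · simp
  · simp
  · unfold marks
    dsimp only
    have hsub : Finset.univ.filter (fun v => Function.update h.mark x false v = true)
        = (Finset.univ.filter (fun v => h.mark v = true)).erase x := by
      ext u
      by_cases hux : u = x
      · subst hux; simp
      · simp [hux]
    rw [hsub]
    split_ifs with hmk
    · have hin : x ∈ Finset.univ.filter (fun v => h.mark v = true) := by simpa using hmk
      rw [Finset.card_erase_of_mem hin]
      have := Finset.card_pos.mpr ⟨x, hin⟩
      omega
    · simpa using Finset.card_le_card (Finset.erase_subset _ _)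
  · omega

/-- A round that cuts clears a mark, whose credit covers the round; the exception moves up to the
parent. Only the last round can set a mark, hence the single summand `32 * (rankBound V + 1)`.
Halting follows from the potential. -/
theorem wp_cascade {h : FibHeap V K} {y : V} (hi : Inv (some y) h) (hy : h.mem y = true) :
    Wp (h.cascade y) (fun h' c => Inv none h' ∧ h'.mem = h.mem ∧
      (∀ u, h.parent u = none → h'.parent u = none) ∧
      c + h'.pot ≤ h.pot + 32 * (rankBound V + 1) + 6) := by
  unfold cascade
  set R := rankBound V with hR
  refine (wp_whileT
    (fun t : FibHeap V K × Option V => Inv t.2 t.1 ∧ (∀ z, t.2 = some z → t.1.mem z = true) ∧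
      t.1.mem = h.mem ∧ (∀ u, h.parent u = none → t.1.parent u = none))
    (fun t => t.1.pot + if t.2.isSome then 32 * (R + 1) + 4 else 0) ?_ (h, some y)
    ⟨hi, fun z hz => by cases hz; exact hy, rfl, fun _ h => h⟩).bind ?_
  · rintro ⟨h, o⟩ ⟨h1, h2, h3, h4⟩ ho
    cases o with
    | none => simp at ho
    | some y =>
      dsimp only at h1 h2 h3 h4 ⊢
      cases hp : h.parent y with
      | none =>
        dsimp only
        rw [wp_op]
        refine ⟨⟨{ h1 with forest := h1.forest.drop_root hp }, fun z hz => (by cases hz), h3, h4⟩, ?_⟩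
        simp
        omega
      | some z =>
        dsimp only
        rw [wp_bind, wp_ops]
        by_cases hm : h.mark y = true
        · rw [if_pos hm]
          refine (wp_cut h1 (h2 y rfl) hp).bind ?_
          rintro h' c ⟨g1, g2, g3, -, g5, g6, g7⟩
          rw [wp_op]
          refine ⟨⟨g1, ?_, by rw [g2, h3], fun u hu => g3 u (h4 u hu)⟩, ?_⟩
          · rintro w hw
            cases hw
            dsimp only
            rw [g2]
            exact h1.forest.mem_parent y _ (h2 y rfl) hp
          · rw [if_pos hm] at g6
            have := Nat.mul_le_mul_left (32 * (R + 1)) g6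
            simp only [pot, Option.isSome_some, if_true, g5]
            rw [← hR]
            rw [mul_add] at this
            omega
        · rw [if_neg hm, wp_op]
          have hm' : h.mark y = false := by simpa using hm
          refine ⟨⟨{ h1 with forest := h1.forest.drop_mark hm' }, fun z hz => (by cases hz), h3, h4⟩,
            ?_⟩
          have hmk : marks { h with mark := Function.update h.mark y true } ≤ h.marks + 1 := by
            unfold marks
            dsimp only
            rw [← Finset.card_singleton y]
            refine le_trans (Finset.card_le_card ?_) (Finset.card_union_le _ _)
            intro u
            by_cases hu : u = y
            · subst hu; simp
            · simp [hu]
          have := Nat.mul_le_mul_left (32 * (R + 1)) hmk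
          rw [mul_add _ h.marks 1] at this
          simp only [pot, Option.isSome_some, Option.isSome_none, if_true]
          rw [← hR]
          simp
          omega
  · rintro ⟨h', o⟩ c ⟨⟨h1, h2, h3, h4⟩, h5, h6⟩
    rw [wp_pure]
    have : o = none := by simpa using h5
    subst this
    refine ⟨h1, h3, h4, ?_⟩
    simp at h6
    dsimp only
    omega

/-- `RootMin` is not claimed: `v` is cut only if its key falls below that of its parent, and without
a heap order `updateMin` might then point to a non-root. This does no harm, since the operation is
applied only to the heap `W`, from which vertices are taken only by `delete`. -/
theorem wp_decreaseKey {h : FibHeap V K} (hi : Inv none h) {v : V} (hv : h.mem v = true) (x : K) :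
    Wp (h.decreaseKey v x) (fun h' c => Inv none h' ∧ h'.mem = h.mem ∧
      c + h'.pot ≤ h.pot + heapCost V) := by
  unfold decreaseKey
  rw [wp_bind, wp_op, wp_bind, wp_op]
  have hi' : Inv none { h with key := Function.update h.key v x } := { hi with }
  have hfin : ∀ (h' : FibHeap V K) (e : ℕ) (Q : FibHeap V K → ℕ → Prop), Inv none h' →
      h'.mem = h.mem → e + h'.pot + 5 ≤ h.pot + heapCost V →
      (∀ g c, Inv none g → g.mem = h.mem → e + c + g.pot ≤ h.pot + heapCost V → Q g c) →
      Wp (h'.updateMin v) Q := by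
    intro h' e Q h1 h2 h3 h4
    refine (wp_updateMin h' v).mono ?_
    rintro h'' c ⟨⟨o, rfl, ho⟩, hc⟩
    refine h4 _ _ (h1.setMin (by rw [h2]; exact hv) ho) h2 ?_
    have : pot { h' with min := o } = h'.pot := rfl
    omega
  have hpot : pot { h with key := Function.update h.key v x } = h.pot := rfl
  have hH : heapCost V = 120 * (rankBound V + 1) := rfl
  cases hp : h.parent v with
  | none =>
    dsimp only
    rw [wp_bind, wp_pure]
    exact hfin _ 2 _ hi' rfl (by rw [hpot]; omega) (fun g c l1 l2 l3 => ⟨l1, l2, by omega⟩)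
  | some y =>
    dsimp only
    rw [wp_bind, wp_ops]
    split_ifs
    · refine (wp_cut (hi'.weaken (some v)) hv hp).bind ?_
      rintro h1 c ⟨g1, g2, g3, -, g5, g6, g7⟩
      have hy : h1.mem y = true := by
        rw [g2]; exact hi.forest.mem_parent v y hv hp
      refine (wp_cascade g1 hy).bind ?_
      rintro h2 d ⟨k1, k2, -, k4⟩
      have hle : h1.pot ≤ h.pot + 21 := by
        unfold pot
        rw [g5]
        have h7 : h1.marks ≤ marks { h with key := Function.update h.key v x } := by omega
        have h8 : marks { h with key := Function.update h.key v x } = h.marks := rfl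
        rw [h8] at h7
        have := Nat.mul_le_mul_left (32 * (rankBound V + 1)) h7
        dsimp only
        omega
      exact hfin h2 (4 + (c + d)) _ k1 (k2.trans g2) (by omega)
        (fun g c l1 l2 l3 => ⟨l1, l2, by omega⟩)
    · rw [wp_bind, wp_pure]
      exact hfin _ 4 _ hi' rfl (by rw [hpot]; omega) (fun g c l1 l2 l3 => ⟨l1, l2, by omega⟩)

/-! #### Consolidation -/

/-- The state of a consolidation: the roots are those that remain to be placed and those in the
table. -/
structure Consol (l : List V) (h : FibHeap V K) (mx : ℕ) : Prop where
  forest : h.IsForest none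
  nodup : l.Nodup
  root_iff : ∀ v, h.mem v = true ∧ h.parent v = none ↔ v ∈ l ∨ h.table (h.rank v) = some v
  table : ∀ j q, h.table j = some q → h.rank q = j ∧ q ∉ l ∧ j ≤ mx
  le_bound : mx ≤ rankBound V

theorem Consol.table_root {l : List V} {h : FibHeap V K} {mx j : ℕ} (hc : Consol l h mx) {q : V}
    (hq : h.table j = some q) : h.mem q = true ∧ h.parent q = none := by
  have := (hc.table j q hq).1
  exact (hc.root_iff q).mpr (Or.inr (by rw [this]; exact hq))

/-- The list `roots` is out of date during a consolidation, so roots are recognized by their parent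
pointers. -/
def rootCount (h : FibHeap V K) : ℕ :=
  (Finset.univ.filter (fun v => h.mem v = true ∧ h.parent v = none)).card

/-- Both outcomes of the key comparison are covered: `y` becomes a child of `z`, and `z` takes the
place of `x` as the vertex to be entered. The position of `q` in the table supplies the equality of
ranks, and the lost root will pay for the link. -/
theorem wp_link_consol {l : List V} {h : FibHeap V K} {mx : ℕ} {x q y z : V}
    (hc : Consol (x :: l) h mx) (hq : h.table (h.rank x) = some q)
    (hyz : (y = x ∧ z = q) ∨ (y = q ∧ z = x)) :
    Wp (link { h with table := Function.update h.table (h.rank x) none } y z) (fun h' c =>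
      Consol (z :: l) h' mx ∧ h'.mem = h.mem ∧ h'.rootCount + 1 ≤ h.rootCount ∧
        h'.marks ≤ h.marks ∧ c = 6) := by
  unfold link
  rw [wp_ops]
  obtain ⟨hq1, hq2, hq3⟩ := hc.table _ _ hq
  obtain ⟨hq4, hq5⟩ := hc.table_root hq
  obtain ⟨hx4, hx5⟩ := (hc.root_iff x).mpr (Or.inl (by simp))
  have hnd := List.nodup_cons.mp hc.nodup
  simp only [List.mem_cons, not_or] at hq2
  have hyz' : y ≠ z ∧ h.mem y = true ∧ h.mem z = true ∧ h.parent y = none ∧ h.parent z = none ∧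
      h.rank y = h.rank z ∧ y ∉ l ∧ z ∉ l ∧ h.rank y = h.rank x ∧ h.rank z = h.rank x := by
    rcases hyz with ⟨rfl, rfl⟩ | ⟨rfl, rfl⟩
    · exact ⟨Ne.symm hq2.1, hx4, hq4, hx5, hq5, hq1.symm, hnd.1, hq2.2, rfl, hq1⟩
    · exact ⟨hq2.1, hq4, hx4, hq5, hx5, hq1, hq2.2, hnd.1, hq1, rfl⟩
  obtain ⟨a1, a2, a3, a4, a5, a6, a7, a8, a9, a10⟩ := hyz'
  have hother : ∀ v, v ≠ y → v ≠ z → (v ≠ x ∧ v ≠ q) := by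
    rintro v h1 h2
    rcases hyz with ⟨rfl, rfl⟩ | ⟨rfl, rfl⟩
    · exact ⟨h1, h2⟩
    · exact ⟨h2, h1⟩
  have htab : ∀ j v, Function.update h.table (h.rank x) none j = some v ↔
      j ≠ h.rank x ∧ h.table j = some v := by
    intro j v
    by_cases hj : j = h.rank x
    · subst hj; simp
    · simp [hj]
  refine ⟨⟨hc.forest.link a1 a2 a3 a4 a5 a6, List.nodup_cons.mpr ⟨a8, hnd.2⟩, ?_, ?_, hc.le_bound⟩,
    rfl, ?_, ?_, rfl⟩
  · intro v
    dsimp only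
    rw [htab]
    by_cases hvy : v = y
    · subst hvy
      simp [a1, a7, a9]
    · rw [Function.update_of_ne hvy]
      by_cases hvz : v = z
      · subst hvz
        simp [a3, a5]
      · rw [Function.update_of_ne hvz, hc.root_iff]
        obtain ⟨b1, b2⟩ := hother v hvy hvz
        simp only [List.mem_cons, hvz, b1, false_or]
        refine or_congr_right ⟨fun ht => ⟨fun hr => ?_, ht⟩, fun ht => ht.2⟩
        rw [hr, hq] at ht
        exact b2 (Option.some.inj ht).symm
  · intro j v hv
    dsimp only at hv ⊢
    rw [htab] at hv
    obtain ⟨b1, b2, b3⟩ := hc.table j v hv.2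
    simp only [List.mem_cons, not_or] at b2
    have hvz : v ≠ z := by rintro rfl; exact hv.1 (b1.symm.trans a10)
    rw [Function.update_of_ne hvz]
    exact ⟨b1, by simp [hvz, b2.2], b3⟩
  · unfold rootCount
    dsimp only
    have hsub : Finset.univ.filter (fun v => h.mem v = true ∧
          Function.update h.parent y (some z) v = none)
        = (Finset.univ.filter (fun v => h.mem v = true ∧ h.parent v = none)).erase y := by
      ext u
      by_cases hux : u = y
      · subst hux; simp
      · simp [hux]
    have hin : y ∈ Finset.univ.filter (fun v => h.mem v = true ∧ h.parent v = none) := by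
      simp [a2, a4]
    rw [hsub, Finset.card_erase_of_mem hin]
    have := Finset.card_pos.mpr ⟨y, hin⟩
    omega
  · apply marks_le
    intro u hu
    dsimp only at hu
    by_cases huy : u = y
    · subst huy; simp at hu
    · rwa [Function.update_of_ne huy] at hu

/-- Each round, with its test, costs 13 steps and destroys one root. -/
theorem wp_place {l : List V} {h : FibHeap V K} {mx : ℕ} {r : V} (hc : Consol (r :: l) h mx) :
    Wp (place (h, mx) r) (fun s c => Consol l s.1 s.2 ∧ s.1.mem = h.mem ∧ s.1.marks ≤ h.marks ∧
      c + 13 * s.1.rootCount ≤ 13 * h.rootCount + 5) := by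
  unfold place
  refine (wp_whileT (fun t : FibHeap V K × V => Consol (t.2 :: l) t.1 mx ∧ t.1.mem = h.mem ∧
    t.1.marks ≤ h.marks) (fun t => 13 * t.1.rootCount) ?_ (h, r) ⟨hc, rfl, le_rfl⟩).bind ?_
  · rintro ⟨g, x⟩ ⟨h1, h2, h3⟩ ht
    dsimp only at h1 h2 h3 ht ⊢
    cases hq : g.table (g.rank x) with
    | none => simp [hq] at ht
    | some q =>
      dsimp only
      rw [wp_bind, wp_ops, wp_bind, wp_ops]
      split_ifs
      · refine (wp_link_consol h1 hq (Or.inl ⟨rfl, rfl⟩)).bind ?_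
        rintro g' c ⟨k1, k2, k3, k4, rfl⟩
        rw [wp_op]
        exact ⟨⟨k1, k2.trans h2, k4.trans h3⟩, by dsimp only; omega⟩
      · refine (wp_link_consol h1 hq (Or.inr ⟨rfl, rfl⟩)).bind ?_
        rintro g' c ⟨k1, k2, k3, k4, rfl⟩
        rw [wp_op]
        exact ⟨⟨k1, k2.trans h2, k4.trans h3⟩, by dsimp only; omega⟩
  · rintro ⟨g, x⟩ c ⟨⟨h1, h2, h3⟩, h4, h5⟩
    dsimp only at h1 h2 h3 h4 h5 ⊢
    rw [wp_bind, wp_ops, wp_bind, wp_ops, wp_pure]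
    have hnone : g.table (g.rank x) = none := by simpa using h4
    have hnd := List.nodup_cons.mp h1.nodup
    obtain ⟨hx4, hx5⟩ := (h1.root_iff x).mpr (Or.inl (by simp))
    refine ⟨⟨h1.forest, hnd.2, ?_, ?_, max_le h1.le_bound (h1.forest.rank_le x)⟩, h2, h3, ?_⟩
    · intro v
      dsimp only
      rw [h1.root_iff]
      by_cases hvx : v = x
      · subst hvx; simp
      · simp only [List.mem_cons, hvx, false_or]
        refine or_congr_right ?_
        by_cases hr : g.rank v = g.rank x
        · rw [hr, hnone, Function.update_self]
          simp [Ne.symm hvx]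
        · rw [Function.update_of_ne hr]
    · intro j v hv
      dsimp only at hv ⊢
      by_cases hj : j = g.rank x
      · subst hj
        simp only [Function.update_self, Option.some.injEq] at hv
        subst hv
        exact ⟨rfl, hnd.1, le_max_right _ _⟩
      · rw [Function.update_of_ne hj] at hv
        obtain ⟨b1, b2, b3⟩ := h1.table j v hv
        simp only [List.mem_cons, not_or] at b2
        exact ⟨b1, b2.2, b3.trans (le_max_left _ _)⟩
    · have : rootCount { g with table := Function.update g.table (g.rank x) (some x) }
        = g.rootCount := rfl
      dsimp only
      rw [this]
      omega

/-- The state while the table is emptied: the entries from `j` on are empty already. -/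
structure Collecting (j : ℕ) (h : FibHeap V K) : Prop where
  forest : h.IsForest none
  nodup : h.roots.Nodup
  root_iff : ∀ v, h.mem v = true ∧ h.parent v = none ↔ v ∈ h.roots ∨ h.table (h.rank v) = some v
  table : ∀ i q, h.table i = some q → h.rank q = i ∧ q ∉ h.roots ∧ i < j
  min_mem : ∀ m, h.min = some m → m ∈ h.roots
  min_none : h.min = none → h.roots = []

/-- The pointer to the minimum is set afresh among the listed roots, which restores `RootMin`
whatever held before. If it stays `none` there are no roots, so the heap has no elements. -/
theorem wp_collect : ∀ (j : ℕ) (h : FibHeap V K), Collecting j h →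
    Wp (collect j h) (fun h' c => Inv none h' ∧ RootMin h' ∧ h'.mem = h.mem ∧
      h'.marks = h.marks ∧ h'.roots.length ≤ h.roots.length + j ∧ c ≤ 8 * j + 1)
  | 0, h, hc => by
    rw [collect, wp_op]
    have htab : ∀ i, h.table i = none := fun i => by
      by_contra hne
      obtain ⟨q, hq⟩ := Option.ne_none_iff_exists'.mp hne
      exact absurd (hc.table i q hq).2.2 (Nat.not_lt_zero _)
    have hroots : ∀ v, v ∈ h.roots ↔ h.mem v = true ∧ h.parent v = none := fun v => by
      rw [hc.root_iff, htab]; simp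
    refine ⟨⟨hc.forest, hc.nodup, hroots, htab, ?_, ?_⟩, ?_, rfl, rfl, by omega, by omega⟩
    · exact fun m hm => ((hroots m).mp (hc.min_mem m hm)).1
    · intro hm v
      by_contra hv
      obtain ⟨r, hr⟩ := hc.forest.exists_root (v := v) (by simpa using hv)
      rw [← hroots, hc.min_none hm] at hr
      simp at hr
    · exact fun m hm => ((hroots m).mp (hc.min_mem m hm)).2
  | j + 1, h, hc => by
    rw [collect, wp_bind, wp_op]
    cases hq : h.table j with
    | none =>
      dsimp only
      have hc' : Collecting j h := { hc with
        table := fun i q hi => by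
          obtain ⟨h1, h2, h3⟩ := hc.table i q hi
          refine ⟨h1, h2, ?_⟩
          have : i ≠ j := by rintro rfl; simp [hq] at hi
          omega }
      refine (wp_collect j h hc').mono ?_
      rintro h' c ⟨h1, h2, h3, h4, h5, h6⟩
      exact ⟨h1, h2, h3, h4, by omega, by omega⟩
    | some r =>
      dsimp only
      rw [wp_bind, wp_ops]
      obtain ⟨hr1, hr2, hr3⟩ := hc.table j r hq
      refine (wp_updateMin _ r).bind ?_
      rintro g c ⟨⟨o, rfl, ho⟩, hcost⟩
      dsimp only at ho
      have hc' : Collecting j { h with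
          roots := r :: h.roots, table := Function.update h.table j none, min := o } := by
        refine ⟨hc.forest, List.nodup_cons.mpr ⟨hr2, hc.nodup⟩, ?_, ?_, ?_, ?_⟩
        · intro v
          dsimp only
          rw [hc.root_iff]
          by_cases hvr : v = r
          · subst hvr; simp [hr1, hq]
          · simp only [List.mem_cons, hvr, false_or]
            refine or_congr_right ?_
            by_cases hj : h.rank v = j
            · rw [hj, hq, Function.update_self]; simp [Ne.symm hvr]
            · rw [Function.update_of_ne hj]
        · intro i q hi
          dsimp only at hi ⊢
          by_cases hij : i = j
          · subst hij; simp at hi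
          · rw [Function.update_of_ne hij] at hi
            obtain ⟨h1, h2, h3⟩ := hc.table i q hi
            refine ⟨h1, ?_, by omega⟩
            have : q ≠ r := by rintro rfl; exact hij (h1.symm.trans hr1)
            simp [this, h2]
        · intro m hm
          dsimp only at hm ⊢
          rcases ho with rfl | ⟨rfl, -⟩
          · cases hm; simp
          · exact List.mem_cons_of_mem _ (hc.min_mem m hm)
        · intro hm
          dsimp only at hm
          rcases ho with rfl | ⟨rfl, h1⟩
          · cases hm
          · exact absurd hm h1
      refine (wp_collect j _ hc').mono ?_
      rintro h' c ⟨h1, h2, h3, h4, h5, h6⟩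
      simp only [List.length_cons] at h5
      exact ⟨h1, h2, h3, h4, by omega, by omega⟩

/-- Each old root pays 13 for a possible link and 6 for the rest of its placement. The new roots
come from at most `rankBound V + 1` entries of the table. -/
theorem wp_consolidate {h : FibHeap V K} (hc : Consol h.roots h 0) (htab : ∀ j, h.table j = none) :
    Wp h.consolidate (fun h' c => Inv none h' ∧ RootMin h' ∧ h'.mem = h.mem ∧
      h'.marks ≤ h.marks ∧ h'.roots.length ≤ rankBound V + 1 ∧
      c ≤ 19 * h.roots.length + 8 * rankBound V + 12) := by
  unfold consolidate
  have hcount : h.rootCount = h.roots.length := by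
    rw [← List.toFinset_card_of_nodup hc.nodup]
    unfold rootCount
    congr 1
    ext v
    simp only [Finset.mem_filter, Finset.mem_univ, true_and, List.mem_toFinset]
    rw [hc.root_iff, htab]
    simp
  refine (wp_forT (fun l (s : FibHeap V K × ℕ) => Consol l s.1 s.2 ∧ s.1.mem = h.mem ∧
    s.1.marks ≤ h.marks) (fun l s => 6 * l.length + 13 * s.1.rootCount) ?_ h.roots (h, 0)
    ⟨hc, rfl, le_rfl⟩).bind ?_
  · rintro r l ⟨g, mx⟩ ⟨h1, h2, h3⟩
    refine (wp_place h1).mono ?_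
    rintro s c ⟨k1, k2, k3, k4⟩
    refine ⟨⟨k1, k2.trans h2, k3.trans h3⟩, ?_⟩
    simp only [List.length_cons]
    dsimp only at k4
    omega
  · rintro ⟨g, mx⟩ c ⟨⟨h1, h2, h3⟩, h4⟩
    dsimp only at h1 h2 h3 h4 ⊢
    rw [wp_bind, wp_ops]
    refine (wp_collect (mx + 1) { g with roots := [], min := none }
      ⟨h1.forest, List.nodup_nil, h1.root_iff, ?_, fun m hm => (by cases hm), fun _ => rfl⟩).mono ?_
    · intro i q hi
      obtain ⟨a1, a2, a3⟩ := h1.table i q hi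
      exact ⟨a1, a2, by omega⟩
    · rintro g' d ⟨k1, k2, k3, k4, k5, k6⟩
      have := h1.le_bound
      have h4' : marks { g with roots := [], min := none } = g.marks := rfl
      simp only [List.length_nil] at k5 h4
      exact ⟨k1, k2, k3.trans h2, by omega, by omega, by omega⟩

theorem wp_forT_children (h : FibHeap V K) (cs : List V) :
    Wp (forT (fun (h : FibHeap V K) c => ops 3 { h with
      parent := Function.update h.parent c none
      mark := Function.update h.mark c false
      roots := c :: h.roots }) h cs) (fun h' c => h' = { h with
        parent := fun x => if x ∈ cs then none else h.parent x
        mark := fun x => if x ∈ cs then false else h.mark x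
        roots := cs.reverse ++ h.roots } ∧ c = 4 * cs.length + 1) := by
  induction cs generalizing h with
  | nil => rw [forT, wp_op]; simp
  | cons a cs ih =>
    rw [forT, wp_bind, wp_op, wp_bind, wp_ops]
    refine (ih _).mono ?_
    rintro h' c ⟨rfl, rfl⟩
    refine ⟨?_, by simp only [List.length_cons]; omega⟩
    simp only [List.reverse_cons, List.append_assoc, List.cons_append, List.nil_append,
      List.mem_cons, FibHeap.mk.injEq, true_and, and_true]
    constructor
    · funext x
      by_cases hx : x = a
      · subst hx; simp
      · simp [hx]
    · funext x
      by_cases hx : x = a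
      · subst hx; simp
      · simp [hx]

/-- Besides what the old roots pay, a child of `m` costs 4 to move and 19 to consolidate, a table
entry costs 8 to scan, and a surviving root needs 21 as its potential; 52 is the sum. -/
theorem wp_extractMin {h : FibHeap V K} (hi : Inv none h) {m : V} (hm : h.min = some m)
    (hp : h.parent m = none) :
    Wp h.extractMin (fun h' c => Inv none h' ∧ RootMin h' ∧
      h'.mem = Function.update h.mem m false ∧ c + h'.pot ≤ h.pot + 52 * (rankBound V + 1)) := by
  unfold extractMin
  rw [hm]
  dsimp only
  refine (wp_eraseT m h.roots).bind ?_
  rintro rs c ⟨rfl, hc⟩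
  rw [wp_bind, wp_ops]
  refine (wp_forT_children _ _).bind ?_
  rintro g d ⟨rfl, rfl⟩
  rw [wp_bind, wp_ops]
  dsimp only
  have hmr : m ∈ h.roots := (hi.mem_roots m).mpr ⟨hi.min_mem m hm, hp⟩
  have hdisj : ∀ x ∈ h.children m, x ∉ h.roots := by
    intro x hx hx'
    have h1 := ((hi.forest.mem_children _ _).mp hx).2
    rw [((hi.mem_roots x).mp hx').2] at h1
    cases h1
  have hlen : (h.roots.erase m).length + 1 = h.roots.length := by
    rw [List.length_erase_of_mem hmr]
    have := List.length_pos_of_mem hmr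
    omega
  have hcl : (h.children m).length ≤ rankBound V := by
    rw [← hi.forest.rank_eq]; exact hi.forest.rank_le m
  refine (wp_consolidate (h := { h with
    mem := Function.update h.mem m false
    parent := fun x => if x ∈ h.children m then none else h.parent x
    mark := fun x => if x ∈ h.children m then false else h.mark x
    roots := (h.children m).reverse ++ h.roots.erase m
    children := Function.update h.children m []
    rank := Function.update h.rank m 0
    min := some m })
    ⟨hi.forest.removeRoot hp, ?_, ?_, ?_, Nat.zero_le _⟩ hi.table).mono ?_
  · refine List.Nodup.append (List.nodup_reverse.mpr (hi.forest.nodup_children m))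
      (hi.nodup_roots.erase m) ?_
    intro x hx hx'
    exact hdisj x (List.mem_reverse.mp hx) (List.mem_of_mem_erase hx')
  · intro v
    dsimp only
    rw [hi.table]
    simp only [List.mem_append, List.mem_reverse, hi.nodup_roots.mem_erase_iff, hi.mem_roots,
      reduceCtorEq, or_false]
    by_cases hv : v = m
    · subst hv
      have : v ∉ h.children v := fun hv => by
        have := ((hi.forest.mem_children _ _).mp hv).2
        simp [hp] at this
      simp [this]
    · rw [Function.update_of_ne hv]
      by_cases hvc : v ∈ h.children m
      · simp [hvc, ((hi.forest.mem_children _ _).mp hvc).1]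
      · simp [hvc, hv]
  · intro j q hq
    dsimp only at hq
    rw [hi.table] at hq
    cases hq
  · rintro h' e ⟨k1, k2, k3, k4, k5, k6⟩
    refine ⟨k1, k2, k3, ?_⟩
    have hmk : h'.marks ≤ h.marks := by
      refine k4.trans (marks_le (fun v hv => ?_))
      dsimp only at hv
      split_ifs at hv
      exact hv
    have := Nat.mul_le_mul_left (32 * (rankBound V + 1)) hmk
    simp only [List.length_append, List.length_reverse] at k6
    unfold pot
    omega

/-- The cut turns `v` into a root and the cascade never gives a root a parent, so `wp_extractMin`
applies even if the pointer was not at a root before. -/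
theorem wp_delete {h : FibHeap V K} (hi : Inv none h) {v : V} (hv : h.mem v = true) :
    Wp (h.delete v) (fun h' c => Inv none h' ∧ RootMin h' ∧
      h'.mem = Function.update h.mem v false ∧ c + h'.pot ≤ h.pot + heapCost V) := by
  unfold delete
  rw [wp_bind, wp_op]
  have hH : heapCost V = 120 * (rankBound V + 1) := rfl
  have hfin : ∀ (g : FibHeap V K) (e : ℕ) (Q : FibHeap V K → ℕ → Prop), Inv none g →
      g.mem = h.mem → g.parent v = none → e + g.pot + 52 * (rankBound V + 1) ≤ h.pot + heapCost V →
      (∀ g' c, Inv none g' → RootMin g' → g'.mem = Function.update h.mem v false →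
        e + c + g'.pot ≤ h.pot + heapCost V → Q g' c) →
      Wp (extractMin { g with min := some v }) Q := by
    intro g e Q h1 h2 h3 h4 h5
    have hi' := h1.setMin (o := some v) (v := v) (by rw [h2]; exact hv) (Or.inl rfl)
    refine (wp_extractMin hi' rfl h3).mono ?_
    rintro g' c ⟨k1, k2, k3, k4⟩
    have : pot { g with min := some v } = g.pot := rfl
    exact h5 g' c k1 k2 (by rw [k3]; dsimp only; rw [h2]) (by omega)
  cases hp : h.parent v with
  | none =>
    dsimp only
    rw [wp_bind, wp_pure, wp_bind, wp_op]
    exact hfin h 2 _ hi rfl hp (by omega) (fun g c l1 l2 l3 l4 => ⟨l1, l2, l3, by omega⟩)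
  | some y =>
    dsimp only
    refine (wp_cut (hi.weaken (some v)) hv hp).bind ?_
    rintro h1 c ⟨g1, g2, g3, g4, g5, g6, g7⟩
    have hy : h1.mem y = true := by
      rw [g2]; exact hi.forest.mem_parent v y hv hp
    refine (wp_cascade g1 hy).bind ?_
    rintro h2 d ⟨k1, k2, k3, k4⟩
    rw [wp_bind, wp_op]
    have hle : h1.pot ≤ h.pot + 21 := by
      unfold pot
      rw [g5]
      have h7 : h1.marks ≤ h.marks := by omega
      have := Nat.mul_le_mul_left (32 * (rankBound V + 1)) h7
      omega
    exact hfin h2 (2 + (c + d)) _ k1 (k2.trans g2) (k3 v g4) (by omega)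
      (fun g c l1 l2 l3 l4 => ⟨l1, l2, l3, by omega⟩)

end FibHeap
/-! ### Cost of the `k`-probabilities and of the bounds -/

theorem wp_dpRow (p : K) : ∀ (l : List K) (prev : K),
    Wp (dpRow p prev l) (fun l' c => l'.length = l.length ∧ c ≤ 5 * l.length + 1)
  | [], _ => by rw [dpRow, wp_op]; simp
  | x :: xs, prev => by
    rw [dpRow, wp_bind, wp_ops]
    refine (wp_dpRow p xs x).bind ?_
    rintro ys c ⟨h1, h2⟩
    rw [wp_op]
    simp only [List.length_cons]
    omega

theorem wp_zerosT : ∀ j : ℕ,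
    Wp (zerosT j : Timed (List K)) (fun l c => l.length = j ∧ c ≤ j + 1)
  | 0 => by rw [zerosT, wp_op]; simp
  | j + 1 => by
    rw [zerosT]
    refine (wp_zerosT j).bind ?_
    rintro l c ⟨h1, h2⟩
    rw [wp_op]
    simp only [List.length_cons]
    omega

/-- The row keeps length `k`, so an edge costs at most `5 * k + 2` steps; `1 ≤ k` turns the constant
into a multiple of `k`. -/
theorem wp_kProb {k : ℕ} (hk : 1 ≤ k) (es : List (V × K)) :
    Wp (kProb k es) (fun _ c => c ≤ 7 * k * (es.length + 1)) := by
  unfold kProb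
  refine (wp_zerosT (k - 1)).bind ?_
  rintro z c ⟨h1, h2⟩
  rw [wp_bind, wp_op]
  refine (wp_forT_sum (fun _ (r : List K) => r.length = k) (fun _ => 5 * k + 2) ?_ es _
    (by simp; omega)).bind ?_
  · intro e l r hr
    refine (wp_dpRow e.2 r 0).mono ?_
    rintro l' c ⟨h3, h4⟩
    omega
  · rintro r d ⟨h3, h4⟩
    refine (wp_forT_sum (fun _ _ => True) (fun _ => 2) ?_ r 0 trivial).bind ?_
    · intro x l s _
      rw [wp_op]
      exact ⟨trivial, le_rfl⟩
    · rintro s e ⟨-, h5⟩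
      rw [wp_op]
      simp only [List.map_const', List.sum_replicate, smul_eq_mul] at h4 h5
      have : es.length ≤ k * es.length := Nat.le_mul_of_pos_left _ hk
      have h6 : es.length * (5 * k + 2) = 5 * (k * es.length) + 2 * es.length := by ring
      have h7 : 7 * k * (es.length + 1) = 7 * (k * es.length) + 7 * k := by ring
      rw [h7]
      omega

theorem wp_powersT (q : K) : ∀ (d : ℕ) (w : K) (acc : List K),
    Wp (powersT q d w acc) (fun l c => l.length = acc.length + d + 1 ∧ c ≤ 2 * d + 1)
  | 0, w, acc => by rw [powersT, wp_op]; simp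
  | d + 1, w, acc => by
    rw [powersT, wp_bind, wp_op, wp_bind, wp_op]
    refine (wp_powersT q d _ _).mono ?_
    rintro l c ⟨h1, h2⟩
    simp only [List.length_cons] at h1
    omega

theorem wp_betaLoop (k d : ℕ) (z : K) : ∀ (l : List K) (i : ℕ) (c y acc : K),
    Wp (betaLoop k d z l i c y acc) (fun _ t => t ≤ 9 * l.length + 1)
  | [], i, c, y, acc => by rw [betaLoop, wp_op]; simp
  | w :: ws, i, c, y, acc => by
    rw [betaLoop, wp_bind, wp_op, wp_bind, wp_ops, wp_bind, wp_ops, wp_bind, wp_op]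
    refine (wp_betaLoop k d z ws _ _ _ _).mono ?_
    intro _ t ht
    simp only [List.length_cons]
    omega

/-- The evaluation is linear in `d`, since powers and binomial coefficients are updated from term to
term. -/
theorem wp_betaT (z : K) (k d : ℕ) : Wp (betaT z k d) (fun _ c => c ≤ 11 * d + 12) := by
  unfold betaT
  rw [wp_bind, wp_op]
  refine (wp_powersT _ d 1 []).bind ?_
  rintro ws c ⟨h1, h2⟩
  refine (wp_betaLoop k d z ws 0 1 1 0).mono ?_
  intro _ t ht
  simp only [List.length_nil] at h1
  omega

theorem wp_upperBound (k d : ℕ) (es : List (V × K)) :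
    Wp (upperBound k d es) (fun _ c => c ≤ 11 * d + 13) := by
  unfold upperBound
  have : Wp (pMax es) (fun _ c => c = 1) := by
    unfold pMax
    split <;> rw [wp_op]
  refine this.bind ?_
  rintro z c rfl
  refine (wp_betaT z k d).mono ?_
  intro _ t ht
  omega

theorem wp_topProd : ∀ (k : ℕ) (es : List (V × K)),
    Wp (topProd k es) (fun _ c => c ≤ 2 * es.length + 1)
  | 0, _ => by rw [topProd, wp_op]; omega
  | _ + 1, [] => by rw [topProd, wp_op]; simp
  | k + 1, e :: es => by
    rw [topProd]
    refine (wp_topProd k es).bind ?_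
    intro x c hc
    rw [wp_ops]
    simp only [List.length_cons]
    omega

theorem wp_lowerBound (k d : ℕ) (es : List (V × K)) :
    Wp (lowerBound k d es) (fun _ c => c ≤ 4 * es.length + 11 * d + 15) := by
  unfold lowerBound pMin
  refine (wp_forT_sum (fun _ _ => True) (fun _ => 2) ?_ es 0 trivial).bind ?_
  · intro x l s _
    rw [wp_op]
    exact ⟨trivial, le_rfl⟩
  · rintro z c ⟨-, hc⟩
    simp only [List.map_const', List.sum_replicate, smul_eq_mul] at hc
    refine (wp_betaT z k d).bind ?_
    intro x c1 h1
    refine (wp_topProd k es).bind ?_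
    intro y c2 h2
    rw [wp_op]
    omega

/-! ### Invariants of the peeling stage -/

/-- The sum of `f` over the set given by a membership array. -/
def memSum (f : V → ℕ) (mem : V → Bool) : ℕ :=
  ∑ v ∈ Finset.univ.filter (fun v => mem v = true), f v

theorem memSum_update_true (f : V → ℕ) {mem : V → Bool} {v : V} (hv : mem v = false) :
    memSum f (Function.update mem v true) = f v + memSum f mem := by
  unfold memSum
  have : Finset.univ.filter (fun u => Function.update mem v true u = true)
      = insert v (Finset.univ.filter (fun u => mem u = true)) := by
    ext u
    by_cases hu : u = v
    · subst hu; simp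
    · simp [hu]
  rw [this, Finset.sum_insert (by simp [hv])]

theorem memSum_update_false (f : V → ℕ) {mem : V → Bool} {v : V} (hv : mem v = true) :
    f v + memSum f (Function.update mem v false) = memSum f mem := by
  have := memSum_update_true f (mem := Function.update mem v false) (v := v) (by simp)
  rw [Function.update_idem, ← hv, Function.update_eq_self] at this
  exact this.symm

theorem memSum_le (f : V → ℕ) (mem : V → Bool) : memSum f mem ≤ ∑ v, f v :=
  Finset.sum_le_sum_of_subset (Finset.subset_univ _)

/-- The vertices in a list of buckets. -/
def bucketVerts (L : List (K × List V)) : List V := L.flatMap Prod.snd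

/-- The price of moving `v` from `D` to `W`: a dynamic program, an extraction and an insertion. It
is deposited when `v` enters `D`. -/
def refreshCost (nbrs : V → List (V × K)) (k : ℕ) (v : V) : ℕ :=
  7 * k * ((nbrs v).length + 1) + 2 * heapCost V + 10

def addCost (nbrs : V → List (V × K)) (k : ℕ) (v : V) : ℕ :=
  7 * k * ((nbrs v).length + 1) + heapCost V + 8

/-- The last summand is the deposit for a later refresh, the others pay for the work at once,
including the scan that erases the edge from the list of `v`. -/
def updateCost (nbrs : V → List (V × K)) (k : ℕ) (v : V) : ℕ :=
  41 * ((nbrs v).length + 1) + 2 * heapCost V + refreshCost nbrs k v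

/-- The sum runs over the original adjacency list, which contains the current one, so this budget
can be fixed in advance. -/
def removeCost (nbrs : V → List (V × K)) (k : ℕ) (v : V) : ℕ :=
  ((nbrs v).map (fun e => updateCost nbrs k e.1)).sum + heapCost V + 30

/-- The working set is the disjoint union of the two heaps. -/
structure WorkInv (W D : FibHeap V K) (inW : V → Bool) : Prop where
  heapW : W.Inv none
  heapD : D.Inv none
  rootMin : D.RootMin
  inW_iff : ∀ v, inW v = true ↔ W.mem v = true ∨ D.mem v = true
  disjoint : ∀ v, W.mem v = true → D.mem v = false

/-- The summand `memSum r D.mem` holds the deposits for the refreshes that have been put off. -/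
def workPot (r : V → ℕ) (W D : FibHeap V K) : ℕ := W.pot + D.pot + memSum r D.mem

/-- The invariant of the peeling stage, when the vertices of `extra` and those of the remaining
layers still have to be added to the working set. -/
structure PeelInv (nbrs : V → List (V × K)) (extra : List V) (s : PeelState V K) : Prop where
  work : WorkInv s.W s.D s.inW
  nodup_pending : (extra ++ bucketVerts s.layers).Nodup
  pending : ∀ v ∈ extra ++ bucketVerts s.layers, s.inW v = false ∧ v ∉ bucketVerts s.stack
  nodup_stack : (bucketVerts s.stack).Nodup
  stack : ∀ v ∈ bucketVerts s.stack, s.inW v = false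
  length_stack : s.stack.length ≤ (bucketVerts s.stack).length
  size_le : s.size ≤ memSum (fun _ => 1) s.inW + (extra ++ bucketVerts s.layers).length
  adj : ∀ v, (s.adj v).Sublist (nbrs v)

/-- `p` is an element of the heap `W`, unless `W` is empty. -/
def Candidate (W : FibHeap V K) (p : Option (V × K)) : Prop :=
  (p = none → ∀ v, W.mem v = false) ∧ ∀ q, p = some q → W.mem q.1 = true

theorem WorkInv.refresh {W D W' D' : FibHeap V K} {inW : V → Bool} (h : WorkInv W D inW) {u : V}
    (hu : D.mem u = true) (hW : W'.Inv none) (hD : D'.Inv none) (hm : D'.RootMin)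
    (hW' : W'.mem = Function.update W.mem u true) (hD' : D'.mem = Function.update D.mem u false) :
    WorkInv W' D' inW := by
  refine ⟨hW, hD, hm, fun v => ?_, fun v => ?_⟩
  · rw [h.inW_iff, hW', hD']
    by_cases hv : v = u
    · subst hv; simp [hu]
    · simp [hv]
  · rw [hW', hD']
    by_cases hv : v = u
    · subst hv; simp
    · simpa [hv] using h.disjoint v

theorem WorkInv.delay {W D W' D' : FibHeap V K} {inW : V → Bool} (h : WorkInv W D inW) {u : V}
    (hu : W.mem u = true) (hW : W'.Inv none) (hD : D'.Inv none) (hm : D'.RootMin)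
    (hW' : W'.mem = Function.update W.mem u false) (hD' : D'.mem = Function.update D.mem u true) :
    WorkInv W' D' inW := by
  refine ⟨hW, hD, hm, fun v => ?_, fun v => ?_⟩
  · rw [h.inW_iff, hW', hD']
    by_cases hv : v = u
    · subst hv; simp [hu]
    · simp [hv]
  · rw [hW', hD']
    by_cases hv : v = u
    · subst hv; simp
    · simpa [hv] using h.disjoint v

/-! ### Amortized cost of the peeling operations -/

theorem below_eq_false {x : K} {p : Option (V × K)} (h : below x p = false) : p ≠ none := by
  rintro rfl
  simp [below] at h

/-- Every round takes a vertex out of `D` and spends its deposit. The virtual candidate lies above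
every key, so the loop can end with it only when `D` is empty. -/
theorem wp_refKPROB {nbrs : V → List (V × K)} {k : ℕ} (hk : 1 ≤ k) {s : PeelState V K}
    {p : Option (V × K)} (hw : WorkInv s.W s.D s.inW) (hp : Candidate s.W p)
    (ha : ∀ v, (s.adj v).Sublist (nbrs v)) :
    Wp (refKPROB k (s, p)) (fun t c => ∃ W D, t.1 = { s with W := W, D := D } ∧
      WorkInv W D s.inW ∧ Candidate W t.2 ∧ (t.2 = none → D.min = none) ∧
      c + workPot (refreshCost nbrs k) W D ≤ workPot (refreshCost nbrs k) s.W s.D + 1) := by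
  unfold refKPROB
  refine (wp_whileT (fun t : PeelState V K × Option (V × K) =>
    ∃ W D, t.1 = { s with W := W, D := D } ∧ WorkInv W D s.inW ∧ Candidate W t.2)
    (fun t => workPot (refreshCost nbrs k) t.1.W t.1.D) ?_ (s, p)
    ⟨s.W, s.D, rfl, hw, hp⟩).mono ?_
  · rintro ⟨t, p⟩ ⟨W, D, ht, h1, h2⟩ hb
    dsimp only at ht h2
    subst ht
    dsimp only
    unfold hasBelow at hb
    dsimp only at hb
    cases hm : D.min with
    | none => simp [hm] at hb
    | some u =>
      dsimp only
      have hu := h1.heapD.min_mem u hm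
      refine (wp_kProb hk (s.adj u)).bind ?_
      intro x c1 hc1
      refine (FibHeap.wp_extractMin h1.heapD hm (h1.rootMin u hm)).bind ?_
      rintro D' c2 ⟨d1, d2, d3, d4⟩
      have huW : W.mem u = false := by
        by_contra hne
        have := h1.disjoint u (by simpa using hne)
        simp [hu] at this
      refine (FibHeap.wp_insert h1.heapW huW x).bind ?_
      rintro W' c3 ⟨w1, -, w3, w4⟩
      rw [wp_bind, wp_op, wp_ops]
      refine ⟨⟨W', D', rfl, h1.refresh hu w1 d1 d2 w3 d3, ?_, ?_⟩, ?_⟩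
      · dsimp only
        intro hn
        split_ifs at hn with hbel
        have := below_eq_false (by simpa using hbel) hn
        exact this.elim
      · dsimp only
        intro q hq
        rw [w3]
        split_ifs at hq
        · cases hq; simp
        · by_cases hqu : q.1 = u
          · rw [hqu]; simp
          · rw [Function.update_of_ne hqu]; exact h2.2 q hq
      · dsimp only
        have hs := memSum_update_false (refreshCost nbrs k) hu
        rw [← d3] at hs
        have hlen := (ha u).length_le
        have hmul : 7 * k * ((s.adj u).length + 1) ≤ 7 * k * ((nbrs u).length + 1) :=
          Nat.mul_le_mul_left _ (by omega)
        have hH : heapCost V = 120 * (rankBound V + 1) := rfl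
        have hr : refreshCost nbrs k u
          = 7 * k * ((nbrs u).length + 1) + 2 * heapCost V + 10 := rfl
        unfold workPot
        omega
  · rintro ⟨t, p⟩ c ⟨⟨W, D, ht, h1, h2⟩, h3, h4⟩
    dsimp only at ht h2
    subst ht
    refine ⟨W, D, rfl, h1, h2, ?_, h4⟩
    rintro hn
    dsimp only at hn
    subst hn
    unfold hasBelow at h3
    dsimp only at h3
    cases hm : D.min with
    | none => rfl
    | some u => simp [hm, below] at h3

/-- The claim about the candidate is an implication because a layer may also be added just after a
removal, when the candidate still names the removed vertex and no longer lies in `W`. -/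
theorem wp_addVertex {nbrs : V → List (V × K)} {k : ℕ} (hk : 1 ≤ k) {extra : List V} {u : V}
    {t : PeelState V K × Option (V × K)} (h : PeelInv nbrs (u :: extra) t.1) :
    Wp (addVertex k t u) (fun t' c => PeelInv nbrs extra t'.1 ∧
      (Candidate t.1.W t.2 → Candidate t'.1.W t'.2) ∧ (t'.2 = none → t.2 = none) ∧
      t'.1.D = t.1.D ∧
      t'.1.layers = t.1.layers ∧ t'.1.stack = t.1.stack ∧ t'.1.size = t.1.size ∧
      c + 1 + t'.1.W.pot ≤ t.1.W.pot + addCost nbrs k u) := by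
  unfold addVertex
  obtain ⟨s, p⟩ := t
  dsimp only at h ⊢
  have hu := h.pending u (by simp)
  have huW : s.W.mem u = false := by
    by_contra hne
    have := (h.work.inW_iff u).mpr (Or.inl (by simpa using hne))
    simp [hu.1] at this
  have huD : s.D.mem u = false := by
    by_contra hne
    have := (h.work.inW_iff u).mpr (Or.inr (by simpa using hne))
    simp [hu.1] at this
  refine (wp_kProb hk (s.adj u)).bind ?_
  intro x c1 hc1
  refine (FibHeap.wp_insert h.work.heapW huW x).bind ?_
  rintro W' c3 ⟨w1, -, w3, w4⟩
  rw [wp_bind, wp_op, wp_ops]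
  dsimp only
  have hnd := List.nodup_cons.mp h.nodup_pending
  refine ⟨⟨⟨w1, h.work.heapD, h.work.rootMin, fun v => ?_, fun v => ?_⟩, hnd.2, fun v hv => ?_,
    h.nodup_stack, fun v hv => ?_, h.length_stack, ?_, h.adj⟩, fun hc => ⟨?_, ?_⟩, fun hn => ?_, rfl, rfl, rfl,
    rfl, ?_⟩
  · dsimp only
    rw [w3]
    by_cases hv : v = u
    · subst hv; simp
    · simpa [hv] using h.work.inW_iff v
  · dsimp only
    rw [w3]
    by_cases hv : v = u
    · subst hv; simp [huD]
    · simpa [hv] using h.work.disjoint v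
  · have hvu : v ≠ u := by rintro rfl; exact hnd.1 hv
    dsimp only
    rw [Function.update_of_ne hvu]
    exact h.pending v (List.mem_cons_of_mem _ hv)
  · have hvu : v ≠ u := by rintro rfl; exact hu.2 hv
    dsimp only
    rw [Function.update_of_ne hvu]
    exact h.stack v hv
  · dsimp only
    rw [memSum_update_true _ hu.1]
    have := h.size_le
    simp only [List.cons_append, List.length_cons] at this
    omega
  · intro hn
    split_ifs at hn with hbel
    exact (below_eq_false (by simpa using hbel) hn).elim
  · intro q hq
    rw [w3]
    split_ifs at hq
    · cases hq; simp
    · by_cases hqu : q.1 = u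
      · rw [hqu]; simp
      · rw [Function.update_of_ne hqu]; exact hc.2 q hq
  · split_ifs at hn
    exact hn
  · have hlen := (h.adj u).length_le
    have hmul : 7 * k * ((s.adj u).length + 1) ≤ 7 * k * ((nbrs u).length + 1) :=
      Nat.mul_le_mul_left _ (by omega)
    have hr : addCost nbrs k u
      = 7 * k * ((nbrs u).length + 1) + heapCost V + 8 := rfl
    omega

theorem wp_addVertices {nbrs : V → List (V × K)} {k : ℕ} (hk : 1 ≤ k) {l : List V}
    {t : PeelState V K × Option (V × K)} (h : PeelInv nbrs l t.1) :
    Wp (forT (addVertex k) t l) (fun t' c => PeelInv nbrs [] t'.1 ∧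
      (Candidate t.1.W t.2 → Candidate t'.1.W t'.2) ∧ (t'.2 = none → t.2 = none) ∧
      t'.1.D = t.1.D ∧
      t'.1.layers = t.1.layers ∧ t'.1.stack = t.1.stack ∧ t'.1.size = t.1.size ∧
      c + t'.1.W.pot ≤ t.1.W.pot + (l.map (addCost nbrs k)).sum + 1) := by
  refine (wp_forT (fun l t' => PeelInv nbrs l t'.1 ∧
      (Candidate t.1.W t.2 → Candidate t'.1.W t'.2) ∧ (t'.2 = none → t.2 = none) ∧
      t'.1.D = t.1.D ∧
      t'.1.layers = t.1.layers ∧ t'.1.stack = t.1.stack ∧ t'.1.size = t.1.size)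
    (fun l t' => t'.1.W.pot + (l.map (addCost nbrs k)).sum) ?_ l t
    ⟨h, id, id, rfl, rfl, rfl, rfl⟩).mono ?_
  · rintro u l t' ⟨h1, h2, h0, h3, h4, h5, h6⟩
    refine (wp_addVertex hk h1).mono ?_
    rintro t'' c ⟨k1, k2, k0, k3, k4, k5, k6, k7⟩
    refine ⟨⟨k1, fun hc => k2 (h2 hc), fun hn => h0 (k0 hn), k3.trans h3, k4.trans h4, k5.trans h5, k6.trans h6⟩, ?_⟩
    simp only [List.map_cons, List.sum_cons]
    omega
  · rintro t' c ⟨⟨h1, h2, h0, h3, h4, h5, h6⟩, h7⟩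
    simp only [List.map_nil, List.sum_nil] at h7
    exact ⟨h1, h2, h0, h3, h4, h5, h6, by omega⟩

/-- The 4 units of a layer pay for detaching it, for the end of the loop over its vertices and for
one loop test. -/
def layerPot (f : V → ℕ) (L : List (K × List V)) : ℕ :=
  ((bucketVerts L).map f).sum + 4 * L.length

theorem wp_addLayer {nbrs : V → List (V × K)} {k : ℕ} (hk : 1 ≤ k)
    {t : PeelState V K × Option (V × K)} (h : PeelInv nbrs [] t.1) (hne : t.1.layers ≠ []) :
    Wp (addLayer k t) (fun t' c => PeelInv nbrs [] t'.1 ∧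
      (Candidate t.1.W t.2 → Candidate t'.1.W t'.2) ∧ (t'.2 = none → t.2 = none) ∧
      t'.1.D = t.1.D ∧
      t'.1.stack = t.1.stack ∧ t'.1.size = t.1.size ∧
      c + 1 + t'.1.W.pot + layerPot (addCost nbrs k) t'.1.layers
        ≤ t.1.W.pot + layerPot (addCost nbrs k) t.1.layers) := by
  unfold addLayer
  obtain ⟨s, p⟩ := t
  dsimp only at h hne ⊢
  cases hL : s.layers with
  | nil => exact absurd hL hne
  | cons L rest =>
    dsimp only
    rw [wp_bind, wp_ops]
    have hb : bucketVerts s.layers = L.2 ++ bucketVerts rest := by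
      rw [hL]; rfl
    have h1 : PeelInv nbrs L.2 { s with layers := rest } := by
      refine ⟨h.work, ?_, ?_, h.nodup_stack, h.stack, h.length_stack, ?_, h.adj⟩
      · have := h.nodup_pending; rwa [List.nil_append, hb] at this
      · have := h.pending; rwa [List.nil_append, hb] at this
      · have := h.size_le; rwa [List.nil_append, hb] at this
    refine (wp_addVertices (t := ({ s with layers := rest }, p)) hk h1).mono ?_
    rintro t' c ⟨k1, k2, k0, k3, k4, k5, k6, k7⟩
    refine ⟨k1, k2, k0, k3, k5, k6, ?_⟩
    rw [k4]
    rw [hL] at hb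
    unfold layerPot
    rw [hb]
    simp only [List.map_append, List.sum_append, List.length_cons]
    dsimp only at k7
    omega

/-- A new bucket is opened only together with a new vertex, so there are never more buckets than
vertices. This bounds the number of layers in the next iteration. -/
theorem wp_push (c : K) (v : V) (S : List (K × List V)) : Wp (push c v S) (fun S' t =>
    bucketVerts S' = v :: bucketVerts S ∧
      (S.length ≤ (bucketVerts S).length → S'.length ≤ (bucketVerts S').length) ∧ t ≤ 3) := by
  unfold push
  cases S with
  | nil =>
    dsimp only
    rw [wp_ops]
    simp [bucketVerts]
  | cons B rest =>
    dsimp only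
    rw [wp_bind, wp_op]
    split_ifs
    · rw [wp_ops]
      refine ⟨by simp [bucketVerts], ?_, le_rfl⟩
      simp [bucketVerts]
      omega
    · rw [wp_ops]
      refine ⟨by simp [bucketVerts], ?_, le_rfl⟩
      simp [bucketVerts]

/-- A new deposit is needed only when `u` passes from `W` to `D`; reinsertion into `D` leaves the
members unchanged, and leaving `D` releases one. The slack `2 * ((nbrs u).length + 1) + 3` is
reserved for erasing the edge and for loop overhead in `wp_removeVertex`. -/
theorem wp_updateNbr {nbrs : V → List (V × K)} {k : ℕ} {s : PeelState V K} {u : V}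
    (h : PeelInv nbrs [] s) (hu : s.inW u = true) :
    Wp (updateNbr k s u) (fun s' c => (∃ W D, s' = { s with W := W, D := D } ∧
      WorkInv W D s.inW) ∧
      c + workPot (refreshCost nbrs k) s'.W s'.D + 2 * ((nbrs u).length + 1) + 3
        ≤ workPot (refreshCost nbrs k) s.W s.D + updateCost nbrs k u) := by
  unfold updateNbr
  have hU : updateCost nbrs k u
    = 41 * ((nbrs u).length + 1) + 2 * heapCost V + refreshCost nbrs k u := rfl
  have hl := (h.adj u).length_le
  refine (wp_lengthT (s.adj u)).bind ?_
  rintro d c1 ⟨rfl, hc1⟩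
  rw [wp_bind, wp_op]
  extract_lets jp
  have hW := h.work.heapW
  have hD := h.work.heapD
  -- The code after the choice of `zero` is treated once for both branches; `e` is the cost so far,
  -- at most that of the degree count, the upper bound and the tests.
  have hjp : ∀ (zero : Bool) (e : ℕ), e ≤ 13 * (nbrs u).length + 18 →
      Wp (jp zero) (fun s' c => (∃ W D, s' = { s with W := W, D := D } ∧ WorkInv W D s.inW) ∧
        e + c + workPot (refreshCost nbrs k) s'.W s'.D + 2 * ((nbrs u).length + 1) + 3
          ≤ workPot (refreshCost nbrs k) s.W s.D + updateCost nbrs k u) := by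
    intro zero e he
    simp only [jp]
    rw [wp_bind, wp_op]
    by_cases hDu : s.D.mem u = true
    · have hWu : s.W.mem u = false := by
        by_contra hne
        have := h.work.disjoint u (by simpa using hne)
        simp [hDu] at this
      cases zero
      · rw [if_neg (by simp)]
        refine (wp_lowerBound k (s.adj u).length (s.adj u)).bind ?_
        intro x c2 hc2
        rw [if_pos hDu]
        refine (FibHeap.wp_delete hD hDu).bind ?_
        rintro D' c3 ⟨d1, d2, d3, d4⟩
        refine (FibHeap.wp_insert d1 (v := u) (by rw [d3]; simp) x).bind ?_
        rintro D'' c4 ⟨e1, e2, e3, e4⟩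
        rw [wp_op]
        have hmem : D''.mem = s.D.mem := by
          rw [e3, d3, Function.update_idem, ← hDu, Function.update_eq_self]
        refine ⟨⟨s.W, D'', rfl, hW, e1, e2 d2, ?_, ?_⟩, ?_⟩
        · rw [hmem]; exact h.work.inW_iff
        · rw [hmem]; exact h.work.disjoint
        · unfold workPot
          dsimp only
          rw [hmem]
          omega
      · rw [if_pos rfl, if_pos hDu]
        refine (FibHeap.wp_delete hD hDu).bind ?_
        rintro D' c3 ⟨d1, d2, d3, d4⟩
        refine (FibHeap.wp_insert hW hWu 0).bind ?_
        rintro W' c4 ⟨e1, -, e3, e4⟩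
        rw [wp_ops]
        refine ⟨⟨W', D', rfl, h.work.refresh hDu e1 d1 d2 e3 d3⟩, ?_⟩
        have hs := memSum_update_false (refreshCost nbrs k) hDu
        rw [← d3] at hs
        unfold workPot
        dsimp only
        omega
    · have hWu : s.W.mem u = true := by
        rcases (h.work.inW_iff u).mp hu with h1 | h1
        · exact h1
        · exact absurd h1 hDu
      cases zero
      · rw [if_neg (by simp)]
        refine (wp_lowerBound k (s.adj u).length (s.adj u)).bind ?_
        intro x c2 hc2
        rw [if_neg hDu]
        refine (FibHeap.wp_delete hW hWu).bind ?_
        rintro W' c3 ⟨d1, -, d3, d4⟩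
        refine (FibHeap.wp_insert hD (v := u) (by simpa using hDu) x).bind ?_
        rintro D' c4 ⟨e1, e2, e3, e4⟩
        rw [wp_ops]
        refine ⟨⟨W', D', rfl, h.work.delay hWu d1 e1 (e2 h.work.rootMin) d3 e3⟩, ?_⟩
        have hs := memSum_update_true (refreshCost nbrs k) (mem := s.D.mem) (v := u)
          (by simpa using hDu)
        rw [← e3] at hs
        unfold workPot
        dsimp only
        omega
      · rw [if_pos rfl, if_neg hDu]
        refine (FibHeap.wp_decreaseKey hW hWu 0).bind ?_
        rintro W' c3 ⟨d1, d2, d3⟩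
        rw [wp_op]
        refine ⟨⟨W', s.D, rfl, d1, hD, h.work.rootMin, ?_, ?_⟩, ?_⟩
        · rw [d2]; exact h.work.inW_iff
        · rw [d2]; exact h.work.disjoint
        · unfold workPot
          dsimp only
          omega
  split_ifs
  · rw [wp_bind, wp_pure]
    refine (hjp true (c1 + 1) (by omega)).mono ?_
    rintro s' c ⟨g1, g2⟩
    exact ⟨g1, by omega⟩
  · refine (wp_upperBound k (s.adj u).length (s.adj u)).bind ?_
    intro x c2 hc2
    rw [wp_bind, wp_op]
    refine (hjp _ (c1 + (1 + (c2 + 1))) (by omega)).mono ?_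
    rintro s' c ⟨g1, g2⟩
    exact ⟨g1, by omega⟩

/-- The budget `updateCost` of each neighbour is split between the two loops: `2 * (nbrs e.1).length
+ 3` for erasing the edge, the rest for the update. The slack of 14 pays for the overhead of the
surrounding round. -/
theorem wp_removeVertex {nbrs : V → List (V × K)} {k : ℕ} {s : PeelState V K} {v : V}
    (h : PeelInv nbrs [] s) (hv : s.W.mem v = true) (x : K) :
    Wp (removeVertex k s v x) (fun s' c => PeelInv nbrs [] s' ∧
      bucketVerts s'.stack = v :: bucketVerts s.stack ∧ v ∉ bucketVerts s.stack ∧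
      s'.layers = s.layers ∧
      c + 14 + workPot (refreshCost nbrs k) s'.W s'.D
        ≤ workPot (refreshCost nbrs k) s.W s.D + removeCost nbrs k v) := by
  unfold removeVertex
  have hinv : s.inW v = true := (h.work.inW_iff v).mpr (Or.inl hv)
  have hDv : s.D.mem v = false := h.work.disjoint v hv
  have hst : v ∉ bucketVerts s.stack := fun hm => by
    have := h.stack v hm
    simp [hinv] at this
  rw [wp_bind, wp_op]
  refine (wp_push (max x s.curThres) v s.stack).bind ?_
  rintro S c1 ⟨hS1, hS2, hS3⟩
  refine (FibHeap.wp_delete h.work.heapW hv).bind ?_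
  rintro W c2 ⟨w1, -, w3, w4⟩
  rw [wp_bind, wp_op, wp_bind, wp_ops]
  set s0 : PeelState V K := { s with
      curThres := max x s.curThres
      stack := S
      W := W
      inW := Function.update s.inW v false
      wSize := s.wSize - 1
      adj := Function.update s.adj v []
      size := s.size - 1 } with hs0
  have h0 : PeelInv nbrs [] s0 := by
    refine ⟨⟨w1, h.work.heapD, h.work.rootMin, fun u => ?_, fun u => ?_⟩, h.nodup_pending,
      fun u hu => ?_, ?_, fun u hu => ?_, hS2 h.length_stack, ?_, fun u => ?_⟩
    · simp only [hs0]
      rw [w3]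
      by_cases huv : u = v
      · subst huv; simp [hDv]
      · simpa [huv] using h.work.inW_iff u
    · simp only [hs0]
      rw [w3]
      by_cases huv : u = v
      · subst huv; simp
      · simpa [huv] using h.work.disjoint u
    · have hp := h.pending u hu
      have huv : u ≠ v := by rintro rfl; simp [hinv] at hp
      simp only [hs0]
      rw [hS1, Function.update_of_ne huv]
      exact ⟨hp.1, by simp [huv, hp.2]⟩
    · simp only [hs0]
      rw [hS1]
      exact List.nodup_cons.mpr ⟨hst, h.nodup_stack⟩
    · simp only [hs0] at hu ⊢
      rw [hS1] at hu
      by_cases huv : u = v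
      · subst huv; simp
      · rw [Function.update_of_ne huv]
        exact h.stack u ((List.mem_cons.mp hu).resolve_left huv)
    · have h1 := memSum_update_false (fun _ => 1) hinv
      have h2 := h.size_le
      simp only [hs0]
      omega
    · simp only [hs0]
      by_cases huv : u = v
      · subst huv; simp
      · rw [Function.update_of_ne huv]; exact h.adj u
  refine (wp_forT_sum (fun _ s' => ∃ adj, s' = { s0 with adj := adj } ∧
    ∀ u, (adj u).Sublist (nbrs u)) (fun e => 2 * (nbrs e.1).length + 3) ?_ (s.adj v) s0
    ⟨s0.adj, rfl, h0.adj⟩).bind ?_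
  · rintro e l _ ⟨adj, rfl, ha⟩
    refine (wp_eraseEdge v (adj e.1)).bind ?_
    rintro l' c ⟨k1, k2⟩
    rw [wp_op]
    refine ⟨⟨_, rfl, fun u => ?_⟩, ?_⟩
    · by_cases hue : u = e.1
      · rw [hue, Function.update_self]; exact k1.trans (ha _)
      · rw [Function.update_of_ne hue]; exact ha u
    · have := (ha e.1).length_le
      omega
  rintro _ c3 ⟨⟨adj, rfl, ha⟩, hc3⟩
  have h1 : PeelInv nbrs [] { s0 with adj := adj } := { h0 with adj := ha }
  refine (wp_forT (fun _ s' => PeelInv nbrs [] s' ∧ ∃ W D, s' = { s0 with adj := adj, W := W, D := D })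
    (fun l s' => workPot (refreshCost nbrs k) s'.W s'.D
      + (l.map (fun e => updateCost nbrs k e.1 - (2 * (nbrs e.1).length + 3))).sum) ?_ (s.adj v) _
    ⟨h1, s0.W, s0.D, rfl⟩).mono ?_
  · rintro e l _ ⟨h2, W', D', rfl⟩
    rw [wp_bind, wp_op]
    have hU : updateCost nbrs k e.1
      = 41 * ((nbrs e.1).length + 1) + 2 * heapCost V + refreshCost nbrs k e.1 := rfl
    simp only [List.map_cons, List.sum_cons]
    split_ifs with hin
    · refine (wp_updateNbr h2 hin).mono ?_
      rintro _ c ⟨⟨W'', D'', rfl, k1⟩, k2⟩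
      refine ⟨⟨{ h2 with work := k1 }, W'', D'', rfl⟩, ?_⟩
      dsimp only at k2 ⊢
      omega
    · rw [wp_pure]
      refine ⟨⟨h2, W', D', rfl⟩, ?_⟩
      dsimp only
      omega
  · rintro _ c4 ⟨⟨h2, W', D', rfl⟩, hc4⟩
    refine ⟨h2, hS1, hst, rfl, ?_⟩
    have hsum : ((s.adj v).map (fun e => 2 * (nbrs e.1).length + 3)).sum
        + ((s.adj v).map (fun e => updateCost nbrs k e.1 - (2 * (nbrs e.1).length + 3))).sum
        = ((s.adj v).map (fun e => updateCost nbrs k e.1)).sum := by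
      rw [← List.sum_map_add]
      congr 1
      apply List.map_congr_left
      intro e _
      have hU : updateCost nbrs k e.1
        = 41 * ((nbrs e.1).length + 1) + 2 * heapCost V + refreshCost nbrs k e.1 := rfl
      omega
    have hsub : ((s.adj v).map (fun e => updateCost nbrs k e.1)).sum
        ≤ ((nbrs v).map (fun e => updateCost nbrs k e.1)).sum :=
      ((h.adj v).map _).sum_le_sum (fun _ _ => Nat.zero_le _)
    have hR : removeCost nbrs k v
      = ((nbrs v).map (fun e => updateCost nbrs k e.1)).sum + heapCost V + 30 := rfl
    simp only [List.map_nil, List.sum_nil, hs0, workPot] at hc4 ⊢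
    omega

theorem wp_findMin (h : FibHeap V K) (hi : h.Inv none) :
    Wp h.findMin (fun p c => Candidate h p ∧ c ≤ 2) := by
  unfold FibHeap.findMin
  split
  · rename_i hm
    rw [wp_op]
    exact ⟨⟨fun _ => hi.min_none hm, fun q hq => (by cases hq)⟩, by omega⟩
  · rename_i m hm
    rw [wp_ops]
    exact ⟨⟨fun hn => (by cases hn), fun q hq => (by cases hq; exact hi.min_mem m hm)⟩, le_rfl⟩

/-- Every vertex not yet on the stack still owns the budget for its removal. As a vertex is pushed
at most once, this budget is spent at most once. -/
def peelPot (nbrs : V → List (V × K)) (k : ℕ) (s : PeelState V K) : ℕ :=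
  workPot (refreshCost nbrs k) s.W s.D + layerPot (addCost nbrs k) s.layers
    + memSum (removeCost nbrs k) (fun v => decide (v ∉ bucketVerts s.stack))

/-- A round always removes a vertex that is not yet on the stack, and the `removeCost` released pays
for it; refreshes and added layers are paid for by the other parts of `peelPot`. -/
theorem wp_peelRound {nbrs : V → List (V × K)} {k : ℕ} (hk : 1 ≤ k) {s : PeelState V K}
    (h : PeelInv nbrs [] s) (hs : s.size ≠ 0) :
    Wp (peelRound k s) (fun s' c => PeelInv nbrs [] s' ∧
      c + 1 + peelPot nbrs k s' ≤ peelPot nbrs k s) := by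
  unfold peelRound
  refine (wp_findMin s.W h.work.heapW).bind ?_
  rintro p c0 ⟨hp, hc0⟩
  rw [wp_bind, wp_ops]
  extract_lets jp
  have hjp : ∀ (t : PeelState V K × Option (V × K)) (e : ℕ) (W D : FibHeap V K),
      t.1 = { s with W := W, D := D } → WorkInv W D s.inW → Candidate W t.2 →
      (t.2 = none → D.min = none) →
      e + workPot (refreshCost nbrs k) W D ≤ workPot (refreshCost nbrs k) s.W s.D + 6 →
      Wp (jp t) (fun s' c => PeelInv nbrs [] s' ∧
        e + c + 1 + peelPot nbrs k s' ≤ peelPot nbrs k s) := by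
    rintro ⟨t, p⟩ e W D rfl h1 h2 h3 h4
    dsimp only at h2 h3
    simp only [jp]
    refine (wp_whileT (fun t : PeelState V K × Option (V × K) => PeelInv nbrs [] t.1 ∧
      Candidate t.1.W t.2 ∧ (t.2 = none → t.1.D.min = none) ∧ t.1.D = D ∧ t.1.stack = s.stack ∧
      t.1.size = s.size) (fun t => t.1.W.pot + layerPot (addCost nbrs k) t.1.layers) ?_ _
      ⟨{ h with work := h1 }, h2, h3, rfl, rfl, rfl⟩).bind ?_
    · rintro t ⟨k1, k2, k3, k4, k5, k6⟩ hb
      have hne : t.1.layers ≠ [] := by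
        intro hnil
        simp [hnil] at hb
      refine (wp_addLayer hk k1 hne).mono ?_
      rintro t' c ⟨m1, m2, m3, m4, m5, m6, m7⟩
      refine ⟨⟨m1, m2 k2, ?_, m4.trans k4, m5.trans k5, m6.trans k6⟩, by omega⟩
      intro hn
      rw [m4]
      exact k3 (m3 hn)
    · rintro ⟨t, p⟩ c1 ⟨⟨k1, k2, k3, k4, k5, k6⟩, k7, k8⟩
      dsimp only at k1 k2 k3 k4 k5 k6 k7 k8 ⊢
      cases p with
      | none =>
        -- A virtual candidate means that `W` is empty, that `D` is empty since refreshing has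
        -- stopped, and that no layer remains since adding has stopped. Then `size_le` forces `size
        -- = 0`.
        exfalso
        have hW := k2.1 rfl
        have hD := k1.work.heapD.min_none (k3 rfl)
        have hlay : t.layers = [] := by
          cases hL : t.layers with
          | nil => rfl
          | cons L rest => simp [hL, below] at k7
        have hinW : memSum (fun _ => 1) t.inW = 0 := by
          unfold memSum
          rw [Finset.sum_eq_zero_iff]
          intro v hv
          have := (k1.work.inW_iff v).mp (by simpa using hv)
          simp [hW v, hD v] at this
        have := k1.size_le
        rw [hinW, hlay] at this
        simp [bucketVerts] at this
        omega
      | some q =>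
        dsimp only
        refine (wp_removeVertex k1 (k2.2 q rfl) q.2).bind ?_
        rintro s' c2 ⟨m1, m2, m3, m4, m5⟩
        rw [wp_bind, wp_ops]
        have hstk : removeCost nbrs k q.1
            + memSum (removeCost nbrs k) (fun v => decide (v ∉ bucketVerts s'.stack))
            = memSum (removeCost nbrs k) (fun v => decide (v ∉ bucketVerts s.stack)) := by
          rw [k5] at m2 m3
          rw [← memSum_update_false (removeCost nbrs k) (v := q.1)
            (mem := fun v => decide (v ∉ bucketVerts s.stack)) (by simpa using m3)]
          congr 2
          funext v
          rw [m2]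
          by_cases hv : v = q.1
          · subst hv; simp
          · simp [hv]
        have hfin : ∀ (s'' : PeelState V K) (c : ℕ), s''.stack = s'.stack → s''.D = s'.D →
            c + s''.W.pot + layerPot (addCost nbrs k) s''.layers
              ≤ s'.W.pot + layerPot (addCost nbrs k) s'.layers →
            e + (c1 + (c2 + (2 + c))) + 1 + peelPot nbrs k s'' ≤ peelPot nbrs k s := by
          intro s'' c n1 n2 n3
          unfold peelPot
          rw [n1, ← hstk]
          rw [m4] at n3
          rw [k4] at m5
          unfold workPot at h4 m5 ⊢
          rw [n2]
          omega
        split_ifs with hb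
        · have hne : s'.layers ≠ [] := by
            intro hnil
            simp [hnil] at hb
          refine (wp_addLayer (t := (s', some q)) hk m1 hne).bind ?_
          rintro t' c3 ⟨n1, -, -, n4, n5, -, n7⟩
          rw [wp_pure]
          exact ⟨n1, hfin t'.1 (c3 + 0) n5 n4 (by dsimp only at n7; omega)⟩
        · rw [wp_pure]
          exact ⟨m1, hfin s' 0 rfl rfl (by omega)⟩
  split_ifs
  · refine (wp_refKPROB hk h.work hp h.adj).bind ?_
    rintro t c1 ⟨W, D, h1, h2, h3, h4, h5⟩
    refine (hjp t (c0 + (3 + c1)) W D h1 h2 h3 h4 (by omega)).mono ?_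
    rintro s' c ⟨g1, g2⟩
    exact ⟨g1, by omega⟩
  · rename_i hb
    rw [wp_bind, wp_pure]
    refine (hjp (s, p) (c0 + 3) s.W s.D rfl h.work hp ?_ (by omega)).mono ?_
    · rintro hn
      dsimp only at hn
      subst hn
      unfold hasBelow at hb
      dsimp only at hb
      cases hm : s.D.min with
      | none => rfl
      | some u => simp [hm, below] at hb
    · rintro s' c ⟨g1, g2⟩
      exact ⟨g1, by omega⟩

theorem wp_markLayers (layers : List (K × List V)) (inP : V → Bool) :
    Wp (forT (fun (a : V → Bool) L =>
      forT (fun a v => op (Function.update a v true)) a L.2) inP layers) (fun a c =>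
        (∀ v, a v = true ↔ inP v = true ∨ v ∈ bucketVerts layers) ∧
        c ≤ 2 * (bucketVerts layers).length + 2 * layers.length + 1) := by
  induction layers generalizing inP with
  | nil => rw [forT, wp_op]; simp [bucketVerts]
  | cons L rest ih =>
    rw [forT, wp_bind, wp_op]
    refine (wp_forT_sum (fun l (a : V → Bool) => ∀ v, (a v = true ∨ v ∈ l) ↔
      (inP v = true ∨ v ∈ L.2)) (fun _ => 2) ?_ L.2 inP (fun v => Iff.rfl)).bind ?_
    · intro u l a ha
      rw [wp_op]
      refine ⟨fun v => ?_, le_rfl⟩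
      rw [← ha v]
      by_cases hv : v = u
      · subst hv; simp
      · simp [hv]
    · rintro a c ⟨h1, h2⟩
      refine (ih a).mono ?_
      rintro a' c' ⟨h3, h4⟩
      simp only [List.not_mem_nil, or_false] at h1
      simp only [List.map_const', List.sum_replicate, smul_eq_mul] at h2
      refine ⟨fun v => ?_, ?_⟩
      · rw [h3, h1]
        simp only [bucketVerts, List.flatMap_cons, List.mem_append]
        tauto
      · simp only [bucketVerts, List.flatMap_cons, List.length_append, List.length_cons] at h4 ⊢
        omega

/-- The vertices added first avoid the layers, and together they cover the core; this gives the
initial disjointness and `size_le`. The layers need not be known to lie in the `k`-core. -/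
theorem wp_peel {verts : List V} {nbrs : V → List (V × K)} (h : IsAdjacency verts nbrs) {k : ℕ}
    (hk : 1 ≤ k) {layers : List (K × List V)} (hl : (bucketVerts layers).Nodup)
    (hl' : layers.length ≤ Fintype.card V) :
    Wp (peel verts nbrs k layers) (fun S c => (bucketVerts S).Nodup ∧
      S.length ≤ Fintype.card V ∧
      c ≤ 12 * (∑ v, (nbrs v).length) + 47 * Fintype.card V + 29
        + ∑ v, addCost nbrs k v + ∑ v, removeCost nbrs k v) := by
  unfold peel
  have hn := h.length_verts
  refine (wp_kCoreT h k).bind ?_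
  rintro alive c1 ⟨-, hc1⟩
  refine (wp_filterT alive verts).bind ?_
  rintro core c2 ⟨hcore, hc2⟩
  have hnd : core.Nodup := by rw [hcore]; exact h.nodup_verts.filter _
  have hcl := length_le_of_nodup hnd
  rw [wp_bind]
  apply wp_newArray
  refine (wp_forT_sum (fun _ (a : V → List (V × K)) => ∀ v, (a v).Sublist (nbrs v))
    (fun v => 2 * (nbrs v).length + 3) ?_ core _ (fun v => List.nil_sublist _)).bind ?_
  · intro v l a ha
    refine (wp_filterT _ (nbrs v)).bind ?_
    rintro l' c ⟨rfl, hc⟩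
    rw [wp_op]
    refine ⟨fun u => ?_, by omega⟩
    by_cases hu : u = v
    · subst hu; simp
    · rw [Function.update_of_ne hu]; exact ha u
  rintro adj c3 ⟨hadj, hc3⟩
  have hc3' := sum_map_le_of_nodup hnd (fun v => 2 * (nbrs v).length + 3)
  simp only [Finset.sum_add_distrib, Finset.sum_const, Finset.card_univ, smul_eq_mul,
    ← Finset.mul_sum] at hc3'
  refine (wp_lengthT core).bind ?_
  rintro size c4 ⟨rfl, hc4⟩
  rw [wp_bind]
  apply wp_newArray
  refine (wp_markLayers layers _).bind ?_
  rintro inP c5 ⟨hinP, hc5⟩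
  have hll := length_le_of_nodup hl
  refine (wp_filterT (fun v => !inP v) core).bind ?_
  rintro PT c6 ⟨hPT, hc6⟩
  rw [wp_bind]
  apply wp_newArray
  refine (FibHeap.wp_empty verts).bind ?_
  rintro W c7 ⟨w1, -, w3, w4, w5⟩
  refine (FibHeap.wp_empty verts).bind ?_
  rintro D c8 ⟨d1, d2, d3, d4, d5⟩
  rw [wp_bind, wp_ops]
  have hpend : (PT ++ bucketVerts layers).Nodup := by
    refine List.Nodup.append (by rw [hPT]; exact hnd.filter _) hl ?_
    intro v hv hv'
    rw [hPT, List.mem_filter] at hv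
    have := (hinP v).mpr (Or.inr hv')
    simp [this] at hv
  have hzero : ∀ f : V → ℕ, memSum f (fun _ => false) = 0 := fun f => by simp [memSum]
  have hd3 : D.mem = fun _ => false := funext d3
  have hinv : PeelInv nbrs PT
      ({ adj := adj
         size := core.length
         inW := fun _ => false
         wSize := 0
         W := W
         D := D
         layers := layers
         curThres := 0
         stack := [] } : PeelState V K) := by
    refine ⟨⟨w1, d1, d2, fun v => ?_, fun v _ => d3 v⟩, hpend, fun v _ => ⟨rfl, ?_⟩, ?_, ?_, ?_, ?_,
      hadj⟩
    · simp [w3, d3]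
    · simp [bucketVerts]
    · simp [bucketVerts]
    · simp [bucketVerts]
    · simp [bucketVerts]
    · dsimp only
      rw [hzero, zero_add]
      refine (List.subperm_of_subset hnd (fun v hv => ?_)).length_le
      rw [List.mem_append]
      by_cases hv' : inP v = true
      · exact Or.inr (((hinP v).mp hv').resolve_left (by simp))
      · left
        rw [hPT, List.mem_filter]
        exact ⟨hv, by simpa using hv'⟩
  refine (wp_addVertices hk (t := (_, none)) hinv).bind ?_
  rintro t c9 ⟨t1, -, -, t2, t3, t4, -, t6⟩
  refine (wp_whileT (PeelInv nbrs []) (peelPot nbrs k) (fun s hs hb =>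
    wp_peelRound hk hs (by simpa using hb)) t.1 t1).bind ?_
  rintro s c10 ⟨s1, -, s3⟩
  rw [wp_pure]
  have hst : s.stack.length ≤ Fintype.card V :=
    s1.length_stack.trans (length_le_of_nodup s1.nodup_stack)
  refine ⟨s1.nodup_stack, hst, ?_⟩
  have hsum := sum_map_le_of_nodup hpend (addCost nbrs k)
  rw [List.map_append, List.sum_append] at hsum
  have hrem := memSum_le (removeCost nbrs k) (fun v => decide (v ∉ bucketVerts t.1.stack))
  unfold peelPot workPot layerPot at s3
  dsimp only at t2 t3 t6
  rw [t2, t3] at s3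
  rw [t4] at s3 hrem
  rw [hd3, hzero] at s3
  dsimp only at s3 hrem
  omega

/-! ### Cost of the construction of the `η`-tree -/

/-- The logarithmic height of union by size is weakened to the heap bound, so that one final
estimate absorbs both. -/
theorem le_rankBound_of_two_pow_le {m : ℕ} (h : 2 ^ m ≤ Fintype.card V) : m ≤ rankBound V := by
  have h5 : Fintype.card V < (Nat.sqrt (Fintype.card V) + 1) * (Nat.sqrt (Fintype.card V) + 1) :=
    Nat.lt_succ_sqrt _
  unfold rankBound
  generalize Nat.sqrt (Fintype.card V) = q at h5
  by_contra hlt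
  have h1 : 2 ^ (2 * (q + 1)) ≤ 2 ^ m := Nat.pow_le_pow_right (by omega) (by omega)
  have h2 : q + 1 < 2 ^ (q + 1) := Nat.lt_two_pow_self
  have h3 : 2 ^ (2 * (q + 1)) = 2 ^ (q + 1) * 2 ^ (q + 1) := by rw [two_mul, pow_add]
  have h4 := Nat.mul_le_mul h2.le h2.le
  omega

/-- A union-find forest with union by size on the vertices in `done`, with heights `ht`. -/
structure UnionFind (ht : V → ℕ) (uf : V → V) (size : V → ℕ) (done : V → Bool) : Prop where
  done_uf : ∀ v, done v = true → done (uf v) = true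
  fresh : ∀ v, done v = false → uf v = v
  lt : ∀ v, uf v ≠ v → ht v < ht (uf v)
  two_pow_le : ∀ v, done v = true → uf v = v → 2 ^ ht v ≤ size v
  le_bound : ∀ v, ht v ≤ rankBound V
  sum_le : ∑ v, (if done v = true then (if uf v = v then size v else 0) else 1) ≤ Fintype.card V

/-- A fresh vertex counted as one in `sum_le` becomes a root of size one, so the sum is unchanged.
-/
theorem UnionFind.add {ht : V → ℕ} {uf : V → V} {size : V → ℕ} {done : V → Bool}
    (h : UnionFind ht uf size done) {v : V} (hv : done v = false) :
    UnionFind (Function.update ht v 0) (Function.update uf v v) (Function.update size v 1)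
      (Function.update done v true) := by
  have huf : Function.update uf v v = uf := by
    funext u
    by_cases hu : u = v
    · subst hu; simp [h.fresh u hv]
    · simp [hu]
  rw [huf]
  constructor
  · intro u hu
    by_cases huv : u = v
    · subst huv; rw [h.fresh u hv]; simp
    · rw [Function.update_of_ne huv] at hu
      have := h.done_uf u hu
      have hne : uf u ≠ v := by rintro hne; rw [hne, hv] at this; cases this
      rwa [Function.update_of_ne hne]
  · intro u hu
    have huv : u ≠ v := by rintro rfl; simp at hu
    rw [Function.update_of_ne huv] at hu
    exact h.fresh u hu
  · intro u hu
    have huv : u ≠ v := by rintro rfl; exact hu (h.fresh u hv)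
    have hne : uf u ≠ v := by
      intro hne
      cases hd : done u with
      | false => exact hu (h.fresh u hd)
      | true =>
        have := h.done_uf u hd
        rw [hne, hv] at this
        cases this
    rw [Function.update_of_ne huv, Function.update_of_ne hne]
    exact h.lt u hu
  · intro u hu hru
    by_cases huv : u = v
    · subst huv; simp
    · rw [Function.update_of_ne huv] at hu ⊢
      rw [Function.update_of_ne huv]
      exact h.two_pow_le u hu hru
  · intro u
    by_cases huv : u = v
    · subst huv; simp
    · rw [Function.update_of_ne huv]; exact h.le_bound u
  · refine le_trans (le_of_eq ?_) h.sum_le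
    refine Finset.sum_congr rfl (fun u _ => ?_)
    by_cases huv : u = v
    · subst huv; simp [hv, h.fresh u hv]
    · simp [huv]

/-- If the height grows to `ht c + 1`, then `2 ^ (ht c + 1) ≤ 2 * size c ≤ size r + size c`. In the
sum the size of `c` is merely moved to `r`. -/
theorem UnionFind.attach {ht : V → ℕ} {uf : V → V} {size : V → ℕ} {done : V → Bool}
    (h : UnionFind ht uf size done) {c r : V} (hcr : c ≠ r) (hc : uf c = c) (hr : uf r = r)
    (hdc : done c = true) (hdr : done r = true) (hs : size c ≤ size r) :
    UnionFind (Function.update ht r (max (ht r) (ht c + 1))) (Function.update uf c r)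
      (Function.update size r (size r + size c)) done := by
  have hsum : ∑ v, (if done v = true then (if Function.update uf c r v = v then
      Function.update size r (size r + size c) v else 0) else 1) ≤ Fintype.card V := by
    have h1 : ∀ v, (if done v = true then (if Function.update uf c r v = v then
        Function.update size r (size r + size c) v else 0) else 1) + (if v = c then size c else 0)
        = (if done v = true then (if uf v = v then size v else 0) else 1)
          + (if v = r then size c else 0) := by
      intro v
      by_cases hvc : v = c
      · subst hvc; simp [hdc, hc, hcr, Ne.symm hcr]
      · by_cases hvr : v = r
        · subst hvr; simp [hdr, hr, hvc]
        · simp [hvc, hvr]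
    have h2 := Finset.sum_congr (rfl : (Finset.univ : Finset V) = Finset.univ) (fun v _ => h1 v)
    rw [Finset.sum_add_distrib, Finset.sum_add_distrib] at h2
    simp only [Finset.sum_ite_eq', Finset.mem_univ, if_true] at h2
    have := h.sum_le
    omega
  have hpow : 2 ^ max (ht r) (ht c + 1) ≤ size r + size c := by
    have h1 := h.two_pow_le r hdr hr
    have h2 := h.two_pow_le c hdc hc
    rcases max_cases (ht r) (ht c + 1) with ⟨he, -⟩ | ⟨he, -⟩ <;> rw [he]
    · omega
    · rw [pow_succ]; omega
  constructor
  · intro v hv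
    by_cases hvc : v = c
    · subst hvc; simpa using hdr
    · rw [Function.update_of_ne hvc]; exact h.done_uf v hv
  · intro v hv
    have hvc : v ≠ c := by rintro rfl; simp [hdc] at hv
    rw [Function.update_of_ne hvc]; exact h.fresh v hv
  · intro v hv
    by_cases hvc : v = c
    · subst hvc
      rw [Function.update_self, Function.update_self, Function.update_of_ne hcr]
      omega
    · rw [Function.update_of_ne hvc] at hv ⊢
      have hvr : v ≠ r := by rintro rfl; exact hv hr
      rw [Function.update_of_ne hvr]
      have := h.lt v hv
      by_cases hur : uf v = r
      · rw [hur] at this ⊢; rw [Function.update_self]; omega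
      · rwa [Function.update_of_ne hur]
  · intro v hv hrv
    have hvc : v ≠ c := by
      rintro rfl
      rw [Function.update_self] at hrv
      exact hcr hrv.symm
    rw [Function.update_of_ne hvc] at hrv
    by_cases hvr : v = r
    · subst hvr; rw [Function.update_self, Function.update_self]; exact hpow
    · rw [Function.update_of_ne hvr, Function.update_of_ne hvr]; exact h.two_pow_le v hv hrv
  · intro v
    by_cases hvr : v = r
    · subst hvr
      rw [Function.update_self]
      -- The new size of `r` is a single term of the sum, hence at most the number of vertices.
      refine le_rankBound_of_two_pow_le (hpow.trans (le_trans ?_ hsum))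
      refine le_trans (le_of_eq ?_) (Finset.single_le_sum (fun _ _ => Nat.zero_le _)
        (Finset.mem_univ v))
      simp [hdr, hr, Ne.symm hcr]
    · rw [Function.update_of_ne hvr]; exact h.le_bound v
  · exact hsum

def TreeInv (b : TreeState V K) : Prop := ∃ ht, UnionFind ht b.uf b.size b.done

/-- Heights increase strictly along the path and are bounded, which limits its length without path
compression. -/
theorem wp_findRoot {b : TreeState V K} (h : TreeInv b) (v : V) :
    Wp (findRoot b v) (fun r c => b.uf r = r ∧ (b.done v = true → b.done r = true) ∧
      c ≤ 2 * rankBound V + 1) := by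
  obtain ⟨ht, h⟩ := h
  unfold findRoot
  refine (wp_whileT (fun x => b.done v = true → b.done x = true)
    (fun x => 2 * (rankBound V - ht x)) ?_ v id).mono ?_
  · intro x hx hb
    rw [wp_op]
    have h1 := h.lt x (by simpa using hb)
    have h2 := h.le_bound (b.uf x)
    exact ⟨fun hv => h.done_uf x (hx hv), by omega⟩
  · rintro r c ⟨h1, h2, h3⟩
    exact ⟨by simpa using h2, h1, by omega⟩

theorem wp_addPending (b : TreeState V K) (r : V) : Wp (addPending b r) (fun b' c =>
    (∃ p, b' = { b with pending := p } ∧ p.length ≤ b.pending.length + 1) ∧ c ≤ 2) := by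
  unfold addPending
  split
  · rw [wp_op]; exact ⟨⟨b.pending, rfl, by omega⟩, by omega⟩
  · rw [wp_ops]; exact ⟨⟨_, rfl, by simp⟩, le_rfl⟩

theorem wp_attach {b : TreeState V K} (h : TreeInv b) {c r : V} (hcr : c ≠ r) (hc : b.uf c = c)
    (hr : b.uf r = r) (hdc : b.done c = true) (hdr : b.done r = true)
    (hs : b.size c ≤ b.size r) :
    Wp (attach b c r) (fun b' t => TreeInv b' ∧ b'.done = b.done ∧ b'.pending = b.pending ∧
      t = 6) := by
  obtain ⟨ht, h⟩ := h
  unfold attach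
  rw [wp_ops]
  exact ⟨⟨_, h.attach hcr hc hr hdc hdr hs⟩, rfl, rfl, rfl⟩

theorem wp_union {b : TreeState V K} (h : TreeInv b) {u v : V} (hu : b.done u = true)
    (hv : b.done v = true) :
    Wp (union b u v) (fun b' t => TreeInv b' ∧ b'.done = b.done ∧
      b'.pending.length ≤ b.pending.length + 2 ∧ t ≤ 4 * rankBound V + 16) := by
  unfold union
  refine (wp_findRoot h u).bind ?_
  rintro a c1 ⟨a1, a2, a3⟩
  refine (wp_findRoot h v).bind ?_
  rintro c c2 ⟨b1, b2, b3⟩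
  rw [wp_bind, wp_op]
  split_ifs with hac
  · rw [wp_pure]
    exact ⟨h, rfl, by omega, by omega⟩
  · have hne : a ≠ c := by simpa using hac
    refine (wp_addPending b a).bind ?_
    rintro _ c3 ⟨⟨p, rfl, hp⟩, hc3⟩
    refine (wp_addPending _ c).bind ?_
    rintro _ c4 ⟨⟨p', rfl, hp'⟩, hc4⟩
    rw [wp_bind, wp_ops]
    have h' : TreeInv { b with pending := p' } := h
    dsimp only at hp'
    split_ifs with hlt
    · refine (wp_attach h' hne a1 b1 (a2 hu) (b2 hv) ?_).mono ?_
      · have := of_decide_eq_true hlt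
        exact this.le
      · rintro b' t ⟨k1, k2, k3, rfl⟩
        exact ⟨k1, k2, by rw [k3]; dsimp only; omega, by omega⟩
    · refine (wp_attach h' hne.symm b1 a1 (b2 hv) (a2 hu) ?_).mono ?_
      · simpa using hlt
      · rintro b' t ⟨k1, k2, k3, rfl⟩
        exact ⟨k1, k2, by rw [k3]; dsimp only; omega, by omega⟩

/-- An edge pays for one union and for the two pending nodes it may create, which are treated later
at `2 * rankBound V + 5` each. -/
def treeCost (nbrs : V → List (V × K)) (v : V) : ℕ :=
  ((nbrs v).length + 1) * (8 * rankBound V + 28)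

/-- The length of `pending` serves as potential in the first loop, since the third loop runs over
that list. -/
theorem wp_treeBucket {nbrs : V → List (V × K)} {b : TreeState V K} {B : K × List V}
    (h : TreeInv b) (hB : B.2.Nodup) (hd : ∀ v ∈ B.2, b.done v = false) :
    Wp (treeBucket nbrs b B) (fun b' c => TreeInv b' ∧
      (∀ v, b'.done v = true → b.done v = true ∨ v ∈ B.2) ∧
      c ≤ (B.2.map (treeCost nbrs)).sum + 4) := by
  unfold treeBucket
  rw [wp_bind, wp_op]
  set R := rankBound V with hR
  have hcost : ∀ v, treeCost nbrs v = (nbrs v).length * (8 * R + 28) + (8 * R + 28) := fun v => by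
    unfold treeCost; ring
  refine (wp_forT (fun l (b' : TreeState V K) => TreeInv b' ∧ l.Nodup ∧
      (∀ v ∈ l, b'.done v = false ∧ v ∈ B.2) ∧
      ∀ v, b'.done v = true → b.done v = true ∨ v ∈ B.2)
    (fun l b' => (l.map (fun v => (nbrs v).length * (8 * R + 28) + 6)).sum
      + b'.pending.length * (2 * R + 5)) ?_ B.2 { b with pending := [] }
    ⟨h, hB, fun v hv => ⟨hd v hv, hv⟩, fun v hv => Or.inl hv⟩).bind ?_
  · rintro v l b' ⟨⟨ht, h1⟩, h2, h3, h4⟩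
    rw [wp_bind, wp_ops]
    obtain ⟨hv1, hv2⟩ := h3 v (by simp)
    have hnd := List.nodup_cons.mp h2
    refine (wp_forT (fun _ (b'' : TreeState V K) => TreeInv b'' ∧
        b''.done = Function.update b'.done v true)
      (fun es b'' => es.length * (8 * R + 28) + b''.pending.length * (2 * R + 5)) ?_ (nbrs v) _
      ⟨⟨_, h1.add hv1⟩, rfl⟩).mono ?_
    · rintro e es b'' ⟨k1, k2⟩
      rw [wp_bind, wp_op]
      simp only [List.length_cons, add_mul, one_mul]
      split_ifs with hde
      · refine (wp_union k1 (by rw [k2]; simp) hde).mono ?_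
        rintro b3 c ⟨m1, m2, m3, m4⟩
        refine ⟨⟨m1, m2.trans k2⟩, ?_⟩
        have := Nat.mul_le_mul_right (2 * R + 5) m3
        rw [add_mul] at this
        omega
      · rw [wp_pure]
        exact ⟨⟨k1, k2⟩, by omega⟩
    · rintro b'' c ⟨⟨k1, k2⟩, k3⟩
      refine ⟨⟨k1, hnd.2, fun w hw => ?_, fun w hw => ?_⟩, ?_⟩
      · have hwv : w ≠ v := by rintro rfl; exact hnd.1 hw
        rw [k2, Function.update_of_ne hwv]
        exact h3 w (by simp [hw])
      · rw [k2] at hw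
        by_cases hwv : w = v
        · subst hwv; exact Or.inr hv2
        · rw [Function.update_of_ne hwv] at hw
          exact h4 w hw
      · simp only [List.map_cons, List.sum_cons, List.length_nil, zero_mul] at k3 ⊢
        omega
  rintro b1 c1 ⟨⟨h1, -, -, h2⟩, h3⟩
  refine (wp_forT_sum (fun _ (b' : TreeState V K) => TreeInv b' ∧ b'.done = b1.done ∧
    b'.pending = b1.pending) (fun _ => 2 * R + 8) ?_ B.2 b1 ⟨h1, rfl, rfl⟩).bind ?_
  · rintro v l b' ⟨k1, k2, k3⟩
    refine (wp_findRoot k1 v).bind ?_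
    rintro r c ⟨-, -, hc⟩
    split
    · rw [wp_ops]
      exact ⟨⟨k1, k2, k3⟩, by omega⟩
    · rw [wp_ops]
      exact ⟨⟨k1, k2, k3⟩, by omega⟩
  rintro b2 c2 ⟨⟨k1, k2, k3⟩, k4⟩
  refine (wp_forT_sum (fun _ (b' : TreeState V K) => TreeInv b' ∧ b'.done = b1.done)
    (fun _ => 2 * R + 5) ?_ b2.pending b2 ⟨k1, k2⟩).mono ?_
  · rintro y l b' ⟨m1, m2⟩
    refine (wp_findRoot m1 y).bind ?_
    rintro r c ⟨-, -, hc⟩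
    rw [wp_ops]
    exact ⟨⟨m1, m2⟩, by omega⟩
  · rintro b3 c3 ⟨⟨m1, m2⟩, m3⟩
    refine ⟨m1, fun v hv => h2 v (by rw [← m2]; exact hv), ?_⟩
    have hsum : (B.2.map (fun v => (nbrs v).length * (8 * R + 28) + 6)).sum
        + (B.2.map (fun _ => 2 * R + 8)).sum ≤ (B.2.map (treeCost nbrs)).sum := by
      rw [← List.sum_map_add]
      refine List.sum_le_sum (fun v _ => ?_)
      rw [hcost]
      omega
    rw [k3] at m3
    simp only [List.map_nil, List.sum_nil, List.length_nil, zero_mul] at h3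
    rw [List.map_const', List.sum_replicate, smul_eq_mul] at m3
    omega

theorem wp_etaTree {verts : List V} {nbrs : V → List (V × K)} (h : IsAdjacency verts nbrs)
    {stack : List (K × List V)} (hs : (bucketVerts stack).Nodup)
    (hs' : stack.length ≤ Fintype.card V) :
    Wp (etaTree verts nbrs stack) (fun _ c =>
      c ≤ 13 * Fintype.card V + 8 + ∑ v, treeCost nbrs v) := by
  unfold etaTree
  have hn := h.length_verts
  rw [wp_bind]
  apply wp_newArray
  rw [wp_bind]
  apply wp_newArray
  rw [wp_bind]
  apply wp_newArray
  refine (wp_forT_sum (fun _ (a : V → V) => a = id) (fun _ => 2) ?_ verts id rfl).bind ?_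
  · rintro v l a rfl
    rw [wp_op]
    refine ⟨?_, le_rfl⟩
    funext u
    by_cases hu : u = v
    · subst hu; simp
    · simp [hu]
  rintro uf c1 ⟨rfl, hc1⟩
  rw [wp_bind]
  apply wp_newArray
  rw [wp_bind]
  apply wp_newArray
  rw [wp_bind]
  apply wp_newArray
  refine (wp_forT_sum (fun l (b : TreeState V K) => TreeInv b ∧ (bucketVerts l).Nodup ∧
      ∀ v ∈ bucketVerts l, b.done v = false) (fun B => (B.2.map (treeCost nbrs)).sum + 5) ?_ stack _
    ⟨⟨fun _ => 0, ?_⟩, hs, fun _ _ => rfl⟩).bind ?_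
  · rintro B l b ⟨h1, h2, h3⟩
    have h2' : (B.2 ++ bucketVerts l).Nodup := h2
    have h3' : ∀ v ∈ B.2 ++ bucketVerts l, b.done v = false := h3
    obtain ⟨n1, n2, n3⟩ := List.nodup_append.mp h2'
    refine (wp_treeBucket h1 n1 (fun v hv => h3' v (by simp [hv]))).mono ?_
    rintro b' c ⟨k1, k2, k3⟩
    refine ⟨⟨k1, n2, fun v hv => ?_⟩, by omega⟩
    by_contra hne
    rcases k2 v (by simpa using hne) with hk | hk
    · rw [h3' v (by simp [hv])] at hk; cases hk
    · exact n3 v hk v hv rfl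
  · constructor <;> simp
  · rintro b c2 ⟨-, h2⟩
    rw [wp_pure]
    have hsum := sum_map_le_of_nodup hs (treeCost nbrs)
    have hflat : (stack.map (fun B => (B.2.map (treeCost nbrs)).sum + 5)).sum
        = ((bucketVerts stack).map (treeCost nbrs)).sum + 5 * stack.length := by
      generalize stack = l
      induction l with
      | nil => simp [bucketVerts]
      | cons B l ih =>
        simp only [bucketVerts, List.flatMap_cons, List.map_append, List.sum_append,
          List.map_cons, List.sum_cons, List.length_cons] at ih ⊢
        omega
    simp only [List.map_const', List.sum_replicate, smul_eq_mul] at hc1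
    omega

end OptiUCF

namespace OptiUCF

section Total

variable {V K : Type} [DecidableEq V] [Fintype V] [Field K] [LinearOrder K]

/-! ### The total cost -/

/-- A bound on the cost of each iteration with `k ≤ m`. -/
def iterationCost (nbrs : V → List (V × K)) (m : ℕ) : ℕ :=
  12 * (∑ v, (nbrs v).length) + 62 * Fintype.card V + 39
    + ∑ v, addCost nbrs m v + ∑ v, removeCost nbrs m v + ∑ v, treeCost nbrs v

theorem addCost_mono (nbrs : V → List (V × K)) {k m : ℕ} (h : k ≤ m) (v : V) :
    addCost nbrs k v ≤ addCost nbrs m v := by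
  unfold addCost; gcongr

theorem removeCost_mono (nbrs : V → List (V × K)) {k m : ℕ} (h : k ≤ m) (v : V) :
    removeCost nbrs k v ≤ removeCost nbrs m v := by
  have : ((nbrs v).map (fun e => updateCost nbrs k e.1)).sum
      ≤ ((nbrs v).map (fun e => updateCost nbrs m e.1)).sum :=
    List.sum_le_sum (fun e _ => by unfold updateCost refreshCost; gcongr)
  unfold removeCost
  omega

/-- Between iterations only two facts are handed on: the buckets are disjoint and there are at most
`|V|` of them. Reversing the stack preserves both. -/
theorem wp_iterations {verts : List V} {nbrs : V → List (V × K)} (h : IsAdjacency verts nbrs)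
    (m : ℕ) : ∀ (k : ℕ) (layers : List (K × List V)) (acc : List (ℕ × EtaTree V K)), k ≤ m →
      (bucketVerts layers).Nodup → layers.length ≤ Fintype.card V →
      Wp (iterations verts nbrs k layers acc) (fun _ c => c ≤ k * iterationCost nbrs m + 1)
  | 0, _, _, _, _, _ => by rw [iterations, wp_op]; omega
  | k + 1, layers, acc, hk, h1, h2 => by
    rw [iterations]
    refine (wp_peel h (Nat.le_add_left 1 k) h1 h2).bind ?_
    rintro stack c1 ⟨hs, hs', hc1⟩
    refine (wp_etaTree h hs hs').bind ?_
    rintro tree c2 hc2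
    refine (wp_reverseT stack).bind ?_
    rintro layers' c3 ⟨rfl, hc3⟩
    rw [wp_bind, wp_op]
    have hnd : (bucketVerts stack.reverse).Nodup :=
      ((List.reverse_perm stack).flatMap_right Prod.snd).nodup_iff.mpr hs
    refine (wp_iterations h m k _ _ (by omega) hnd (by simpa using hs')).mono ?_
    intro _ c4 hc4
    have ha : ∑ v, addCost nbrs (k + 1) v ≤ ∑ v, addCost nbrs m v :=
      Finset.sum_le_sum (fun v _ => addCost_mono nbrs hk v)
    have hr : ∑ v, removeCost nbrs (k + 1) v ≤ ∑ v, removeCost nbrs m v :=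
      Finset.sum_le_sum (fun v _ => removeCost_mono nbrs hk v)
    rw [add_mul, one_mul]
    have hi : iterationCost nbrs m = 12 * (∑ v, (nbrs v).length) + 62 * Fintype.card V + 39
      + ∑ v, addCost nbrs m v + ∑ v, removeCost nbrs m v + ∑ v, treeCost nbrs v := rfl
    omega

/-- Double counting: every vertex occurs in as many adjacency lists as its own one has entries. -/
theorem IsAdjacency.sum_nbrs {verts : List V} {nbrs : V → List (V × K)}
    (h : IsAdjacency verts nbrs) (f : V → ℕ) :
    ∑ v, ((nbrs v).map (fun e => f e.1)).sum = ∑ u, (nbrs u).length * f u := by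
  have h1 : ∀ v, ((nbrs v).map (fun e => f e.1)).sum
      = ∑ u ∈ ((nbrs v).map Prod.fst).toFinset, f u := fun v => by
    rw [List.sum_toFinset f (h.nodup_nbrs v), List.map_map]
    rfl
  simp_rw [h1]
  rw [Finset.sum_comm' (t' := Finset.univ) (s' := fun u => ((nbrs u).map Prod.fst).toFinset)]
  · refine Finset.sum_congr rfl (fun u _ => ?_)
    rw [Finset.sum_const, List.toFinset_card_of_nodup (h.nodup_nbrs u), List.length_map,
      smul_eq_mul]
  · intro u v
    simp only [Finset.mem_univ, true_and, and_true, List.mem_toFinset]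
    exact ⟨h.symm u v, h.symm v u⟩

/-- After double counting, a vertex of degree `d` costs a multiple of `m d ^ 2 + d r + n`, where `r`
is of order `√n`. The mixed term is at most `d ^ 2 + r ^ 2`, and `r ^ 2 = O(n)`. -/
theorem iterationCost_le [Nonempty V] {verts : List V} {nbrs : V → List (V × K)}
    (h : IsAdjacency verts nbrs) {m : ℕ} (hm : 1 ≤ m) (hmn : m ≤ Fintype.card V) :
    iterationCost nbrs m
      ≤ 100000 * (m * ∑ v, (nbrs v).length ^ 2 + Fintype.card V ^ 2) := by
  have hn : 1 ≤ Fintype.card V := Fintype.card_pos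
  have hR := sq_rankBound_le V
  have hrem : ∑ v, removeCost nbrs m v
      = ∑ v, ((nbrs v).length * updateCost nbrs m v + heapCost V + 30) := by
    unfold removeCost
    simp only [Finset.sum_add_distrib]
    rw [h.sum_nbrs (updateCost nbrs m)]
  have hkey : ∀ v, 12 * (nbrs v).length + 62 + addCost nbrs m v
      + ((nbrs v).length * updateCost nbrs m v + heapCost V + 30) + treeCost nbrs v
      ≤ 99000 * (m * (nbrs v).length ^ 2 + Fintype.card V) := by
    intro v
    unfold updateCost addCost refreshCost treeCost heapCost
    generalize hr : rankBound V + 1 = r at *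
    have hr' : 8 * rankBound V + 28 ≤ 28 * r := by omega
    generalize (nbrs v).length = d
    generalize Fintype.card V = n at *
    have h1 : d ≤ d ^ 2 := Nat.le_self_pow two_ne_zero d
    have h2 : r ≤ r ^ 2 := Nat.le_self_pow two_ne_zero r
    -- This is the inequality that makes a rank bound of order `√n` sufficient.
    have h3 : 2 * (d * r) ≤ d ^ 2 + r ^ 2 := by
      have := two_mul_le_add_sq d r
      rwa [mul_assoc] at this
    have h4 : d ^ 2 ≤ m * d ^ 2 := Nat.le_mul_of_pos_left _ hm
    have h5 : m * d ≤ m * d ^ 2 := Nat.mul_le_mul_left m h1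
    have h6 : (d + 1) * (8 * rankBound V + 28) ≤ (d + 1) * (28 * r) :=
      Nat.mul_le_mul_left _ hr'
    refine (Nat.add_le_add_left h6 _).trans ?_
    ring_nf at *
    omega
  have hsum : iterationCost nbrs m = ∑ v, (12 * (nbrs v).length + 62 + addCost nbrs m v
      + ((nbrs v).length * updateCost nbrs m v + heapCost V + 30) + treeCost nbrs v) + 39 := by
    unfold iterationCost
    rw [hrem]
    simp only [Finset.sum_add_distrib, Finset.mul_sum, Finset.sum_const, Finset.card_univ,
      smul_eq_mul]
    ring
  have hle := Finset.sum_le_sum (s := Finset.univ) (fun v _ => hkey v)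
  have hright : ∑ v, 99000 * (m * (nbrs v).length ^ 2 + Fintype.card V)
      = 99000 * (m * ∑ v, (nbrs v).length ^ 2 + Fintype.card V ^ 2) := by
    rw [← Finset.mul_sum, Finset.sum_add_distrib, ← Finset.mul_sum, Finset.sum_const,
      Finset.card_univ, smul_eq_mul, ← sq]
  rw [hright] at hle
  have hn2 : 1 ≤ Fintype.card V ^ 2 := Nat.one_le_pow _ _ hn
  rw [hsum]
  omega

/-- In `hcore` the lists are arbitrary permutations of the input because `k_max` is computed on the
sorted ones. -/
theorem wp_optiUCF [Nonempty V] {verts : List V} {nbrs : V → List (V × K)}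
    (h : IsAdjacency verts nbrs) {m : ℕ} (hm : 1 ≤ m) (hmn : m ≤ Fintype.card V)
    (hcore : ∀ (nbrs' : V → List (V × K)), (∀ v, (nbrs' v).Perm (nbrs v)) →
      ∀ (k : ℕ) (alive : V → Bool), (∃ w, alive w = true) →
      (∀ w, alive w = true → k ≤ (((nbrs' w).map Prod.fst).toFinset.filter
        (fun u => alive u = true)).card) → k ≤ m) :
    Wp (optiUCF verts nbrs) (fun _ c =>
      c ≤ 200000 * (m * (m * ∑ v, (nbrs v).length ^ 2 + Fintype.card V ^ 2))) := by
  unfold optiUCF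
  refine (wp_sortAdj verts nbrs h.mem_verts).bind ?_
  rintro nbrs' c1 ⟨hp, hc1⟩
  have h' : IsAdjacency verts nbrs' := by
    refine ⟨h.nodup_verts, h.mem_verts, fun u => ?_, fun u v huv => ?_⟩
    · exact ((hp u).map Prod.fst).nodup_iff.mpr (h.nodup_nbrs u)
    · rw [((hp v).map Prod.fst).mem_iff]
      rw [((hp u).map Prod.fst).mem_iff] at huv
      exact h.symm u v huv
  have hlen : ∀ v, (nbrs' v).length = (nbrs v).length := fun v => (hp v).length_eq
  refine (wp_kMaxT h' m (hcore nbrs' hp)).bind ?_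
  rintro kmax c2 ⟨hk, hc2⟩
  refine (wp_iterations h' m kmax [] [] hk (by simp [bucketVerts]) (Nat.zero_le _)).mono ?_
  intro _ c3 hc3
  have hi := iterationCost_le h' hm hmn
  simp only [hlen] at hc2 hi
  have hn : 1 ≤ Fintype.card V := Fintype.card_pos
  rw [h.sum_map, h.length_verts] at hc1
  have hS : ∑ v, (nbrs v).length ≤ ∑ v, (nbrs v).length ^ 2 :=
    Finset.sum_le_sum (fun v _ => Nat.le_self_pow two_ne_zero _)
  have hs1 : ∑ v, ((nbrs v).length * (2 * (nbrs v).length + 3) + 3)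
      ≤ 5 * ∑ v, (nbrs v).length ^ 2 + 3 * Fintype.card V := by
    have : ∀ v, (nbrs v).length * (2 * (nbrs v).length + 3) + 3
        ≤ 5 * (nbrs v).length ^ 2 + 3 := fun v => by
      have := Nat.le_self_pow two_ne_zero (nbrs v).length
      nlinarith
    refine (Finset.sum_le_sum (fun v _ => this v)).trans (le_of_eq ?_)
    rw [Finset.sum_add_distrib, ← Finset.mul_sum, Finset.sum_const, Finset.card_univ, smul_eq_mul,
      mul_comm (Fintype.card V)]
  generalize ∑ v, (nbrs v).length = S at *
  generalize ∑ v, (nbrs v).length ^ 2 = T at *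
  generalize Fintype.card V = n at *
  have hk' : kmax * iterationCost nbrs' m ≤ m * (100000 * (m * T + n ^ 2)) := Nat.mul_le_mul hk hi
  have hT : T ≤ m * T := Nat.le_mul_of_pos_left _ hm
  have hn2 : n ≤ n ^ 2 := Nat.le_self_pow two_ne_zero n
  have hX : m * T + n ^ 2 ≤ m * (m * T + n ^ 2) := Nat.le_mul_of_pos_left _ hm
  have hk2 : (m + 1) * (10 * S + 15 * n + 10) ≤ 2 * m * (35 * (m * T + n ^ 2)) :=
    Nat.mul_le_mul (by omega) (by omega)
  have e1 : m * (100000 * (m * T + n ^ 2)) = 100000 * (m * (m * T + n ^ 2)) := by ring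
  have e2 : 2 * m * (35 * (m * T + n ^ 2)) = 70 * (m * (m * T + n ^ 2)) := by ring
  omega

end Total

end OptiUCF

/-! ### From the uncertain graph to the input of the program -/

namespace UncertainGraph

variable {V : Type} [Fintype V] [DecidableEq V] (𝒢 : UncertainGraph V)

theorem le_card_of_kCore_nonempty {k : ℕ} (h : (𝒢.kCore k).Nonempty) : k ≤ Fintype.card V := by
  obtain ⟨u, C, hC, hu⟩ := h
  refine (hC u hu).trans ?_
  rw [← Nat.card_eq_fintype_card]
  exact Set.ncard_le_card _

theorem le_kMax {k : ℕ} (h : (𝒢.kCore k).Nonempty) : k ≤ 𝒢.kMax :=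
  le_csSup ⟨Fintype.card V, fun _ hj => 𝒢.le_card_of_kCore_nonempty hj⟩ h

/-- The endpoints of an edge form a set of minimum degree one. The final estimates need `1 ≤ k_max`
to absorb terms without this factor. -/
theorem one_le_kMax (h : 𝒢.graph.edgeSet.Nonempty) : 1 ≤ 𝒢.kMax := by
  apply 𝒢.le_kMax
  obtain ⟨e, he⟩ := h
  induction e using Sym2.ind with
  | _ u v =>
    rw [SimpleGraph.mem_edgeSet] at he
    refine ⟨u, {u, v}, fun w hw => ?_, by simp⟩
    rw [Nat.one_le_iff_ne_zero, Ne, Set.ncard_eq_zero (Set.toFinite _),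
      ← Ne, ← Set.nonempty_iff_ne_empty]
    rcases hw with rfl | hw
    · exact ⟨v, he, by simp⟩
    · rw [Set.mem_singleton_iff] at hw
      subst hw
      exact ⟨u, he.symm, by simp⟩

theorem kMax_le_card : 𝒢.kMax ≤ Fintype.card V :=
  csSup_le' fun _ hk => 𝒢.le_card_of_kCore_nonempty hk

variable {𝒢}

theorem AdjacencyLists.mem_map_fst (I : 𝒢.AdjacencyLists) (u v : V) :
    v ∈ (I.nbrs u).map Prod.fst ↔ 𝒢.graph.Adj u v := by
  rw [List.mem_map]
  constructor
  · rintro ⟨⟨w, q⟩, h, rfl⟩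
    exact ((I.mem_nbrs _ _ _).mp h).1
  · intro h
    exact ⟨(v, _), (I.mem_nbrs u v _).mpr ⟨h, rfl⟩, rfl⟩

theorem AdjacencyLists.isAdjacency (I : 𝒢.AdjacencyLists) :
    OptiUCF.IsAdjacency I.verts I.nbrs :=
  ⟨I.nodup_verts, I.mem_verts, I.nodup_nbrs, fun u v h => by
    rw [I.mem_map_fst] at h ⊢; exact h.symm⟩

theorem AdjacencyLists.length_nbrs (I : 𝒢.AdjacencyLists) (u : V) :
    (I.nbrs u).length = 𝒢.deg u := by
  have : 𝒢.graph.neighborSet u = (((I.nbrs u).map Prod.fst).toFinset : Set V) := by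
    ext v
    rw [Finset.mem_coe, List.mem_toFinset, I.mem_map_fst, SimpleGraph.mem_neighborSet]
  unfold deg
  rw [this, Set.ncard_coe_finset, List.toFinset_card_of_nodup (I.nodup_nbrs u), List.length_map]

/-- The surviving set is itself one of the sets whose union is the `k`-core. -/
theorem AdjacencyLists.le_kMax (I : 𝒢.AdjacencyLists) {nbrs : V → List (V × ℝ)}
    (hp : ∀ v, (nbrs v).Perm (I.nbrs v)) {k : ℕ} {alive : V → Bool} (hne : ∃ w, alive w = true)
    (h : ∀ w, alive w = true → k ≤ (((nbrs w).map Prod.fst).toFinset.filter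
        (fun u => alive u = true)).card) : k ≤ 𝒢.kMax := by
  apply 𝒢.le_kMax
  obtain ⟨w, hw⟩ := hne
  refine ⟨w, {u | alive u = true}, fun u hu => (h u hu).trans ?_, hw⟩
  rw [← Set.ncard_coe_finset]
  refine Set.ncard_le_ncard (fun x hx => ?_) (Set.toFinite _)
  simp only [Finset.coe_filter, Set.mem_ofPred_eq, List.mem_toFinset] at hx
  rw [((hp u).map Prod.fst).mem_iff, I.mem_map_fst] at hx
  exact hx

end UncertainGraph

theorem theorem2 :
    ∃ C : ℝ, ∀ (V : Type) [Fintype V] [DecidableEq V] (𝒢 : UncertainGraph V)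
      (I : 𝒢.AdjacencyLists), 𝒢.graph.edgeSet.Nonempty →
      ∃ t : ℕ, (OptiUCF.optiUCF I.verts I.nbrs).cost = t ∧
        (t : ℝ) ≤ C * (𝒢.kMax * (Fintype.card V : ℝ) ^ 2 * Real.log (Fintype.card V)
          + ∑ u : V, (𝒢.kMax : ℝ) ^ 2 * (𝒢.deg u : ℝ) ^ 2
          + (𝒢.kMax : ℝ) ^ 2 * 𝒢.edgeCount) := by
  -- Twice the constant of `wp_optiUCF`, because of `log |V| ≥ 1 / 2`.
  refine ⟨400000, fun V _ _ 𝒢 I he => ?_⟩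
  have hcard : 2 ≤ Fintype.card V := by
    obtain ⟨e, he⟩ := he
    induction e using Sym2.ind with
    | _ u v => exact Fintype.one_lt_card_iff.mpr ⟨u, v, SimpleGraph.Adj.ne he⟩
  have : Nonempty V := Fintype.card_pos_iff.mp (by omega)
  obtain ⟨t, ht, hle⟩ := OptiUCF.wp_optiUCF I.isAdjacency (𝒢.one_le_kMax he) 𝒢.kMax_le_card
    (fun _ hp _ _ hne h => I.le_kMax hp hne h)
  refine ⟨t, ht, ?_⟩
  simp only [I.length_nbrs] at hle
  have hle' : (t : ℝ) ≤ 200000 * (𝒢.kMax * (𝒢.kMax * ∑ v, (𝒢.deg v : ℝ) ^ 2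
      + (Fintype.card V : ℝ) ^ 2)) := by exact_mod_cast hle
  -- An edge has two distinct endpoints, so `|V| ≥ 2` and the logarithm is bounded away from zero.
  have hlog : (1 : ℝ) / 2 ≤ Real.log (Fintype.card V) := by
    have h1 : Real.log 2 ≤ Real.log (Fintype.card V) :=
      Real.log_le_log (by norm_num) (by exact_mod_cast hcard)
    have := Real.log_two_gt_d9
    linarith
  have hkn : (0 : ℝ) ≤ 𝒢.kMax * (Fintype.card V : ℝ) ^ 2 := by positivity
  have hsum : (0 : ℝ) ≤ (𝒢.kMax : ℝ) ^ 2 * ∑ v, (𝒢.deg v : ℝ) ^ 2 := by positivity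
  have hedge : (0 : ℝ) ≤ (𝒢.kMax : ℝ) ^ 2 * 𝒢.edgeCount := by positivity
  have hmul := mul_le_mul_of_nonneg_left hlog hkn
  rw [← Finset.mul_sum]
  nlinarith
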